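/- **[Random distances between two adjacent unit hexagons]** A unit hexagon is a (filled) regular hexagon in the Euclidean plane with side length $1$. Let $H$ and $H'$ be two unit hexagons that share a side, i.e. $H\cap H'$ is a side of both. Let $X$ and $Y$ be independent random points, $X$ uniformly distributed on $H$ and $Y$ uniformly distributed on $H'$, and let $D=|X-Y|$ be their Euclidean distance. Then $D$ has the (nonnegative) probability density function $$ f(d)=\frac{2}{9}d\begin{cases} \left(\frac{\pi}{9\sqrt3}-\frac13\right)d^2+\frac43 d & 0\le d\le 1\\[4pt] \frac{2}{\sqrt3}(d^2+2)\sin^{-1}\frac{\sqrt3}{2d}-\left(\frac13+\frac{5\pi}{9\sqrt3}\right)d^2+\frac{11}{6}\sqrt{4d^2-3}-\frac{4\pi}{3\sqrt3}-\frac12 & 1\le d\le\sqrt3\\[4pt] \frac{2}{\sqrt3}\left(\frac{d^2}{3}-2\right)\sin^{-1}\frac{\sqrt3}{2d}-\frac{4}{\sqrt3}\left(\frac{d^2}{3}+4\right)\sin^{-1}\frac{\sqrt3}{d}+\left(1+\frac{\pi}{3\sqrt3}\right)d^2-\frac76\sqrt{4d^2-3}-\frac{20}{3}\sqrt{d^2-3}+\frac{8\pi}{\sqrt3}+\frac92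 & \sqrt3\le d\le 2\\[4pt] \frac{2}{\sqrt3}\left(\frac{d^2}{3}-2\right)\sin^{-1}\frac{\sqrt3}{2d}+\left(\frac13-\frac{\pi}{9\sqrt3}\right)d^2-\frac76\sqrt{4d^2-3}+\frac{8\pi}{3\sqrt3}+\frac12 & 2\le d\le\sqrt7\\[4pt] -\frac{2}{\sqrt3}\left(\frac{d^2}{3}+6\right)\sin^{-1}\frac{3\sqrt3}{2d}-\frac{4}{\sqrt3}\left(\frac{d^2}{3}+2\right)\sin^{-1}\frac{\sqrt3}{d}+\left(\frac13+\frac{5\pi}{9\sqrt3}\right)d^2-4\sqrt{d^2-3}-\frac{11}{6}\sqrt{4d^2-27}+\frac{28\pi}{3\sqrt3}+\frac92 & \sqrt7\le d\le 3\\[4pt] \frac{2}{\sqrt3}\left(\frac{d^2}{3}+12\right)\sin^{-1}\frac{3\sqrt3}{2d}-\frac{4}{\sqrt3}\left(\frac{d^2}{3}+2\right)\sin^{-1}\frac{\sqrt3}{d}+\left(\frac{\pi}{9\sqrt3}-\frac13\right)d^2-4\sqrt{d^2-3}+\frac{19}{6}\sqrt{4d^2-27}-\frac{8\pi}{3\sqrt3}-\frac92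 & 3\le d\le 2\sqrt3\\[4pt] \frac{2}{\sqrt3}\left(\frac{d^2}{3}+12\right)\left(\sin^{-1}\frac{3\sqrt3}{2d}+\sin^{-1}\frac{2\sqrt3}{d}\right)-\left(\frac23+\frac{4\pi}{9\sqrt3}\right)d^2+\frac{19}{6}\sqrt{4d^2-27}+\frac{16}{3}\sqrt{d^2-12}-\frac{16\pi}{\sqrt3}-\frac{25}{2} & 2\sqrt3\le d\le\sqrt{13}\\[4pt] 0 & \text{otherwise,} \end{cases} $$ and for every real $d$ its cumulative distribution function $F(d)=P(D\le d)$ is $$ F(d)=\begin{cases} 0 & d<0\\[4pt] \frac1{18}\left(\frac{\pi}{9\sqrt3}-\frac13\right)d^4+\frac{8}{81}d^3 & 0\le d\le1\\[4pt] \frac{1}{9\sqrt3}(d^4+4d^2)\sin^{-1}\frac{\sqrt3}{2d}-\left(\frac{5\pi}{162\sqrt3}+\frac1{54}\right)d^4-\left(\frac{4\pi}{27\sqrt3}+\frac1{18}\right)d^2+\frac{94d^2+15}{648}\sqrt{4d^2-3}-\frac1{72} & 1\le d\le\sqrt3\\[4pt] \frac{1}{9\sqrt3}\left(\frac{d^4}{3}-4d^2\right)\sin^{-1}\frac{\sqrt3}{2d}-\frac{2}{9\sqrt3}\left(\frac{d^4}{3}+8d^2\right)\sin^{-1}\frac{\sqrt3}{d}+\left(\frac{\pi}{54\sqrt3}+\frac1{18}\right)d^4+\left(\frac{8\pi}{9\sqrt3}+\frac12\right)d^2-\frac{2d^2+1}{24}\sqrt{4d^2-3}-\frac{14d^2+12}{27}\sqrt{d^2-3}-\frac{7}{72}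 & \sqrt3\le d\le2\\[4pt] \frac{1}{9\sqrt3}\left(\frac{d^4}{3}-4d^2\right)\sin^{-1}\frac{\sqrt3}{2d}-\left(\frac{\pi}{162\sqrt3}-\frac1{54}\right)d^4+\left(\frac{8\pi}{27\sqrt3}+\frac1{18}\right)d^2-\frac{2d^2+1}{24}\sqrt{4d^2-3}-\frac{53}{216} & 2\le d\le\sqrt7\\[4pt] -\frac{2}{9\sqrt3}\left(\frac{d^4}{3}+4d^2\right)\sin^{-1}\frac{\sqrt3}{d}-\frac{1}{3\sqrt3}\left(\frac{d^4}{9}+4d^2\right)\sin^{-1}\frac{3\sqrt3}{2d}+\left(\frac{5\pi}{162\sqrt3}+\frac1{54}\right)d^4+\left(\frac{28\pi}{27\sqrt3}+\frac12\right)d^2-\frac{26d^2+12}{81}\sqrt{d^2-3}-\frac{94d^2+135}{648}\sqrt{4d^2-27}-\frac{101}{216} & \sqrt7\le d\le3\\[4pt] -\frac{2}{9\sqrt3}\left(\frac{d^4}{3}+4d^2\right)\sin^{-1}\frac{\sqrt3}{d}+\frac{1}{3\sqrt3}\left(\frac{d^4}{9}+8d^2\right)\sin^{-1}\frac{3\sqrt3}{2d}+\left(\frac{\pi}{162\sqrt3}-\frac1{54}\right)d^4-\left(\frac{8\pi}{27\sqrt3}+\frac12\right)d^2-\frac{26d^2+12}{81}\sqrt{d^2-3}+\frac{158d^2+351}{648}\sqrt{4d^2-27}-\frac{263}{216}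 & 3\le d\le2\sqrt3\\[4pt] \frac{1}{3\sqrt3}\left(\frac{d^4}{9}+8d^2\right)\left(\sin^{-1}\frac{3\sqrt3}{2d}+\sin^{-1}\frac{2\sqrt3}{d}\right)-\left(\frac{2\pi}{81\sqrt3}+\frac1{27}\right)d^4-\left(\frac{16\pi}{9\sqrt3}+\frac{25}{18}\right)d^2+\frac{158d^2+351}{648}\sqrt{4d^2-27}+\frac{34d^2+96}{81}\sqrt{d^2-12}+\frac{25}{216} & 2\sqrt3\le d\le\sqrt{13}\\[4pt] 1 & d>\sqrt{13}. \end{cases} $$ -/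

import Mathlib

open MeasureTheory ProbabilityTheory

/-- The vertices, in cyclic order, of the regular hexagon with side length `1`, centre `c` and
orientation `θ` in the Euclidean plane. -/
noncomputable def hexVertex (c : EuclideanSpace ℝ (Fin 2)) (θ : ℝ) (k : Fin 6) :
    EuclideanSpace ℝ (Fin 2) :=
  c + !₂[Real.cos (θ + (k : ℕ) * (Real.pi / 3)), Real.sin (θ + (k : ℕ) * (Real.pi / 3))]

/-- The unit hexagon (a filled, closed region). -/
noncomputable def unitHexagon (c : EuclideanSpace ℝ (Fin 2)) (θ : ℝ) :
    Set (EuclideanSpace ℝ (Fin 2)) :=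
  convexHull ℝ (Set.range (hexVertex c θ))

/-- The sides of the unit hexagon; `k + 1` is taken modulo `6`. -/
noncomputable def hexSide (c : EuclideanSpace ℝ (Fin 2)) (θ : ℝ) (k : Fin 6) :
    Set (EuclideanSpace ℝ (Fin 2)) :=
  segment ℝ (hexVertex c θ k) (hexVertex c θ (k + 1))

/-- Two unit hexagons are adjacent along a common side: their intersection is a side of both. -/
def ShareSide (c : EuclideanSpace ℝ (Fin 2)) (θ : ℝ)
    (c' : EuclideanSpace ℝ (Fin 2)) (θ' : ℝ) : Prop :=
  ∃ i j : Fin 6, unitHexagon c θ ∩ unitHexagon c' θ' = hexSide c θ i ∧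
    unitHexagon c θ ∩ unitHexagon c' θ' = hexSide c' θ' j

/-- The claimed density of the distance. -/
noncomputable def hexPairPDF (d : ℝ) : ℝ :=
  if d < 0 then 0
  else if d ≤ 1 then
    2 / 9 * d * ((Real.pi / (9 * √3) - 1 / 3) * d ^ 2 + 4 / 3 * d)
  else if d ≤ √3 then
    2 / 9 * d * (2 / √3 * (d ^ 2 + 2) * Real.arcsin (√3 / (2 * d))
      - (1 / 3 + 5 * Real.pi / (9 * √3)) * d ^ 2 + 11 / 6 * √(4 * d ^ 2 - 3)
      - 4 * Real.pi / (3 * √3) - 1 / 2)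
  else if d ≤ 2 then
    2 / 9 * d * (2 / √3 * (d ^ 2 / 3 - 2) * Real.arcsin (√3 / (2 * d))
      - 4 / √3 * (d ^ 2 / 3 + 4) * Real.arcsin (√3 / d)
      + (1 + Real.pi / (3 * √3)) * d ^ 2 - 7 / 6 * √(4 * d ^ 2 - 3)
      - 20 / 3 * √(d ^ 2 - 3) + 8 * Real.pi / √3 + 9 / 2)
  else if d ≤ √7 then
    2 / 9 * d * (2 / √3 * (d ^ 2 / 3 - 2) * Real.arcsin (√3 / (2 * d))
      + (1 / 3 - Real.pi / (9 * √3)) * d ^ 2 - 7 / 6 * √(4 * d ^ 2 - 3)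
      + 8 * Real.pi / (3 * √3) + 1 / 2)
  else if d ≤ 3 then
    2 / 9 * d * (-(2 / √3) * (d ^ 2 / 3 + 6) * Real.arcsin (3 * √3 / (2 * d))
      - 4 / √3 * (d ^ 2 / 3 + 2) * Real.arcsin (√3 / d)
      + (1 / 3 + 5 * Real.pi / (9 * √3)) * d ^ 2 - 4 * √(d ^ 2 - 3)
      - 11 / 6 * √(4 * d ^ 2 - 27) + 28 * Real.pi / (3 * √3) + 9 / 2)
  else if d ≤ 2 * √3 then
    2 / 9 * d * (2 / √3 * (d ^ 2 / 3 + 12) * Real.arcsin (3 * √3 / (2 * d))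
      - 4 / √3 * (d ^ 2 / 3 + 2) * Real.arcsin (√3 / d)
      + (Real.pi / (9 * √3) - 1 / 3) * d ^ 2 - 4 * √(d ^ 2 - 3)
      + 19 / 6 * √(4 * d ^ 2 - 27) - 8 * Real.pi / (3 * √3) - 9 / 2)
  else if d ≤ √13 then
    2 / 9 * d * (2 / √3 * (d ^ 2 / 3 + 12)
        * (Real.arcsin (3 * √3 / (2 * d)) + Real.arcsin (2 * √3 / d))
      - (2 / 3 + 4 * Real.pi / (9 * √3)) * d ^ 2 + 19 / 6 * √(4 * d ^ 2 - 27)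
      + 16 / 3 * √(d ^ 2 - 12) - 16 * Real.pi / √3 - 25 / 2)
  else 0

/-- The claimed cumulative distribution function of the distance. -/
noncomputable def hexPairCDF (d : ℝ) : ℝ :=
  if d < 0 then 0
  else if d ≤ 1 then
    1 / 18 * (Real.pi / (9 * √3) - 1 / 3) * d ^ 4 + 8 / 81 * d ^ 3
  else if d ≤ √3 then
    1 / (9 * √3) * (d ^ 4 + 4 * d ^ 2) * Real.arcsin (√3 / (2 * d))
      - (5 * Real.pi / (162 * √3) + 1 / 54) * d ^ 4
      - (4 * Real.pi / (27 * √3) + 1 / 18) * d ^ 2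
      + (94 * d ^ 2 + 15) / 648 * √(4 * d ^ 2 - 3) - 1 / 72
  else if d ≤ 2 then
    1 / (9 * √3) * (d ^ 4 / 3 - 4 * d ^ 2) * Real.arcsin (√3 / (2 * d))
      - 2 / (9 * √3) * (d ^ 4 / 3 + 8 * d ^ 2) * Real.arcsin (√3 / d)
      + (Real.pi / (54 * √3) + 1 / 18) * d ^ 4
      + (8 * Real.pi / (9 * √3) + 1 / 2) * d ^ 2
      - (2 * d ^ 2 + 1) / 24 * √(4 * d ^ 2 - 3)
      - (14 * d ^ 2 + 12) / 27 * √(d ^ 2 - 3) - 7 / 72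
  else if d ≤ √7 then
    1 / (9 * √3) * (d ^ 4 / 3 - 4 * d ^ 2) * Real.arcsin (√3 / (2 * d))
      - (Real.pi / (162 * √3) - 1 / 54) * d ^ 4
      + (8 * Real.pi / (27 * √3) + 1 / 18) * d ^ 2
      - (2 * d ^ 2 + 1) / 24 * √(4 * d ^ 2 - 3) - 53 / 216
  else if d ≤ 3 then
    -(2 / (9 * √3)) * (d ^ 4 / 3 + 4 * d ^ 2) * Real.arcsin (√3 / d)
      - 1 / (3 * √3) * (d ^ 4 / 9 + 4 * d ^ 2) * Real.arcsin (3 * √3 / (2 * d))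
      + (5 * Real.pi / (162 * √3) + 1 / 54) * d ^ 4
      + (28 * Real.pi / (27 * √3) + 1 / 2) * d ^ 2
      - (26 * d ^ 2 + 12) / 81 * √(d ^ 2 - 3)
      - (94 * d ^ 2 + 135) / 648 * √(4 * d ^ 2 - 27) - 101 / 216
  else if d ≤ 2 * √3 then
    -(2 / (9 * √3)) * (d ^ 4 / 3 + 4 * d ^ 2) * Real.arcsin (√3 / d)
      + 1 / (3 * √3) * (d ^ 4 / 9 + 8 * d ^ 2) * Real.arcsin (3 * √3 / (2 * d))
      + (Real.pi / (162 * √3) - 1 / 54) * d ^ 4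
      - (8 * Real.pi / (27 * √3) + 1 / 2) * d ^ 2
      - (26 * d ^ 2 + 12) / 81 * √(d ^ 2 - 3)
      + (158 * d ^ 2 + 351) / 648 * √(4 * d ^ 2 - 27) - 263 / 216
  else if d ≤ √13 then
    1 / (3 * √3) * (d ^ 4 / 9 + 8 * d ^ 2)
        * (Real.arcsin (3 * √3 / (2 * d)) + Real.arcsin (2 * √3 / d))
      - (2 * Real.pi / (81 * √3) + 1 / 27) * d ^ 4
      - (16 * Real.pi / (9 * √3) + 25 / 18) * d ^ 2
      + (158 * d ^ 2 + 351) / 648 * √(4 * d ^ 2 - 27)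
      + (34 * d ^ 2 + 96) / 81 * √(d ^ 2 - 12) + 25 / 216
  else 1

/-! Use the basis of two unit vectors at angle π/3 pointing from the centre of `H` to the ends of
the common side. In these lattice coordinates `(p, q)` the squared length is `p² + pq + q²`, `H`
becomes `latticeHexagon`, of area 3, and `H'` is its translate by `(1, 1)`
(`ShareSide.exists_latticeMap`). A linear map scales all areas by one factor, so uniform laws stay
uniform (`cond_image_latticeMap`). Hence `Y - X` has density `overlapArea (p - 1) (q - 1) / 9` in
lattice coordinates.

The overlap of the hexagon with a translate is supported on a hexagon of side 2, which twelve unit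
rhombi tile: six around its centre and six at its vertices. On each rhombus the overlap is a
quadratic polynomial, and by symmetry only `overlapArea_kite` and `overlapArea_corner` need
computing.

Put orthonormal axes along the line of centres, so that `p = x/√3 + y` and `q = x/√3 - y`, and pass
to polar coordinates. The density of `D` at `d` is then `4√3/27 · d` times the integral of the
overlap over a quarter circle of radius `d`: the overlap is even in the angle and vanishes where
`cos θ ≤ 0`. The circle crosses the rhombi at angles given by arcsines, a quadratic polynomial has
an explicit primitive along the circle (`hasDerivAt_arcPrimitive`), and the order of the crossings
changes only when the circle passes through a vertex of the tiling. These radii are the breakpoints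
1, √3, 2, √7, 3, 2√3, √13. The outcome is `exists_hasArcIntegral`, from which both nonnegativity and
the law follow.

For the distribution function, each of its pieces is a primitive of the matching piece of the
density, and neighbouring pieces agree at the breakpoints (`integral_hexPairPDF`). Above √13 the
value 1 comes from the total mass of the law, not from evaluating a formula. -/

/-! ### Overlap area of a hexagon with its translates -/

/-- The unit hexagon in lattice coordinates. -/
def latticeHexagon : Set (ℝ × ℝ) :=
  {w | |w.1| ≤ 1 ∧ |w.2| ≤ 1 ∧ |w.1 + w.2| ≤ 1}

/-- Area, in lattice coordinates, of the overlap of the hexagon with its translate. -/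
noncomputable def overlapArea (p q : ℝ) : ℝ :=
  volume.real {w : ℝ × ℝ | w ∈ latticeHexagon ∧ w + (p, q) ∈ latticeHexagon}

lemma isClosed_latticeHexagon : IsClosed latticeHexagon := by
  have h1 : IsClosed {w : ℝ × ℝ | |w.1| ≤ 1} := isClosed_le (by fun_prop) (by fun_prop)
  have h2 : IsClosed {w : ℝ × ℝ | |w.2| ≤ 1} := isClosed_le (by fun_prop) (by fun_prop)
  have h3 : IsClosed {w : ℝ × ℝ | |w.1 + w.2| ≤ 1} := isClosed_le (by fun_prop) (by fun_prop)
  exact h1.inter (h2.inter h3)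

lemma measurableSet_latticeHexagon : MeasurableSet latticeHexagon :=
  isClosed_latticeHexagon.measurableSet

lemma isBounded_latticeHexagon : Bornology.IsBounded latticeHexagon := by
  refine (Metric.isBounded_closedBall (x := (0 : ℝ × ℝ)) (r := 1)).subset ?_
  rintro ⟨a, b⟩ ⟨h1, h2, -⟩
  simp only [Metric.mem_closedBall, dist_zero_right, Prod.norm_def, Real.norm_eq_abs]
  exact max_le h1 h2

lemma measurableSet_overlap (p q : ℝ) :
    MeasurableSet {w : ℝ × ℝ | w ∈ latticeHexagon ∧ w + (p, q) ∈ latticeHexagon} :=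
  measurableSet_latticeHexagon.inter
    (measurableSet_latticeHexagon.preimage (measurable_id.add_const _))

lemma overlapArea_neg (p q : ℝ) : overlapArea (-p) (-q) = overlapArea p q := by
  unfold overlapArea
  rw [← (Measure.measurePreserving_neg (volume : Measure (ℝ × ℝ))).measureReal_preimage
    (measurableSet_overlap p q).nullMeasurableSet]
  congr 1
  ext ⟨a, b⟩
  simp only [latticeHexagon, Set.mem_ofPred_eq, Set.mem_preimage, Prod.fst_add, Prod.snd_add,
    Prod.neg_mk]
  rw [← abs_neg a, ← abs_neg b, ← abs_neg (a + b), ← abs_neg (a + -p), ← abs_neg (b + -q),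
    ← abs_neg (a + -p + (b + -q))]
  ring_nf

lemma overlapArea_swap (p q : ℝ) : overlapArea q p = overlapArea p q := by
  unfold overlapArea
  have hs : MeasurePreserving (Prod.swap : ℝ × ℝ → ℝ × ℝ) volume volume :=
    Measure.measurePreserving_swap
  rw [← hs.measureReal_preimage (measurableSet_overlap p q).nullMeasurableSet]
  congr 1
  ext ⟨a, b⟩
  simp only [latticeHexagon, Set.mem_ofPred_eq, Set.mem_preimage, Prod.swap_prod_mk,
    Prod.mk_add_mk]
  rw [add_comm b a, add_comm (b + p) (a + q)]
  tauto

lemma measurePreserving_shear :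
    MeasurePreserving (fun w : ℝ × ℝ => (w.1 + w.2, -w.2)) volume volume := by
  have h1 : MeasurePreserving (fun w : ℝ × ℝ => (w.2, w.2 + w.1))
      (volume.prod volume) (volume.prod volume) := measurePreserving_prod_add_swap volume volume
  have h2 := (Measure.measurePreserving_swap (μ := (volume : Measure ℝ)) (ν := volume)).comp h1
  have h3 := ((MeasurePreserving.id (volume : Measure ℝ)).prod
    (Measure.measurePreserving_neg (volume : Measure ℝ))).comp h2
  have he : (fun w : ℝ × ℝ => (w.1 + w.2, -w.2)) =
      Prod.map id Neg.neg ∘ Prod.swap ∘ fun w : ℝ × ℝ => (w.2, w.2 + w.1) := by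
    ext w <;> simp [add_comm]
  rw [he]
  exact h3

/-- The map `(p, q) ↦ (p + q, -q)` is a reflection for the form `p² + pq + q²` that preserves the
hexagon. Together with the swap it generates the full symmetry group of order 12, so one rhombus of
each kind determines the overlap everywhere. -/
lemma overlapArea_shear (p q : ℝ) : overlapArea (p + q) (-q) = overlapArea p q := by
  unfold overlapArea
  rw [← measurePreserving_shear.measureReal_preimage
    (measurableSet_overlap (p + q) (-q)).nullMeasurableSet]
  congr 1
  ext ⟨a, b⟩
  simp only [latticeHexagon, Set.mem_ofPred_eq, Set.mem_preimage, Prod.mk_add_mk]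
  rw [show -b + -q = -(b + q) by ring, abs_neg, abs_neg,
    show a + b + (p + q) + -(b + q) = a + p by ring,
    show a + b + -b = a by ring, show a + b + (p + q) = a + p + (b + q) by ring]
  tauto

lemma volumeReal_between {α β : ℝ} (hαβ : α ≤ β) {lo hi : ℝ → ℝ} (hlo : Continuous lo)
    (hhi : Continuous hi) (hle : ∀ a ∈ Set.Icc α β, lo a ≤ hi a) :
    volume.real {w : ℝ × ℝ | w.1 ∈ Set.Icc α β ∧ w.2 ∈ Set.Icc (lo w.1) (hi w.1)} =
      ∫ a in α..β, (hi a - lo a) := by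
  rw [intervalIntegral.integral_of_le hαβ, ← integral_Icc_eq_integral_Ioc]
  have h := volume_regionBetween_eq_integral (μ := (volume : Measure ℝ)) (s := Set.Icc α β)
    (hlo.integrableOn_Icc) (hhi.integrableOn_Icc) measurableSet_Icc hle
  have hlo' : MeasurableSet {w : ℝ × ℝ | lo w.1 ≤ w.2} :=
    (isClosed_le (by fun_prop) (by fun_prop)).measurableSet
  have hhi' : MeasurableSet {w : ℝ × ℝ | w.2 ≤ hi w.1} :=
    (isClosed_le (by fun_prop) (by fun_prop)).measurableSet
  have hms : MeasurableSet {w : ℝ × ℝ | w.1 ∈ Set.Icc α β ∧ w.2 ∈ Set.Icc (lo w.1) (hi w.1)} :=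
    (measurable_fst measurableSet_Icc).inter (hlo'.inter hhi')
  rw [measureReal_def, Measure.volume_eq_prod, Measure.prod_apply hms]
  have h2 : ∀ a, volume (Prod.mk a ⁻¹' {w : ℝ × ℝ | w.1 ∈ Set.Icc α β ∧
      w.2 ∈ Set.Icc (lo w.1) (hi w.1)}) =
      (Set.Icc α β).indicator (fun a => ENNReal.ofReal (hi a - lo a)) a := by
    intro a
    by_cases ha : a ∈ Set.Icc α β
    · rw [Set.indicator_of_mem ha, ← Real.volume_Icc]
      congr 1
      ext b
      simp only [Set.mem_preimage, Set.mem_ofPred_eq]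
      tauto
    · rw [Set.indicator_of_notMem ha]
      convert measure_empty (μ := (volume : Measure ℝ))
      ext b
      simp only [Set.mem_preimage, Set.mem_ofPred_eq, Set.mem_empty_iff_false]
      tauto
  simp_rw [h2]
  rw [lintegral_indicator measurableSet_Icc, ← ofReal_integral_eq_lintegral_ofReal,
    ENNReal.toReal_ofReal]
  · exact setIntegral_nonneg measurableSet_Icc fun a ha => sub_nonneg.2 (hle a ha)
  · exact (hhi.sub hlo).integrableOn_Icc
  · exact (ae_restrict_iff' measurableSet_Icc).2 (.of_forall fun a ha => sub_nonneg.2 (hle a ha))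

/-- The intersection is a box of sides `2 - p` and `2 - q` from which the constraints on `a + b` cut
two opposite corner triangles, each of area 1/2. -/
lemma overlapArea_kite {p q : ℝ} (hp0 : 0 ≤ p) (hp1 : p ≤ 1) (hq0 : 0 ≤ q) (hq1 : q ≤ 1) :
    overlapArea p q = (2 - p) * (2 - q) - 1 := by
  rw [← overlapArea_neg]
  unfold overlapArea
  have hset : {w : ℝ × ℝ | w ∈ latticeHexagon ∧ w + (-p, -q) ∈ latticeHexagon} =
      {w : ℝ × ℝ | w.1 ∈ Set.Icc (p - 1) 1 ∧
        w.2 ∈ Set.Icc (max (q - 1) (p + q - 1 - w.1)) (min 1 (1 - w.1))} := by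
    ext ⟨a, b⟩
    simp only [latticeHexagon, Set.mem_ofPred_eq, Prod.mk_add_mk, abs_le, Set.mem_Icc, max_le_iff,
      le_min_iff]
    constructor
    · rintro ⟨⟨h1, h2, h3⟩, h4, h5, h6⟩
      refine ⟨⟨?_, ?_⟩, ⟨?_, ?_⟩, ?_, ?_⟩ <;> linarith
    · rintro ⟨⟨h1, h2⟩, ⟨h3, h4⟩, h5, h6⟩
      refine ⟨⟨⟨?_, ?_⟩, ⟨?_, ?_⟩, ?_, ?_⟩, ⟨?_, ?_⟩, ⟨?_, ?_⟩, ?_, ?_⟩ <;> linarith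
  rw [hset, volumeReal_between (by linarith) (lo := fun a => max (q - 1) (p + q - 1 - a))
    (hi := fun a => min 1 (1 - a)) (by fun_prop) (by fun_prop)]
  -- The upper boundary bends at `a = 0` and the lower one at `a = p`, hence the split of the
  -- integral there.
  · have hc : Continuous fun a : ℝ => min 1 (1 - a) - max (q - 1) (p + q - 1 - a) := by fun_prop
    rw [← intervalIntegral.integral_add_adjacent_intervals (b := 0)
        (hc.intervalIntegrable _ _) (hc.intervalIntegrable _ _),
      ← intervalIntegral.integral_add_adjacent_intervals (a := 0) (b := p)
        (hc.intervalIntegrable _ _) (hc.intervalIntegrable _ _)]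
    have e1 : ∫ a in (p - 1)..0, (min 1 (1 - a) - max (q - 1) (p + q - 1 - a)) =
        ∫ a in (p - 1)..0, ((2 - p - q) + a) := by
      refine intervalIntegral.integral_congr fun a ha => ?_
      rw [Set.uIcc_of_le (by linarith)] at ha
      rw [min_eq_left (by linarith [ha.2]), max_eq_right (by linarith [ha.2])]
      ring
    have e2 : ∫ a in 0..p, (min 1 (1 - a) - max (q - 1) (p + q - 1 - a)) =
        ∫ a in 0..p, (2 - p - q) := by
      refine intervalIntegral.integral_congr fun a ha => ?_
      rw [Set.uIcc_of_le (by linarith)] at ha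
      rw [min_eq_right (by linarith [ha.1]), max_eq_right (by linarith [ha.2])]
      ring
    have e3 : ∫ a in p..1, (min 1 (1 - a) - max (q - 1) (p + q - 1 - a)) =
        ∫ a in p..1, ((2 - q) + -1 * a) := by
      refine intervalIntegral.integral_congr fun a ha => ?_
      rw [Set.uIcc_of_le (by linarith)] at ha
      rw [min_eq_right (by linarith [ha.1]), max_eq_left (by linarith [ha.1])]
      ring
    rw [e1, e2, e3, intervalIntegral.integral_add (by simp) (by simp),
      intervalIntegral.integral_add (by simp)
        ((by fun_prop : Continuous fun a : ℝ => -1 * a).intervalIntegrable _ _),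
      intervalIntegral.integral_const_mul]
    simp only [intervalIntegral.integral_const, integral_id, smul_eq_mul]
    ring
  · rintro a ⟨h1, h2⟩
    simp only [max_le_iff, le_min_iff]
    refine ⟨⟨?_, ?_⟩, ?_, ?_⟩ <;> linarith

/-- Here only the constraints on `a` and on `a + b` are active, and the intersection is a
parallelogram. -/
lemma overlapArea_corner {p q : ℝ} (hp1 : 1 ≤ p) (hp2 : p ≤ 2) (hr1 : 1 ≤ p + q)
    (hr2 : p + q ≤ 2) : overlapArea p q = (2 - p) * (2 - (p + q)) := by
  rw [← overlapArea_neg]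
  unfold overlapArea
  have hset : {w : ℝ × ℝ | w ∈ latticeHexagon ∧ w + (-p, -q) ∈ latticeHexagon} =
      {w : ℝ × ℝ | w.1 ∈ Set.Icc (p - 1) 1 ∧
        w.2 ∈ Set.Icc (p + q - 1 - w.1) (1 - w.1)} := by
    ext ⟨a, b⟩
    simp only [latticeHexagon, Set.mem_ofPred_eq, Prod.mk_add_mk, abs_le, Set.mem_Icc]
    constructor
    · rintro ⟨⟨h1, h2, h3⟩, h4, h5, h6⟩
      refine ⟨⟨?_, ?_⟩, ⟨?_, ?_⟩⟩ <;> linarith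
    · rintro ⟨⟨h1, h2⟩, h3, h4⟩
      refine ⟨⟨⟨?_, ?_⟩, ⟨?_, ?_⟩, ?_, ?_⟩, ⟨?_, ?_⟩, ⟨?_, ?_⟩, ?_, ?_⟩ <;> linarith
  rw [hset, volumeReal_between (by linarith) (lo := fun a => p + q - 1 - a)
    (hi := fun a => 1 - a) (by fun_prop) (by fun_prop)]
  · have e : ∀ a : ℝ, 1 - a - (p + q - 1 - a) = 2 - (p + q) := fun a => by ring
    simp only [e, intervalIntegral.integral_const, smul_eq_mul]
    ring
  · rintro a -
    linarith

lemma overlapArea_eq_zero_of_two_le {p q : ℝ} (hp : 2 ≤ p) : overlapArea p q = 0 := by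
  unfold overlapArea
  have hsub : {w : ℝ × ℝ | w ∈ latticeHexagon ∧ w + (p, q) ∈ latticeHexagon} ⊆
      {(-1 : ℝ)} ×ˢ Set.univ := by
    rintro ⟨a, b⟩ ⟨⟨h1, -⟩, h2, -⟩
    simp only [Prod.mk_add_mk, abs_le] at h1 h2
    exact ⟨by simp only [Set.mem_singleton_iff]; linarith, trivial⟩
  refine measureReal_mono_null hsub ?_ ?_
  · rw [measureReal_def, Measure.volume_eq_prod, Measure.prod_prod]; simp
  · rw [Measure.volume_eq_prod, Measure.prod_prod]; simp

lemma overlapArea_nonneg (p q : ℝ) : 0 ≤ overlapArea p q := measureReal_nonneg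

/-- This and the following lemmas list the rhombi that meet the upper half of the picture, with the
origin moved so that `(p, q)` are the coordinates of `Y - X`. The centre of the support is then `(1,
1)`, and the origin is the midpoint of one of its edges. -/
lemma overlapArea_kite_right {p q : ℝ} (h1 : 1 ≤ p) (h2 : p ≤ 2) (h3 : 1 ≤ q) (h4 : q ≤ 2) :
    overlapArea (p - 1) (q - 1) = (3 - p) * (3 - q) - 1 := by
  rw [overlapArea_kite (by linarith) (by linarith) (by linarith) (by linarith)]; ring

lemma overlapArea_kite_upper_right {p q : ℝ} (h1 : 0 ≤ q) (h2 : q ≤ 1) (h3 : 2 ≤ p + q)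
    (h4 : p + q ≤ 3) : overlapArea (p - 1) (q - 1) = (4 - (p + q)) * (1 + q) - 1 := by
  rw [← overlapArea_shear,
    overlapArea_kite (by linarith) (by linarith) (by linarith) (by linarith)]; ring

lemma overlapArea_kite_upper_left {p q : ℝ} (h1 : 1 ≤ p) (h2 : p ≤ 2) (h3 : 1 ≤ p + q)
    (h4 : p + q ≤ 2) : overlapArea (p - 1) (q - 1) = (3 - p) * (p + q) - 1 := by
  rw [← overlapArea_swap, ← overlapArea_shear, ← overlapArea_neg, neg_neg, ← overlapArea_swap,
    overlapArea_kite (by linarith) (by linarith) (by linarith) (by linarith)]; ring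

lemma overlapArea_kite_left {p q : ℝ} (h1 : 0 ≤ p) (h2 : p ≤ 1) (h3 : 0 ≤ q) (h4 : q ≤ 1) :
    overlapArea (p - 1) (q - 1) = (1 + p) * (1 + q) - 1 := by
  rw [← overlapArea_neg,
    overlapArea_kite (by linarith) (by linarith) (by linarith) (by linarith)]; ring

lemma overlapArea_corner_right {p q : ℝ} (h1 : 2 ≤ p) (h2 : p ≤ 3) (h3 : 3 ≤ p + q)
    (h4 : p + q ≤ 4) : overlapArea (p - 1) (q - 1) = (3 - p) * (4 - (p + q)) := by
  rw [overlapArea_corner (by linarith) (by linarith) (by linarith) (by linarith)]; ring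

lemma overlapArea_corner_top {p q : ℝ} (h1 : 2 ≤ p) (h2 : p ≤ 3) (h3 : -1 ≤ q)
    (h4 : q ≤ 0) : overlapArea (p - 1) (q - 1) = (3 - p) * (1 + q) := by
  rw [← overlapArea_shear, ← overlapArea_swap,
    overlapArea_corner (by linarith) (by linarith) (by linarith) (by linarith)]; ring

lemma overlapArea_corner_left {p q : ℝ} (h1 : 0 ≤ p + q) (h2 : p + q ≤ 1) (h3 : -1 ≤ q)
    (h4 : q ≤ 0) : overlapArea (p - 1) (q - 1) = (1 + q) * (p + q) := by
  rw [← overlapArea_neg, ← overlapArea_swap,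
    overlapArea_corner (by linarith) (by linarith) (by linarith) (by linarith)]; ring

lemma overlapArea_eq_zero_of_three_le {p : ℝ} (q : ℝ) (h : 3 ≤ p) :
    overlapArea (p - 1) (q - 1) = 0 := overlapArea_eq_zero_of_two_le (by linarith)

lemma overlapArea_eq_zero_of_le_neg_one (p : ℝ) {q : ℝ} (h : q ≤ -1) :
    overlapArea (p - 1) (q - 1) = 0 := by
  rw [← overlapArea_swap, ← overlapArea_neg, overlapArea_eq_zero_of_two_le (by linarith)]

lemma overlapArea_eq_zero_of_four_le {p q : ℝ} (h : 4 ≤ p + q) :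
    overlapArea (p - 1) (q - 1) = 0 := by
  rw [← overlapArea_shear, overlapArea_eq_zero_of_two_le (by linarith)]

lemma overlapArea_eq_zero_of_nonpos {p q : ℝ} (h : p + q ≤ 0) :
    overlapArea (p - 1) (q - 1) = 0 := by
  rw [← overlapArea_neg, ← overlapArea_shear, overlapArea_eq_zero_of_two_le (by linarith)]

/-! ### Circular arcs and their crossings with the tiling -/

/-- Overlap of two adjacent hexagons displaced by the vector with polar coordinates `(d, θ)`. -/
noncomputable def polarOverlap (d θ : ℝ) : ℝ :=
  overlapArea (d * Real.cos θ / √3 + d * Real.sin θ - 1)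
    (d * Real.cos θ / √3 - d * Real.sin θ - 1)

/-- The integral of the overlap along an arc exists and has the value `I`. -/
def HasArcIntegral (d a b I : ℝ) : Prop :=
  IntervalIntegrable (polarOverlap d) volume a b ∧ ∫ θ in a..b, polarOverlap d θ = I

lemma HasArcIntegral.trans {d a b c I J : ℝ} (h : HasArcIntegral d a b I)
    (h' : HasArcIntegral d b c J) : HasArcIntegral d a c (I + J) :=
  ⟨h.1.trans h'.1, by
    rw [← intervalIntegral.integral_add_adjacent_intervals h.1 h'.1, h.2, h'.2]⟩

/-- The point at distance `d` from the origin and polar angle `θ` in the first quadrant is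
`(√3 * ξ, y)`. -/
structure IsArcPoint (d θ ξ y : ℝ) : Prop where
  nonneg : 0 ≤ θ
  le_half_pi : θ ≤ Real.pi / 2
  cos_eq : d * Real.cos θ = √3 * ξ
  sin_eq : d * Real.sin θ = y

/-- The crossing angles are shifted arcsines, for which crude bounds are immediate but the first
quadrant is not; the signs of the coordinates place the angle there. -/
lemma IsArcPoint.of_mem_Ioo {d θ ξ y : ℝ} (hd : 0 < d) (h1 : -Real.pi < θ) (h2 : θ < Real.pi)
    (hc : d * Real.cos θ = √3 * ξ) (hs : d * Real.sin θ = y) (hξ : 0 ≤ ξ) (hy : 0 ≤ y) :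
    IsArcPoint d θ ξ y := by
  have hcos : 0 ≤ Real.cos θ := by
    by_contra! h
    have := mul_neg_of_pos_of_neg hd h
    rw [hc] at this
    have : 0 ≤ √3 * ξ := by positivity
    linarith
  have hsin : 0 ≤ Real.sin θ := by
    by_contra! h
    have := mul_neg_of_pos_of_neg hd h
    linarith
  refine ⟨?_, ?_, hc, hs⟩
  · by_contra! h
    exact absurd (Real.sin_neg_of_neg_of_neg_pi_lt h h1) (not_lt.2 hsin)
  · by_contra! h
    exact absurd (Real.cos_neg_of_pi_div_two_lt_of_lt h (by linarith [Real.pi_pos]))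
      (not_lt.2 hcos)

lemma mul_cos_arcsin {d k : ℝ} (hd : 0 < d) :
    d * Real.cos (Real.arcsin (k * √3 / (2 * d))) = √(4 * d ^ 2 - 3 * k ^ 2) / 2 := by
  rw [Real.cos_arcsin]
  have h1 : d = √(d ^ 2) := (Real.sqrt_sq hd.le).symm
  have h2 : (2 : ℝ) = √(2 ^ 2) := (Real.sqrt_sq (by norm_num)).symm
  rw [h1, h2, ← Real.sqrt_mul (sq_nonneg d), ← Real.sqrt_div' _ (by norm_num), ← h1, ← h2]
  congr 1
  have h3 : √3 ^ 2 = 3 := Real.sq_sqrt (by norm_num)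
  field_simp
  rw [h3]
  ring

lemma mul_sin_arcsin {d k : ℝ} (hd : 0 < d) (hk : 3 * k ^ 2 ≤ 4 * d ^ 2) :
    d * Real.sin (Real.arcsin (k * √3 / (2 * d))) = k * √3 / 2 := by
  have h3 : √3 ^ 2 = 3 := Real.sq_sqrt (by norm_num)
  have habs : |k * √3| ≤ 2 * d := abs_le_of_sq_le_sq (by nlinarith) (by positivity)
  rw [abs_le] at habs
  rw [Real.sin_arcsin]
  · field_simp
  · rw [le_div_iff₀ (by positivity)]; linarith
  · rw [div_le_one (by positivity)]; linarith

section points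

variable {d k s : ℝ}

/-- In the coordinates `(ξ, y)` the lattice coordinates are `p = ξ + y` and `q = ξ - y`. The line `p
= k` has normal direction π/3 and signed distance `k√3/2` from the origin, so it meets the circle at
`π/3 ± arccos (k√3/(2d))`; this is the crossing with the minus sign. -/
lemma isArcPoint_lower (hd : 0 < d) (hk : 3 * k ^ 2 ≤ 4 * d ^ 2)
    (hs : √(4 * d ^ 2 - 3 * k ^ 2) = s) (h1 : 0 ≤ k + s) (h2 : 0 ≤ 3 * k - s) :
    IsArcPoint d (Real.arcsin (k * √3 / (2 * d)) - Real.pi / 6) ((k + s) / 4)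
      ((3 * k - s) / 4) := by
  have hc := mul_cos_arcsin (k := k) hd
  have hsn := mul_sin_arcsin hd hk
  have h3 : √3 ^ 2 = 3 := Real.sq_sqrt (by norm_num)
  have := Real.pi_pos
  rw [hs] at hc
  apply IsArcPoint.of_mem_Ioo hd
  · linarith [Real.neg_pi_div_two_le_arcsin (k * √3 / (2 * d))]
  · linarith [Real.arcsin_le_pi_div_two (k * √3 / (2 * d))]
  · rw [Real.cos_sub, Real.cos_pi_div_six, Real.sin_pi_div_six, mul_add, ← mul_assoc, hc,
      ← mul_assoc, hsn]
    ring
  · rw [Real.sin_sub, Real.cos_pi_div_six, Real.sin_pi_div_six, mul_sub, ← mul_assoc, hsn,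
      ← mul_assoc, hc]
    linear_combination k / 4 * h3
  · linarith
  · linarith

/-- The crossing with the line `p + q = k`, that is `ξ = k / 2`. -/
lemma isArcPoint_vertical (hd : 0 < d) (hk : 3 * k ^ 2 ≤ 4 * d ^ 2) (hk0 : 0 ≤ k)
    (hs : √(4 * d ^ 2 - 3 * k ^ 2) = s) :
    IsArcPoint d (Real.pi / 2 - Real.arcsin (k * √3 / (2 * d))) (k / 2) (s / 2) := by
  have hc := mul_cos_arcsin (k := k) hd
  have hsn := mul_sin_arcsin hd hk
  have := Real.pi_pos
  have hs0 : 0 ≤ s := hs ▸ Real.sqrt_nonneg _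
  rw [hs] at hc
  apply IsArcPoint.of_mem_Ioo hd
  · linarith [Real.arcsin_le_pi_div_two (k * √3 / (2 * d))]
  · have : 0 ≤ Real.arcsin (k * √3 / (2 * d)) := Real.arcsin_nonneg.2 (by positivity)
    linarith
  · rw [Real.cos_pi_div_two_sub, hsn]; ring
  · rw [Real.sin_pi_div_two_sub, hc]
  · linarith
  · linarith

/-- The crossing with the line `q = k`, whose normal direction is `-π/3`. -/
lemma isArcPoint_upper (hd : 0 < d) (hk : 3 * k ^ 2 ≤ 4 * d ^ 2)
    (hs : √(4 * d ^ 2 - 3 * k ^ 2) = s) (h1 : 0 ≤ k + s) (h2 : 0 ≤ s - 3 * k) :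
    IsArcPoint d (Real.pi / 6 - Real.arcsin (k * √3 / (2 * d))) ((k + s) / 4)
      ((s - 3 * k) / 4) := by
  have hc := mul_cos_arcsin (k := k) hd
  have hsn := mul_sin_arcsin hd hk
  have h3 : √3 ^ 2 = 3 := Real.sq_sqrt (by norm_num)
  have := Real.pi_pos
  rw [hs] at hc
  apply IsArcPoint.of_mem_Ioo hd
  · linarith [Real.arcsin_le_pi_div_two (k * √3 / (2 * d))]
  · linarith [Real.neg_pi_div_two_le_arcsin (k * √3 / (2 * d))]
  · rw [Real.cos_sub, Real.cos_pi_div_six, Real.sin_pi_div_six]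
    linear_combination √3 / 2 * hc + 1 / 2 * hsn
  · rw [Real.sin_sub, Real.cos_pi_div_six, Real.sin_pi_div_six]
    linear_combination 1 / 2 * hc - √3 / 2 * hsn - k / 4 * h3
  · linarith
  · linarith

/-- The case `k = -1` of `isArcPoint_upper`: the line `q = -1` carries an edge of the support. -/
lemma isArcPoint_outer (hd : 1 ≤ d) (hs : √(4 * d ^ 2 - 3) = s) :
    IsArcPoint d (Real.pi / 6 + Real.arcsin (√3 / (2 * d))) ((s - 1) / 4) ((s + 3) / 4) := by
  have h := isArcPoint_upper (d := d) (k := -1) (s := s) (by linarith) (by nlinarith)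
    (by rw [← hs]; norm_num)
  have hs1 : 1 ≤ s := by rw [← hs]; exact Real.one_le_sqrt.2 (by nlinarith)
  have h := h (by linarith) (by linarith)
  have e : (-1 : ℝ) * √3 / (2 * d) = -(√3 / (2 * d)) := by ring
  rw [e, Real.arcsin_neg, sub_neg_eq_add] at h
  convert h using 1 <;> ring

lemma isArcPoint_zero (d : ℝ) : IsArcPoint d 0 (d / √3) 0 := by
  refine ⟨le_rfl, by positivity, ?_, by simp⟩
  rw [Real.cos_zero]
  field_simp

lemma isArcPoint_pi_div_six (d : ℝ) : IsArcPoint d (Real.pi / 6) (d / 2) (d / 2) := by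
  have := Real.pi_pos
  refine ⟨by positivity, by linarith, ?_, ?_⟩
  · rw [Real.cos_pi_div_six]; ring
  · rw [Real.sin_pi_div_six]; ring

lemma isArcPoint_pi_div_three (d : ℝ) :
    IsArcPoint d (Real.pi / 3) (d / (2 * √3)) (√3 * d / 2) := by
  have := Real.pi_pos
  refine ⟨by positivity, by linarith, ?_, ?_⟩
  · rw [Real.cos_pi_div_three]; field_simp
  · rw [Real.sin_pi_div_three]; ring

lemma isArcPoint_pi_div_two (d : ℝ) : IsArcPoint d (Real.pi / 2) 0 d := by
  have := Real.pi_pos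
  refine ⟨by positivity, le_rfl, ?_, ?_⟩ <;> simp

end points

lemma IsArcPoint.sq_add_sq {d θ ξ y : ℝ} (h : IsArcPoint d θ ξ y) :
    3 * ξ ^ 2 + y ^ 2 = d ^ 2 := by
  have h3 : √3 ^ 2 = 3 := Real.sq_sqrt (by norm_num)
  rw [← h.sin_eq]
  linear_combination d ^ 2 * Real.sin_sq_add_cos_sq θ - (d * Real.cos θ + √3 * ξ) * h.cos_eq
    - ξ ^ 2 * h3

lemma IsArcPoint.le {d a b ξ ξ' y y' : ℝ} (hd : 0 < d) (ha : IsArcPoint d a ξ y)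
    (hb : IsArcPoint d b ξ' y') (h : ξ' ≤ ξ) : a ≤ b := by
  by_contra! hab
  have h1 := Real.cos_lt_cos_of_nonneg_of_le_pi_div_two hb.nonneg ha.le_half_pi hab
  have h2 : d * Real.cos a < d * Real.cos b := mul_lt_mul_of_pos_left h1 hd
  rw [ha.cos_eq, hb.cos_eq] at h2
  have : √3 * ξ' ≤ √3 * ξ := by gcongr
  linarith

lemma IsArcPoint.anti {d a b ξ ξ' y y' : ℝ} (hd : 0 < d) (ha : IsArcPoint d a ξ y)
    (hb : IsArcPoint d b ξ' y') (h : a ≤ b) : ξ' ≤ ξ ∧ y ≤ y' := by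
  have := Real.pi_pos
  have h1 := Real.cos_le_cos_of_nonneg_of_le_pi ha.nonneg (by linarith [hb.le_half_pi]) h
  have h2 := Real.sin_le_sin_of_le_of_le_pi_div_two (by linarith [ha.nonneg]) hb.le_half_pi h
  constructor
  · have h3 : d * Real.cos b ≤ d * Real.cos a := by gcongr
    rw [ha.cos_eq, hb.cos_eq] at h3
    exact le_of_mul_le_mul_left h3 (by positivity)
  · rw [← ha.sin_eq, ← hb.sin_eq]
    gcongr

/-- The coordinate `p = ξ + y` is proportional to `cos (π/3 - θ)`, so it increases only up to the
angle π/3; the hypothesis `y' ≤ 3 * ξ'` says that the arc ends by then. For `q = ξ - y` nothing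
extra is needed, since `ξ` decreases and `y` increases on the whole quarter circle. -/
lemma IsArcPoint.mono_add {d a b ξ ξ' y y' : ℝ} (hd : 0 < d) (ha : IsArcPoint d a ξ y)
    (hb : IsArcPoint d b ξ' y') (h : a ≤ b) (h' : y' ≤ 3 * ξ') : ξ + y ≤ ξ' + y' := by
  have hpi := Real.pi_pos
  have h3 : √3 ^ 2 = 3 := Real.sq_sqrt (by norm_num)
  have hb3 : b ≤ Real.pi / 3 := by
    refine hb.le hd (isArcPoint_pi_div_three d) ?_
    have hsq := hb.sq_add_sq
    have hy : 0 ≤ y' := by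
      rw [← hb.sin_eq]
      exact mul_nonneg hd.le (Real.sin_nonneg_of_nonneg_of_le_pi hb.nonneg
        (by linarith [hb.le_half_pi]))
    rw [div_le_iff₀ (by positivity)]
    refine abs_le_of_sq_le_sq' ?_ (mul_nonneg (by linarith) (by positivity)) |>.2
    rw [mul_pow, mul_pow, h3]
    nlinarith
  have h1 : Real.cos (Real.pi / 3 - a) ≤ Real.cos (Real.pi / 3 - b) :=
    Real.cos_le_cos_of_nonneg_of_le_pi (by linarith) (by linarith [ha.nonneg]) (by linarith)
  have h2 : d * Real.cos (Real.pi / 3 - a) ≤ d * Real.cos (Real.pi / 3 - b) := by gcongr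
  have e : ∀ {t ζ η : ℝ}, IsArcPoint d t ζ η →
      d * Real.cos (Real.pi / 3 - t) = √3 / 2 * (ζ + η) := by
    intro t ζ η ht
    rw [Real.cos_sub, Real.cos_pi_div_three, Real.sin_pi_div_three]
    linear_combination 1 / 2 * ht.cos_eq + √3 / 2 * ht.sin_eq
  rw [e ha, e hb] at h2
  exact le_of_mul_le_mul_left h2 (by positivity)

/-! ### Integrating quadratic polynomials along arcs -/

/-- A primitive, along the circle of radius `d`, of the quadratic polynomial with coefficients
`k, l, m, A, B, C` in `ξ` and `y`. -/
noncomputable def arcPrimitive (k l m A B C d θ ξ y : ℝ) : ℝ :=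
  (k + (A / 3 + C) * d ^ 2 / 2) * θ +
    √3 * (l * y / 3 - m * ξ + (A / 3 - C) * (ξ * y) / 2 + B * y ^ 2 / 6)

/-- Along the circle `ξ' = -y/√3` and `y' = √3 ξ`. The squares split into the constant mean `(A/3 +
C) d²/2` and a multiple of `ξ² - y²/3`, which is the derivative of `ξ y / √3`. -/
lemma hasDerivAt_arcPrimitive (k l m A B C d θ : ℝ) :
    HasDerivAt (fun t => arcPrimitive k l m A B C d t (d * Real.cos t / √3) (d * Real.sin t))
      (k + l * (d * Real.cos θ / √3) + m * (d * Real.sin θ) + A * (d * Real.cos θ / √3) ^ 2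
        + B * (d * Real.cos θ / √3) * (d * Real.sin θ) + C * (d * Real.sin θ) ^ 2) θ := by
  have hξ : HasDerivAt (fun t => d * Real.cos t / √3) (d * -Real.sin θ / √3) θ :=
    ((Real.hasDerivAt_cos θ).const_mul d).div_const _
  have hy : HasDerivAt (fun t => d * Real.sin t) (d * Real.cos θ) θ :=
    (Real.hasDerivAt_sin θ).const_mul d
  have h := ((hasDerivAt_id θ).const_mul (k + (A / 3 + C) * d ^ 2 / 2)).add
    ((((((hy.const_mul l).div_const 3).sub (hξ.const_mul m)).add
      (((hξ.mul hy).const_mul (A / 3 - C)).div_const 2)).add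
      (((hy.pow 2).const_mul B).div_const 6)).const_mul √3)
  refine h.congr_deriv ?_
  have h3 : √3 ^ 2 = 3 := Real.sq_sqrt (by norm_num)
  have hsc := Real.sin_sq_add_cos_sq θ
  have hne : √3 ≠ 0 := by positivity
  generalize √3 = t at *
  generalize Real.sin θ = S at *
  generalize Real.cos θ = c at *
  field_simp
  grind

/-- Integral of the overlap along an arc on which it is a quadratic polynomial. -/
lemma hasArcIntegral_of_quadratic (k l m A B C : ℝ) {d a b ξ ξ' y y' : ℝ} (hd : 0 < d)
    (ha : IsArcPoint d a ξ y) (hb : IsArcPoint d b ξ' y') (hle : ξ' ≤ ξ)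
    (h : ∀ x z : ℝ, ξ' ≤ x → x ≤ ξ → y ≤ z → z ≤ y' →
      (y' ≤ 3 * ξ' → ξ + y ≤ x + z ∧ x + z ≤ ξ' + y') → 3 * x ^ 2 + z ^ 2 = d ^ 2 →
      overlapArea (x + z - 1) (x - z - 1) =
        k + l * x + m * z + A * x ^ 2 + B * x * z + C * z ^ 2) :
    HasArcIntegral d a b
      (arcPrimitive k l m A B C d b ξ' y' - arcPrimitive k l m A B C d a ξ y) := by
  have hab := ha.le hd hb hle
  have hcongr : ∀ t ∈ Set.uIcc a b, k + l * (d * Real.cos t / √3) + m * (d * Real.sin t)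
      + A * (d * Real.cos t / √3) ^ 2 + B * (d * Real.cos t / √3) * (d * Real.sin t)
      + C * (d * Real.sin t) ^ 2 = polarOverlap d t := by
    intro t ht
    rw [Set.uIcc_of_le hab] at ht
    have hp : IsArcPoint d t (d * Real.cos t / √3) (d * Real.sin t) :=
      ⟨ha.nonneg.trans ht.1, ht.2.trans hb.le_half_pi, by field_simp, rfl⟩
    obtain ⟨h1, h2⟩ := ha.anti hd hp ht.1
    obtain ⟨h3, h4⟩ := hp.anti hd hb ht.2
    refine (h _ _ h3 h1 h2 h4 (fun h5 => ⟨?_, hp.mono_add hd hb ht.2 h5⟩) hp.sq_add_sq).symm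
    exact ha.mono_add hd hp ht.1 (by linarith)
  have hcont : Continuous fun t => k + l * (d * Real.cos t / √3) + m * (d * Real.sin t)
      + A * (d * Real.cos t / √3) ^ 2 + B * (d * Real.cos t / √3) * (d * Real.sin t)
      + C * (d * Real.sin t) ^ 2 := by fun_prop
  refine ⟨(hcont.intervalIntegrable a b).congr fun t ht => hcongr t (Set.uIoc_subset_uIcc ht), ?_⟩
  rw [← intervalIntegral.integral_congr hcongr,
    intervalIntegral.integral_eq_sub_of_hasDerivAt
      (fun t _ => hasDerivAt_arcPrimitive k l m A B C d t) (hcont.intervalIntegrable a b)]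
  have e : ∀ {t ζ η : ℝ}, IsArcPoint d t ζ η → d * Real.cos t / √3 = ζ := by
    intro t ζ η ht
    rw [ht.cos_eq]; field_simp
  rw [e ha, e hb, ha.sin_eq, hb.sin_eq]

lemma hasArcIntegral_zero {d a b ξ ξ' y y' : ℝ} (hd : 0 < d)
    (ha : IsArcPoint d a ξ y) (hb : IsArcPoint d b ξ' y') (hle : ξ' ≤ ξ)
    (h : ∀ x z : ℝ, ξ' ≤ x → x ≤ ξ → y ≤ z → z ≤ y' →
      (y' ≤ 3 * ξ' → ξ + y ≤ x + z ∧ x + z ≤ ξ' + y') → 3 * x ^ 2 + z ^ 2 = d ^ 2 →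
      overlapArea (x + z - 1) (x - z - 1) = 0) :
    HasArcIntegral d a b 0 := by
  have := hasArcIntegral_of_quadratic 0 0 0 0 0 0 hd ha hb hle
    (fun x z h1 h2 h3 h4 h5 h6 => by rw [h x z h1 h2 h3 h4 h5 h6]; ring)
  simpa [arcPrimitive] using this

lemma sqrt_four_mul_sub (x : ℝ) : √(4 * x) = 2 * √x := by
  rw [Real.sqrt_mul (by norm_num), show (4 : ℝ) = 2 ^ 2 by norm_num, Real.sqrt_sq (by norm_num)]

lemma IsArcPoint.fst_le {d θ ξ y : ℝ} (hd : 0 < d) (h : IsArcPoint d θ ξ y) : ξ ≤ d / √3 := by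
  have h1 : √3 * ξ ≤ d := by
    rw [← h.cos_eq]
    exact mul_le_of_le_one_right hd.le (Real.cos_le_one θ)
  rw [le_div_iff₀ (by positivity)]
  linarith

/-! ### The rhombi crossed by the quarter circle, for each range of the radius -/

lemma hasArcIntegral_first {d : ℝ} (hd : 0 < d) (hd1 : d ≤ 1) :
    HasArcIntegral d 0 (Real.pi / 2)
      (arcPrimitive 0 2 0 1 0 (-1) d (Real.pi / 6) (d / 2) (d / 2)
        - arcPrimitive 0 2 0 1 0 (-1) d 0 (d / √3) 0
      + (arcPrimitive 0 2 0 2 (-2) 0 d (Real.pi / 2) 0 d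
        - arcPrimitive 0 2 0 2 (-2) 0 d (Real.pi / 6) (d / 2) (d / 2))) := by
  have p0 := isArcPoint_zero d
  have p1 := isArcPoint_pi_div_six d
  have p2 := isArcPoint_pi_div_two d
  -- The six coefficients are those of the overlap polynomial of the rhombus in the variables `ξ`
  -- and `y`, here `(1 + p)(1 + q) - 1` and `(1 + q)(p + q)`. The arc changes rhombus on the ray `q
  -- = 0`, at the angle π/6.
  refine (hasArcIntegral_of_quadratic 0 2 0 1 0 (-1) hd p0 p1 (p1.fst_le hd) ?_).trans
    (hasArcIntegral_of_quadratic 0 2 0 2 (-2) 0 hd p1 p2 (by linarith) ?_)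
  · intro x z h1 h2 h3 h4 h5 _
    have h5 := h5 (by linarith)
    rw [overlapArea_kite_left (by linarith) (by linarith) (by linarith) (by linarith)]
    ring
  · intro x z h1 h2 h3 h4 _ _
    rw [overlapArea_corner_left (by linarith) (by linarith) (by linarith) (by linarith)]
    ring

lemma hasArcIntegral_second {d : ℝ} (hd1 : 1 ≤ d) (hd2 : d ^ 2 ≤ 3) :
    HasArcIntegral d 0 (Real.pi / 2)
      (arcPrimitive 0 2 0 1 0 (-1) d (Real.arcsin (√3 / (2 * d)) - Real.pi / 6)
          ((1 + √(4 * d ^ 2 - 3)) / 4) ((3 - √(4 * d ^ 2 - 3)) / 4)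
        - arcPrimitive 0 2 0 1 0 (-1) d 0 (d / √3) 0
      + (arcPrimitive (-1) 6 0 (-2) (-2) 0 d (Real.pi / 2 - Real.arcsin (√3 / (2 * d)))
          (1 / 2) (√(4 * d ^ 2 - 3) / 2)
        - arcPrimitive (-1) 6 0 (-2) (-2) 0 d (Real.arcsin (√3 / (2 * d)) - Real.pi / 6)
          ((1 + √(4 * d ^ 2 - 3)) / 4) ((3 - √(4 * d ^ 2 - 3)) / 4))
      + (arcPrimitive 0 2 0 2 (-2) 0 d (Real.pi / 6 + Real.arcsin (√3 / (2 * d)))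
          ((√(4 * d ^ 2 - 3) - 1) / 4) ((√(4 * d ^ 2 - 3) + 3) / 4)
        - arcPrimitive 0 2 0 2 (-2) 0 d (Real.pi / 2 - Real.arcsin (√3 / (2 * d)))
          (1 / 2) (√(4 * d ^ 2 - 3) / 2))
      + 0) := by
  have hd : 0 < d := by linarith
  have hs0 := Real.sqrt_nonneg (4 * d ^ 2 - 3)
  have hs : √(4 * d ^ 2 - 3) ^ 2 = 4 * d ^ 2 - 3 := Real.sq_sqrt (by nlinarith)
  have hk : 3 * (1 : ℝ) ^ 2 ≤ 4 * d ^ 2 := by nlinarith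
  have hsk : √(4 * d ^ 2 - 3 * 1 ^ 2) = √(4 * d ^ 2 - 3) := by norm_num
  have p4 := isArcPoint_outer hd1 rfl
  have p0 := isArcPoint_zero d
  have p5 := isArcPoint_pi_div_two d
  have p2 := isArcPoint_vertical hd hk zero_le_one hsk
  have p1 := isArcPoint_lower hd hk hsk
  rw [one_mul] at p1 p2
  generalize √(4 * d ^ 2 - 3) = s at *
  have hs1 : 1 ≤ s := by nlinarith
  have hs3 : s ≤ 3 := by nlinarith
  have p1 := p1 (by linarith) (by linarith)
  rw [mul_one] at p1
  refine (((hasArcIntegral_of_quadratic 0 2 0 1 0 (-1) hd p0 p1 (p1.fst_le hd) ?_).trans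
    (hasArcIntegral_of_quadratic (-1) 6 0 (-2) (-2) 0 hd p1 p2 (by linarith) ?_)).trans
    (hasArcIntegral_of_quadratic 0 2 0 2 (-2) 0 hd p2 p4 (by linarith) ?_)).trans
    (hasArcIntegral_zero hd p4 p5 (by linarith) ?_)
  · intro x z h1 h2 h3 h4 h5 _
    have h5 := h5 (by linarith)
    rw [overlapArea_kite_left (by linarith) (by linarith) (by linarith) (by linarith)]
    ring
  · intro x z h1 h2 h3 h4 h5 h6
    have h5 := h5 (by linarith)
    -- Cauchy–Schwarz: `3 (x + z)² + (3x - z)² = 4 (3x² + z²)`, and the right side is at most 12.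
    have h7 : x + z ≤ 2 := by nlinarith [sq_nonneg (3 * x - z)]
    rw [overlapArea_kite_upper_left (by linarith) h7 (by linarith) (by linarith)]
    ring
  · intro x z h1 h2 h3 h4 _ _
    rw [overlapArea_corner_left (by linarith) (by linarith) (by linarith) (by linarith)]
    ring
  · intro x z h1 h2 h3 h4 _ _
    exact overlapArea_eq_zero_of_le_neg_one _ (by linarith)

lemma isArcPoint_upper_one {d : ℝ} (hd : 0 < d) (hd3 : 3 ≤ d ^ 2) :
    IsArcPoint d (Real.pi / 6 - Real.arcsin (√3 / (2 * d))) ((1 + √(4 * d ^ 2 - 3)) / 4)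
      ((√(4 * d ^ 2 - 3) - 3) / 4) := by
  have h3 : 3 ≤ √(4 * d ^ 2 - 3) := Real.le_sqrt_of_sq_le (by linarith)
  have := isArcPoint_upper hd (k := 1) (s := √(4 * d ^ 2 - 3)) (by linarith) (by norm_num)
    (by linarith) (by linarith)
  rwa [one_mul, mul_one] at this

lemma isArcPoint_lower_two {d : ℝ} (hd : 0 < d) (hd3 : 3 ≤ d ^ 2) (hd12 : d ^ 2 ≤ 12) :
    IsArcPoint d (Real.arcsin (√3 / d) - Real.pi / 6) ((1 + √(d ^ 2 - 3)) / 2)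
      ((3 - √(d ^ 2 - 3)) / 2) := by
  have h0 := Real.sqrt_nonneg (d ^ 2 - 3)
  have h3 : √(d ^ 2 - 3) ≤ 3 := by rw [Real.sqrt_le_left] <;> linarith
  have := isArcPoint_lower hd (k := 2) (s := 2 * √(d ^ 2 - 3)) (by linarith)
    (by rw [← sqrt_four_mul_sub]; ring_nf) (by linarith) (by linarith)
  rw [mul_div_mul_left _ _ two_ne_zero] at this
  convert this using 1 <;> ring

lemma isArcPoint_vertical_two {d : ℝ} (hd : 0 < d) (hd3 : 3 ≤ d ^ 2) :
    IsArcPoint d (Real.pi / 2 - Real.arcsin (√3 / d)) 1 (√(d ^ 2 - 3)) := by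
  have := isArcPoint_vertical hd (k := 2) (s := 2 * √(d ^ 2 - 3)) (by linarith) (by norm_num)
    (by rw [← sqrt_four_mul_sub]; ring_nf)
  rw [mul_div_mul_left _ _ two_ne_zero] at this
  convert this using 1 <;> ring

lemma isArcPoint_lower_three {d : ℝ} (hd : 0 < d) (hd7 : 7 ≤ d ^ 2) (hd27 : d ^ 2 ≤ 27) :
    IsArcPoint d (Real.arcsin (3 * √3 / (2 * d)) - Real.pi / 6) ((3 + √(4 * d ^ 2 - 27)) / 4)
      ((9 - √(4 * d ^ 2 - 27)) / 4) := by
  have h0 := Real.sqrt_nonneg (4 * d ^ 2 - 27)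
  have h3 : √(4 * d ^ 2 - 27) ≤ 9 := by rw [Real.sqrt_le_left] <;> linarith
  have := isArcPoint_lower hd (k := 3) (s := √(4 * d ^ 2 - 27)) (by linarith)
    (by norm_num) (by linarith) (by linarith)
  convert this using 1; ring

lemma isArcPoint_vertical_three {d : ℝ} (hd : 0 < d) (hd7 : 7 ≤ d ^ 2) :
    IsArcPoint d (Real.pi / 2 - Real.arcsin (3 * √3 / (2 * d))) (3 / 2)
      (√(4 * d ^ 2 - 27) / 2) :=
  isArcPoint_vertical hd (k := 3) (by linarith) (by norm_num) (by norm_num)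

lemma isArcPoint_vertical_four {d : ℝ} (hd : 0 < d) (hd12 : 12 ≤ d ^ 2) :
    IsArcPoint d (Real.pi / 2 - Real.arcsin (2 * √3 / d)) 2 (√(d ^ 2 - 12)) := by
  have := isArcPoint_vertical hd (k := 4) (s := 2 * √(d ^ 2 - 12)) (by linarith) (by norm_num)
    (by rw [← sqrt_four_mul_sub]; ring_nf)
  rw [show 4 * √3 = 2 * (2 * √3) by ring, mul_div_mul_left _ _ two_ne_zero] at this
  convert this using 1 <;> ring

/-- The arc changes rhombus at `q = 1`, `p + q = 2` and `p = 2`, and leaves the support at `q = -1`.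
-/
lemma hasArcIntegral_third {d : ℝ} (hd : 0 < d) (hd3 : 3 ≤ d ^ 2) (hd4 : d ^ 2 ≤ 4) :
    HasArcIntegral d 0 (Real.pi / 2)
      (arcPrimitive 8 (-6) 0 1 0 (-1) d (Real.pi / 6 - Real.arcsin (√3 / (2 * d)))
          ((1 + √(4 * d ^ 2 - 3)) / 4) ((√(4 * d ^ 2 - 3) - 3) / 4)
        - arcPrimitive 8 (-6) 0 1 0 (-1) d 0 (d / √3) 0
      + (arcPrimitive 3 2 (-4) (-2) 2 0 d (Real.pi / 2 - Real.arcsin (√3 / d))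
          1 (√(d ^ 2 - 3))
        - arcPrimitive 3 2 (-4) (-2) 2 0 d (Real.pi / 6 - Real.arcsin (√3 / (2 * d)))
          ((1 + √(4 * d ^ 2 - 3)) / 4) ((√(4 * d ^ 2 - 3) - 3) / 4))
      + (arcPrimitive (-1) 6 0 (-2) (-2) 0 d (Real.arcsin (√3 / d) - Real.pi / 6)
          ((1 + √(d ^ 2 - 3)) / 2) ((3 - √(d ^ 2 - 3)) / 2)
        - arcPrimitive (-1) 6 0 (-2) (-2) 0 d (Real.pi / 2 - Real.arcsin (√3 / d))
          1 (√(d ^ 2 - 3)))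
      + (arcPrimitive 3 2 (-4) (-1) 0 1 d (Real.pi / 6 + Real.arcsin (√3 / (2 * d)))
          ((√(4 * d ^ 2 - 3) - 1) / 4) ((√(4 * d ^ 2 - 3) + 3) / 4)
        - arcPrimitive 3 2 (-4) (-1) 0 1 d (Real.arcsin (√3 / d) - Real.pi / 6)
          ((1 + √(d ^ 2 - 3)) / 2) ((3 - √(d ^ 2 - 3)) / 2))
      + 0) := by
  have hs0 := Real.sqrt_nonneg (4 * d ^ 2 - 3)
  have hs : √(4 * d ^ 2 - 3) ^ 2 = 4 * d ^ 2 - 3 := Real.sq_sqrt (by linarith)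
  have ht0 := Real.sqrt_nonneg (d ^ 2 - 3)
  have ht : √(d ^ 2 - 3) ^ 2 = d ^ 2 - 3 := Real.sq_sqrt (by linarith)
  have p0 := isArcPoint_zero d
  have p1 := isArcPoint_upper_one hd hd3
  have p2 := isArcPoint_vertical_two hd hd3
  have p3 := isArcPoint_lower_two hd hd3 (by linarith)
  have p4 := isArcPoint_outer (d := d) (by nlinarith) rfl
  have p5 := isArcPoint_pi_div_two d
  generalize √(4 * d ^ 2 - 3) = s at *
  generalize √(d ^ 2 - 3) = t at *
  have hs3 : 3 ≤ s := by nlinarith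
  have hs4 : s ≤ 4 := by nlinarith
  have ht1 : t ≤ 1 := by nlinarith
  have hst : s ≤ 3 + 2 * t := by nlinarith
  refine ((((hasArcIntegral_of_quadratic 8 (-6) 0 1 0 (-1) hd p0 p1 (p1.fst_le hd) ?_).trans
    (hasArcIntegral_of_quadratic 3 2 (-4) (-2) 2 0 hd p1 p2 (by linarith) ?_)).trans
    (hasArcIntegral_of_quadratic (-1) 6 0 (-2) (-2) 0 hd p2 p3 (by linarith) ?_)).trans
    (hasArcIntegral_of_quadratic 3 2 (-4) (-1) 0 1 hd p3 p4 (by linarith) ?_)).trans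
    (hasArcIntegral_zero hd p4 p5 (by linarith) ?_)
  · intro x z h1 h2 h3 h4 h5 _
    have h5 := h5 (by linarith)
    rw [overlapArea_kite_right (by linarith) (by linarith) (by linarith) (by linarith)]
    ring
  · intro x z h1 h2 h3 h4 h5 _
    rw [overlapArea_kite_upper_right (by linarith) (by linarith) (by linarith) (by linarith)]
    ring
  · intro x z h1 h2 h3 h4 h5 _
    have h5 := h5 (by linarith)
    rw [overlapArea_kite_upper_left (by linarith) (by linarith) (by linarith) (by linarith)]
    ring
  · intro x z h1 h2 h3 h4 h5 _
    have h5 := h5 (by linarith)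
    rw [overlapArea_corner_top (by linarith) (by linarith) (by linarith) (by linarith)]
    ring
  · intro x z h1 h2 h3 h4 _ _
    exact overlapArea_eq_zero_of_le_neg_one _ (by linarith)

/-- From `d = 2` on, the circle passes beyond the vertex `(2, 0)` and misses the upper left rhombus:
it goes from the upper right to the top one across `q = 0`. -/
lemma hasArcIntegral_fourth {d : ℝ} (hd2 : 2 ≤ d) (hd7 : d ^ 2 ≤ 7) :
    HasArcIntegral d 0 (Real.pi / 2)
      (arcPrimitive 8 (-6) 0 1 0 (-1) d (Real.pi / 6 - Real.arcsin (√3 / (2 * d)))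
          ((1 + √(4 * d ^ 2 - 3)) / 4) ((√(4 * d ^ 2 - 3) - 3) / 4)
        - arcPrimitive 8 (-6) 0 1 0 (-1) d 0 (d / √3) 0
      + (arcPrimitive 3 2 (-4) (-2) 2 0 d (Real.pi / 6) (d / 2) (d / 2)
        - arcPrimitive 3 2 (-4) (-2) 2 0 d (Real.pi / 6 - Real.arcsin (√3 / (2 * d)))
          ((1 + √(4 * d ^ 2 - 3)) / 4) ((√(4 * d ^ 2 - 3) - 3) / 4))
      + (arcPrimitive 3 2 (-4) (-1) 0 1 d (Real.pi / 6 + Real.arcsin (√3 / (2 * d)))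
          ((√(4 * d ^ 2 - 3) - 1) / 4) ((√(4 * d ^ 2 - 3) + 3) / 4)
        - arcPrimitive 3 2 (-4) (-1) 0 1 d (Real.pi / 6) (d / 2) (d / 2))
      + 0) := by
  have hd : 0 < d := by linarith
  have hs0 := Real.sqrt_nonneg (4 * d ^ 2 - 3)
  have hs : √(4 * d ^ 2 - 3) ^ 2 = 4 * d ^ 2 - 3 := Real.sq_sqrt (by nlinarith)
  have p0 := isArcPoint_zero d
  have p1 := isArcPoint_upper_one hd (by nlinarith)
  have p2 := isArcPoint_pi_div_six d
  have p4 := isArcPoint_outer (d := d) (by linarith) rfl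
  have p5 := isArcPoint_pi_div_two d
  generalize √(4 * d ^ 2 - 3) = s at *
  have hs3 : 3 ≤ s := by nlinarith
  have hs4 : s ≤ 5 := by nlinarith
  have hsd : 2 * d - 1 ≤ s := by nlinarith
  have hsd' : s ≤ 2 * d := by nlinarith
  refine (((hasArcIntegral_of_quadratic 8 (-6) 0 1 0 (-1) hd p0 p1 (p1.fst_le hd) ?_).trans
    (hasArcIntegral_of_quadratic 3 2 (-4) (-2) 2 0 hd p1 p2 (by linarith) ?_)).trans
    (hasArcIntegral_of_quadratic 3 2 (-4) (-1) 0 1 hd p2 p4 (by linarith) ?_)).trans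
    (hasArcIntegral_zero hd p4 p5 (by linarith) ?_)
  · intro x z h1 h2 h3 h4 h5 _
    have h5 := h5 (by linarith)
    rw [overlapArea_kite_right (by linarith) (by linarith) (by linarith) (by linarith)]
    ring
  · intro x z h1 h2 h3 h4 h5 _
    rw [overlapArea_kite_upper_right (by linarith) (by linarith) (by linarith) (by linarith)]
    ring
  · intro x z h1 h2 h3 h4 h5 _
    have h5 := h5 (by linarith)
    rw [overlapArea_corner_top (by linarith) (by linarith) (by linarith) (by linarith)]
    ring
  · intro x z h1 h2 h3 h4 _ _
    exact overlapArea_eq_zero_of_le_neg_one _ (by linarith)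

/-- Once `p = 3` is crossed the arc stays outside the support. Up to the angle π/3 the coordinate
`p` keeps increasing; at π/3 one has `y = 3 ξ`, so `q = -2 ξ ≤ -1`, and from there on `q` decreases.
-/
lemma hasArcIntegral_tail {d : ℝ} (hd : 0 < d) (hd7 : 7 ≤ d ^ 2) (hd13 : d ^ 2 ≤ 13) :
    HasArcIntegral d (Real.arcsin (3 * √3 / (2 * d)) - Real.pi / 6) (Real.pi / 2) (0 + 0) := by
  have hs0 := Real.sqrt_nonneg (4 * d ^ 2 - 27)
  have hs : √(4 * d ^ 2 - 27) ^ 2 = 4 * d ^ 2 - 27 := Real.sq_sqrt (by linarith)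
  have p0 := isArcPoint_lower_three hd hd7 (by linarith)
  have p1 := isArcPoint_pi_div_three d
  have p2 := isArcPoint_pi_div_two d
  have h3 : √3 ^ 2 = 3 := Real.sq_sqrt (by norm_num)
  have e : √3 * d / 2 = 3 * (d / (2 * √3)) := by
    field_simp
    rw [h3]
  rw [e] at p1
  have hq := p1.sq_add_sq
  have hξ : 0 < d / (2 * √3) := by positivity
  generalize √(4 * d ^ 2 - 27) = s at *
  generalize d / (2 * √3) = ξ at *
  have hs1 : 1 ≤ s := by nlinarith
  have hξ1 : 1 / 2 ≤ ξ := by nlinarith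
  have hle : ξ ≤ (3 + s) / 4 := by nlinarith
  refine (hasArcIntegral_zero hd p0 p1 hle ?_).trans (hasArcIntegral_zero hd p1 p2 hξ.le ?_)
  · intro x z h1 h2 h3 h4 h5 _
    have h5 := h5 (by linarith)
    exact overlapArea_eq_zero_of_three_le _ (by linarith)
  · intro x z h1 h2 h3 h4 _ _
    exact overlapArea_eq_zero_of_le_neg_one _ (by linarith)

/-- Beyond the vertex `(2, 1)`, reached at `d = √7`, the arc also cuts the right corner rhombus; the
crossings are `p = 2`, `p + q = 3`, `q = 0`, and finally `p = 3`. -/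
lemma hasArcIntegral_fifth {d : ℝ} (hd : 0 < d) (hd7 : 7 ≤ d ^ 2) (hd3 : d ≤ 3) :
    HasArcIntegral d 0 (Real.pi / 2)
      (arcPrimitive 8 (-6) 0 1 0 (-1) d (Real.arcsin (√3 / d) - Real.pi / 6)
          ((1 + √(d ^ 2 - 3)) / 2) ((3 - √(d ^ 2 - 3)) / 2)
        - arcPrimitive 8 (-6) 0 1 0 (-1) d 0 (d / √3) 0
      + (arcPrimitive 12 (-10) (-4) 2 2 0 d (Real.pi / 2 - Real.arcsin (3 * √3 / (2 * d)))
          (3 / 2) (√(4 * d ^ 2 - 27) / 2)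
        - arcPrimitive 12 (-10) (-4) 2 2 0 d (Real.arcsin (√3 / d) - Real.pi / 6)
          ((1 + √(d ^ 2 - 3)) / 2) ((3 - √(d ^ 2 - 3)) / 2))
      + (arcPrimitive 3 2 (-4) (-2) 2 0 d (Real.pi / 6) (d / 2) (d / 2)
        - arcPrimitive 3 2 (-4) (-2) 2 0 d (Real.pi / 2 - Real.arcsin (3 * √3 / (2 * d)))
          (3 / 2) (√(4 * d ^ 2 - 27) / 2))
      + (arcPrimitive 3 2 (-4) (-1) 0 1 d (Real.arcsin (3 * √3 / (2 * d)) - Real.pi / 6)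
          ((3 + √(4 * d ^ 2 - 27)) / 4) ((9 - √(4 * d ^ 2 - 27)) / 4)
        - arcPrimitive 3 2 (-4) (-1) 0 1 d (Real.pi / 6) (d / 2) (d / 2))
      + (0 + 0)) := by
  have hs0 := Real.sqrt_nonneg (4 * d ^ 2 - 27)
  have hs : √(4 * d ^ 2 - 27) ^ 2 = 4 * d ^ 2 - 27 := Real.sq_sqrt (by linarith)
  have ht0 := Real.sqrt_nonneg (d ^ 2 - 3)
  have ht : √(d ^ 2 - 3) ^ 2 = d ^ 2 - 3 := Real.sq_sqrt (by linarith)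
  have p0 := isArcPoint_zero d
  have p1 := isArcPoint_lower_two hd (by linarith) (by nlinarith)
  have p2 := isArcPoint_vertical_three hd hd7
  have p3 := isArcPoint_pi_div_six d
  have p4 := isArcPoint_lower_three hd hd7 (by nlinarith)
  have tail := hasArcIntegral_tail hd hd7 (by nlinarith)
  generalize √(4 * d ^ 2 - 27) = s at *
  generalize √(d ^ 2 - 3) = t at *
  have hs1 : 1 ≤ s := by nlinarith
  have hs3 : s ≤ 3 := by nlinarith
  have ht2 : 2 ≤ t := by nlinarith
  have ht3 : t ≤ 3 := by nlinarith
  have hd2 : 2 ≤ d := by nlinarith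
  have hsd : s ≤ 2 * d - 3 := by nlinarith
  refine ((((hasArcIntegral_of_quadratic 8 (-6) 0 1 0 (-1) hd p0 p1 (p1.fst_le hd) ?_).trans
    (hasArcIntegral_of_quadratic 12 (-10) (-4) 2 2 0 hd p1 p2 (by linarith) ?_)).trans
    (hasArcIntegral_of_quadratic 3 2 (-4) (-2) 2 0 hd p2 p3 (by linarith) ?_)).trans
    (hasArcIntegral_of_quadratic 3 2 (-4) (-1) 0 1 hd p3 p4 (by linarith) ?_)).trans tail
  · intro x z h1 h2 h3 h4 h5 _
    have h5 := h5 (by linarith)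
    rw [overlapArea_kite_right (by linarith) (by linarith) (by linarith) (by linarith)]
    ring
  · intro x z h1 h2 h3 h4 h5 _
    have h5 := h5 (by linarith)
    rw [overlapArea_corner_right (by linarith) (by linarith) (by linarith) (by linarith)]
    ring
  · intro x z h1 h2 h3 h4 h5 _
    rw [overlapArea_kite_upper_right (by linarith) (by linarith) (by linarith) (by linarith)]
    ring
  · intro x z h1 h2 h3 h4 h5 _
    have h5 := h5 (by linarith)
    rw [overlapArea_corner_top (by linarith) (by linarith) (by linarith) (by linarith)]
    ring

lemma hasArcIntegral_sixth {d : ℝ} (hd3 : 3 ≤ d) (hd12 : d ^ 2 ≤ 12) :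
    HasArcIntegral d 0 (Real.pi / 2)
      (arcPrimitive 8 (-6) 0 1 0 (-1) d (Real.arcsin (√3 / d) - Real.pi / 6)
          ((1 + √(d ^ 2 - 3)) / 2) ((3 - √(d ^ 2 - 3)) / 2)
        - arcPrimitive 8 (-6) 0 1 0 (-1) d 0 (d / √3) 0
      + (arcPrimitive 12 (-10) (-4) 2 2 0 d (Real.arcsin (3 * √3 / (2 * d)) - Real.pi / 6)
          ((3 + √(4 * d ^ 2 - 27)) / 4) ((9 - √(4 * d ^ 2 - 27)) / 4)
        - arcPrimitive 12 (-10) (-4) 2 2 0 d (Real.arcsin (√3 / d) - Real.pi / 6)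
          ((1 + √(d ^ 2 - 3)) / 2) ((3 - √(d ^ 2 - 3)) / 2))
      + (0 + 0)) := by
  have hd : 0 < d := by linarith
  have hd9 : 9 ≤ d ^ 2 := by nlinarith
  have hs0 := Real.sqrt_nonneg (4 * d ^ 2 - 27)
  have hs : √(4 * d ^ 2 - 27) ^ 2 = 4 * d ^ 2 - 27 := Real.sq_sqrt (by linarith)
  have ht0 := Real.sqrt_nonneg (d ^ 2 - 3)
  have ht : √(d ^ 2 - 3) ^ 2 = d ^ 2 - 3 := Real.sq_sqrt (by linarith)
  have p0 := isArcPoint_zero d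
  have p1 := isArcPoint_lower_two hd (by linarith) hd12
  have p2 := isArcPoint_lower_three hd (by linarith) (by linarith)
  have tail := hasArcIntegral_tail hd (by linarith) (by linarith)
  generalize √(4 * d ^ 2 - 27) = s at *
  generalize √(d ^ 2 - 3) = t at *
  have hs3 : 3 ≤ s := by nlinarith
  have hs5 : s ≤ 5 := by nlinarith
  have ht2 : 2 ≤ t := by nlinarith
  have ht3 : t ≤ 3 := by nlinarith
  have hst : s ≤ 2 * t - 1 := by nlinarith
  refine ((hasArcIntegral_of_quadratic 8 (-6) 0 1 0 (-1) hd p0 p1 (p1.fst_le hd) ?_).trans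
    (hasArcIntegral_of_quadratic 12 (-10) (-4) 2 2 0 hd p1 p2 (by linarith) ?_)).trans tail
  · intro x z h1 h2 h3 h4 h5 _
    have h5 := h5 (by linarith)
    rw [overlapArea_kite_right (by linarith) (by linarith) (by linarith) (by linarith)]
    ring
  · intro x z h1 h2 h3 h4 h5 _
    have h5 := h5 (by linarith)
    rw [overlapArea_corner_right (by linarith) (by linarith) (by linarith) (by linarith)]
    ring

/-- The arc now starts outside the support, beyond the edge `p + q = 4`, and meets only the right
corner rhombus, around the vertex `(3, 1)` at distance √13. -/
lemma hasArcIntegral_seventh {d : ℝ} (hd : 0 < d) (hd12 : 12 ≤ d ^ 2) (hd13 : d ^ 2 ≤ 13) :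
    HasArcIntegral d 0 (Real.pi / 2)
      (0
      + (arcPrimitive 12 (-10) (-4) 2 2 0 d (Real.arcsin (3 * √3 / (2 * d)) - Real.pi / 6)
          ((3 + √(4 * d ^ 2 - 27)) / 4) ((9 - √(4 * d ^ 2 - 27)) / 4)
        - arcPrimitive 12 (-10) (-4) 2 2 0 d (Real.pi / 2 - Real.arcsin (2 * √3 / d))
          2 (√(d ^ 2 - 12)))
      + (0 + 0)) := by
  have hs0 := Real.sqrt_nonneg (4 * d ^ 2 - 27)
  have hs : √(4 * d ^ 2 - 27) ^ 2 = 4 * d ^ 2 - 27 := Real.sq_sqrt (by linarith)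
  have ht0 := Real.sqrt_nonneg (d ^ 2 - 12)
  have ht : √(d ^ 2 - 12) ^ 2 = d ^ 2 - 12 := Real.sq_sqrt (by linarith)
  have p0 := isArcPoint_zero d
  have p1 := isArcPoint_vertical_four hd hd12
  have p2 := isArcPoint_lower_three hd (by linarith) (by linarith)
  have tail := hasArcIntegral_tail hd (by linarith) hd13
  generalize √(4 * d ^ 2 - 27) = s at *
  generalize √(d ^ 2 - 12) = t at *
  have hs3 : 3 ≤ s := by nlinarith
  have hs5 : s ≤ 5 := by nlinarith
  refine ((hasArcIntegral_zero hd p0 p1 (p1.fst_le hd) ?_).trans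
    (hasArcIntegral_of_quadratic 12 (-10) (-4) 2 2 0 hd p1 p2 (by linarith) ?_)).trans tail
  · intro x z h1 h2 h3 h4 _ _
    exact overlapArea_eq_zero_of_four_le (by linarith)
  · intro x z h1 h2 h3 h4 h5 _
    have h5 := h5 (by linarith)
    rw [overlapArea_corner_right (by linarith) (by linarith) (by linarith) (by linarith)]
    ring

lemma hasArcIntegral_far {d : ℝ} (hd : 0 < d) (hd13 : 13 ≤ d ^ 2) :
    HasArcIntegral d 0 (Real.pi / 2) 0 := by
  refine hasArcIntegral_zero hd (isArcPoint_zero d) (isArcPoint_pi_div_two d) (by positivity) ?_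
  intro x z h1 _ h3 _ _ h6
  by_cases hp : 3 ≤ x + z
  · exact overlapArea_eq_zero_of_three_le _ hp
  by_cases hr : 2 ≤ x
  · exact overlapArea_eq_zero_of_four_le (by linarith)
  push Not at hp hr
  -- From `x + z < 3` one gets `z² < (3 - x)²`, so `d² < 4x² - 6x + 9`; on `0 ≤ x ≤ 2` the right
  -- side is at most 13, its value at `x = 2`.
  nlinarith [mul_pos (sub_pos.2 hp) (by linarith : 0 < 3 + z - x),
    mul_nonneg h1 (sub_pos.2 hr).le]

/-! ### Comparison of the arc integrals with the claimed density -/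

lemma exists_hasArcIntegral_first {d : ℝ} (hd : 0 < d) (hd1 : d ≤ 1) :
    ∃ I, HasArcIntegral d 0 (Real.pi / 2) I ∧
      2 / 9 * d * ((Real.pi / (9 * √3) - 1 / 3) * d ^ 2 + 4 / 3 * d) =
        4 * √3 / 27 * d * I := by
  refine ⟨_, hasArcIntegral_first hd hd1, ?_⟩
  unfold arcPrimitive
  have h3 : √3 ^ 2 = 3 := Real.sq_sqrt (by norm_num)
  have hne : √3 ≠ 0 := by positivity
  generalize Real.pi = π at *
  generalize √3 = w at *
  field_simp
  grind

lemma exists_hasArcIntegral_second {d : ℝ} (hd1 : 1 ≤ d) (hd2 : d ^ 2 ≤ 3) :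
    ∃ I, HasArcIntegral d 0 (Real.pi / 2) I ∧
      2 / 9 * d * (2 / √3 * (d ^ 2 + 2) * Real.arcsin (√3 / (2 * d))
        - (1 / 3 + 5 * Real.pi / (9 * √3)) * d ^ 2 + 11 / 6 * √(4 * d ^ 2 - 3)
        - 4 * Real.pi / (3 * √3) - 1 / 2) =
        4 * √3 / 27 * d * I := by
  refine ⟨_, hasArcIntegral_second hd1 hd2, ?_⟩
  unfold arcPrimitive
  have h3 : √3 ^ 2 = 3 := Real.sq_sqrt (by norm_num)
  have hne : √3 ≠ 0 := by positivity
  have hs0 : √(4 * d ^ 2 - 3) ^ 2 = 4 * d ^ 2 - 3 := Real.sq_sqrt (by nlinarith)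
  -- With the roots, the arcsine and π turned into variables, the claim is a polynomial identity
  -- modulo the relations for the squared roots. The later pieces are treated alike.
  generalize √(4 * d ^ 2 - 3) = s at *
  generalize Real.arcsin (√3 / (2 * d)) = a at *
  generalize Real.pi = π at *
  generalize √3 = w at *
  field_simp
  grind

lemma exists_hasArcIntegral_third {d : ℝ} (hd : 0 < d) (hd3 : 3 ≤ d ^ 2) (hd4 : d ^ 2 ≤ 4) :
    ∃ I, HasArcIntegral d 0 (Real.pi / 2) I ∧
      2 / 9 * d * (2 / √3 * (d ^ 2 / 3 - 2) * Real.arcsin (√3 / (2 * d))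
        - 4 / √3 * (d ^ 2 / 3 + 4) * Real.arcsin (√3 / d)
        + (1 + Real.pi / (3 * √3)) * d ^ 2 - 7 / 6 * √(4 * d ^ 2 - 3)
        - 20 / 3 * √(d ^ 2 - 3) + 8 * Real.pi / √3 + 9 / 2) =
        4 * √3 / 27 * d * I := by
  refine ⟨_, hasArcIntegral_third hd hd3 hd4, ?_⟩
  unfold arcPrimitive
  have h3 : √3 ^ 2 = 3 := Real.sq_sqrt (by norm_num)
  have hne : √3 ≠ 0 := by positivity
  have hs0 : √(4 * d ^ 2 - 3) ^ 2 = 4 * d ^ 2 - 3 := Real.sq_sqrt (by nlinarith)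
  have hs1 : √(d ^ 2 - 3) ^ 2 = d ^ 2 - 3 := Real.sq_sqrt (by nlinarith)
  generalize √(4 * d ^ 2 - 3) = s at *
  generalize √(d ^ 2 - 3) = t at *
  generalize Real.arcsin (√3 / (2 * d)) = a at *
  generalize Real.arcsin (√3 / d) = b at *
  generalize Real.pi = π at *
  generalize √3 = w at *
  field_simp
  grind

lemma exists_hasArcIntegral_fourth {d : ℝ} (hd2 : 2 ≤ d) (hd7 : d ^ 2 ≤ 7) :
    ∃ I, HasArcIntegral d 0 (Real.pi / 2) I ∧
      2 / 9 * d * (2 / √3 * (d ^ 2 / 3 - 2) * Real.arcsin (√3 / (2 * d))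
        + (1 / 3 - Real.pi / (9 * √3)) * d ^ 2 - 7 / 6 * √(4 * d ^ 2 - 3)
        + 8 * Real.pi / (3 * √3) + 1 / 2) =
        4 * √3 / 27 * d * I := by
  refine ⟨_, hasArcIntegral_fourth hd2 hd7, ?_⟩
  unfold arcPrimitive
  have h3 : √3 ^ 2 = 3 := Real.sq_sqrt (by norm_num)
  have hne : √3 ≠ 0 := by positivity
  have hs0 : √(4 * d ^ 2 - 3) ^ 2 = 4 * d ^ 2 - 3 := Real.sq_sqrt (by nlinarith)
  generalize √(4 * d ^ 2 - 3) = s at *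
  generalize Real.arcsin (√3 / (2 * d)) = a at *
  generalize Real.pi = π at *
  generalize √3 = w at *
  field_simp
  grind

lemma exists_hasArcIntegral_fifth {d : ℝ} (hd : 0 < d) (hd7 : 7 ≤ d ^ 2) (hd3 : d ≤ 3) :
    ∃ I, HasArcIntegral d 0 (Real.pi / 2) I ∧
      2 / 9 * d * (-(2 / √3) * (d ^ 2 / 3 + 6) * Real.arcsin (3 * √3 / (2 * d))
        - 4 / √3 * (d ^ 2 / 3 + 2) * Real.arcsin (√3 / d)
        + (1 / 3 + 5 * Real.pi / (9 * √3)) * d ^ 2 - 4 * √(d ^ 2 - 3)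
        - 11 / 6 * √(4 * d ^ 2 - 27) + 28 * Real.pi / (3 * √3) + 9 / 2) =
        4 * √3 / 27 * d * I := by
  refine ⟨_, hasArcIntegral_fifth hd hd7 hd3, ?_⟩
  unfold arcPrimitive
  have h3 : √3 ^ 2 = 3 := Real.sq_sqrt (by norm_num)
  have hne : √3 ≠ 0 := by positivity
  have hs0 : √(4 * d ^ 2 - 27) ^ 2 = 4 * d ^ 2 - 27 := Real.sq_sqrt (by nlinarith)
  have hs1 : √(d ^ 2 - 3) ^ 2 = d ^ 2 - 3 := Real.sq_sqrt (by nlinarith)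
  generalize √(4 * d ^ 2 - 27) = s at *
  generalize √(d ^ 2 - 3) = t at *
  generalize Real.arcsin (3 * √3 / (2 * d)) = a at *
  generalize Real.arcsin (√3 / d) = b at *
  generalize Real.pi = π at *
  generalize √3 = w at *
  field_simp
  grind

lemma exists_hasArcIntegral_sixth {d : ℝ} (hd3 : 3 ≤ d) (hd12 : d ^ 2 ≤ 12) :
    ∃ I, HasArcIntegral d 0 (Real.pi / 2) I ∧
      2 / 9 * d * (2 / √3 * (d ^ 2 / 3 + 12) * Real.arcsin (3 * √3 / (2 * d))
        - 4 / √3 * (d ^ 2 / 3 + 2) * Real.arcsin (√3 / d)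
        + (Real.pi / (9 * √3) - 1 / 3) * d ^ 2 - 4 * √(d ^ 2 - 3)
        + 19 / 6 * √(4 * d ^ 2 - 27) - 8 * Real.pi / (3 * √3) - 9 / 2) =
        4 * √3 / 27 * d * I := by
  refine ⟨_, hasArcIntegral_sixth hd3 hd12, ?_⟩
  unfold arcPrimitive
  have h3 : √3 ^ 2 = 3 := Real.sq_sqrt (by norm_num)
  have hne : √3 ≠ 0 := by positivity
  have hs0 : √(4 * d ^ 2 - 27) ^ 2 = 4 * d ^ 2 - 27 := Real.sq_sqrt (by nlinarith)
  have hs1 : √(d ^ 2 - 3) ^ 2 = d ^ 2 - 3 := Real.sq_sqrt (by nlinarith)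
  generalize √(4 * d ^ 2 - 27) = s at *
  generalize √(d ^ 2 - 3) = t at *
  generalize Real.arcsin (3 * √3 / (2 * d)) = a at *
  generalize Real.arcsin (√3 / d) = b at *
  generalize Real.pi = π at *
  generalize √3 = w at *
  field_simp
  grind

lemma exists_hasArcIntegral_seventh {d : ℝ} (hd : 0 < d) (hd12 : 12 ≤ d ^ 2) (hd13 : d ^ 2 ≤ 13) :
    ∃ I, HasArcIntegral d 0 (Real.pi / 2) I ∧
      2 / 9 * d * (2 / √3 * (d ^ 2 / 3 + 12)
          * (Real.arcsin (3 * √3 / (2 * d)) + Real.arcsin (2 * √3 / d))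
        - (2 / 3 + 4 * Real.pi / (9 * √3)) * d ^ 2 + 19 / 6 * √(4 * d ^ 2 - 27)
        + 16 / 3 * √(d ^ 2 - 12) - 16 * Real.pi / √3 - 25 / 2) =
        4 * √3 / 27 * d * I := by
  refine ⟨_, hasArcIntegral_seventh hd hd12 hd13, ?_⟩
  unfold arcPrimitive
  have h3 : √3 ^ 2 = 3 := Real.sq_sqrt (by norm_num)
  have hne : √3 ≠ 0 := by positivity
  have hs0 : √(4 * d ^ 2 - 27) ^ 2 = 4 * d ^ 2 - 27 := Real.sq_sqrt (by nlinarith)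
  have hs1 : √(d ^ 2 - 12) ^ 2 = d ^ 2 - 12 := Real.sq_sqrt (by nlinarith)
  generalize √(4 * d ^ 2 - 27) = s at *
  generalize √(d ^ 2 - 12) = t at *
  generalize Real.arcsin (3 * √3 / (2 * d)) = a at *
  generalize Real.arcsin (2 * √3 / d) = b at *
  generalize Real.pi = π at *
  generalize √3 = w at *
  field_simp
  grind

/-! ### The pieces of the density and their primitives -/

/-- The first piece of the claimed density. -/
noncomputable def pdfFirst (d : ℝ) : ℝ :=
  2 / 9 * d * ((Real.pi / (9 * √3) - 1 / 3) * d ^ 2 + 4 / 3 * d)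

/-- The first piece of the claimed distribution function. -/
noncomputable def cdfFirst (d : ℝ) : ℝ :=
  1 / 18 * (Real.pi / (9 * √3) - 1 / 3) * d ^ 4 + 8 / 81 * d ^ 3

/-- The second piece of the claimed density. -/
noncomputable def pdfSecond (d : ℝ) : ℝ :=
  2 / 9 * d * (2 / √3 * (d ^ 2 + 2) * Real.arcsin (√3 / (2 * d))
      - (1 / 3 + 5 * Real.pi / (9 * √3)) * d ^ 2 + 11 / 6 * √(4 * d ^ 2 - 3)
      - 4 * Real.pi / (3 * √3) - 1 / 2)

/-- The second piece of the claimed distribution function. -/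
noncomputable def cdfSecond (d : ℝ) : ℝ :=
  1 / (9 * √3) * (d ^ 4 + 4 * d ^ 2) * Real.arcsin (√3 / (2 * d))
      - (5 * Real.pi / (162 * √3) + 1 / 54) * d ^ 4
      - (4 * Real.pi / (27 * √3) + 1 / 18) * d ^ 2
      + (94 * d ^ 2 + 15) / 648 * √(4 * d ^ 2 - 3) - 1 / 72

/-- The third piece of the claimed density. -/
noncomputable def pdfThird (d : ℝ) : ℝ :=
  2 / 9 * d * (2 / √3 * (d ^ 2 / 3 - 2) * Real.arcsin (√3 / (2 * d))
      - 4 / √3 * (d ^ 2 / 3 + 4) * Real.arcsin (√3 / d)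
      + (1 + Real.pi / (3 * √3)) * d ^ 2 - 7 / 6 * √(4 * d ^ 2 - 3)
      - 20 / 3 * √(d ^ 2 - 3) + 8 * Real.pi / √3 + 9 / 2)

/-- The third piece of the claimed distribution function. -/
noncomputable def cdfThird (d : ℝ) : ℝ :=
  1 / (9 * √3) * (d ^ 4 / 3 - 4 * d ^ 2) * Real.arcsin (√3 / (2 * d))
      - 2 / (9 * √3) * (d ^ 4 / 3 + 8 * d ^ 2) * Real.arcsin (√3 / d)
      + (Real.pi / (54 * √3) + 1 / 18) * d ^ 4
      + (8 * Real.pi / (9 * √3) + 1 / 2) * d ^ 2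
      - (2 * d ^ 2 + 1) / 24 * √(4 * d ^ 2 - 3)
      - (14 * d ^ 2 + 12) / 27 * √(d ^ 2 - 3) - 7 / 72

/-- The fourth piece of the claimed density. -/
noncomputable def pdfFourth (d : ℝ) : ℝ :=
  2 / 9 * d * (2 / √3 * (d ^ 2 / 3 - 2) * Real.arcsin (√3 / (2 * d))
      + (1 / 3 - Real.pi / (9 * √3)) * d ^ 2 - 7 / 6 * √(4 * d ^ 2 - 3)
      + 8 * Real.pi / (3 * √3) + 1 / 2)

/-- The fourth piece of the claimed distribution function. -/
noncomputable def cdfFourth (d : ℝ) : ℝ :=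
  1 / (9 * √3) * (d ^ 4 / 3 - 4 * d ^ 2) * Real.arcsin (√3 / (2 * d))
      - (Real.pi / (162 * √3) - 1 / 54) * d ^ 4
      + (8 * Real.pi / (27 * √3) + 1 / 18) * d ^ 2
      - (2 * d ^ 2 + 1) / 24 * √(4 * d ^ 2 - 3) - 53 / 216

/-- The fifth piece of the claimed density. -/
noncomputable def pdfFifth (d : ℝ) : ℝ :=
  2 / 9 * d * (-(2 / √3) * (d ^ 2 / 3 + 6) * Real.arcsin (3 * √3 / (2 * d))
      - 4 / √3 * (d ^ 2 / 3 + 2) * Real.arcsin (√3 / d)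
      + (1 / 3 + 5 * Real.pi / (9 * √3)) * d ^ 2 - 4 * √(d ^ 2 - 3)
      - 11 / 6 * √(4 * d ^ 2 - 27) + 28 * Real.pi / (3 * √3) + 9 / 2)

/-- The fifth piece of the claimed distribution function. -/
noncomputable def cdfFifth (d : ℝ) : ℝ :=
  -(2 / (9 * √3)) * (d ^ 4 / 3 + 4 * d ^ 2) * Real.arcsin (√3 / d)
      - 1 / (3 * √3) * (d ^ 4 / 9 + 4 * d ^ 2) * Real.arcsin (3 * √3 / (2 * d))
      + (5 * Real.pi / (162 * √3) + 1 / 54) * d ^ 4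
      + (28 * Real.pi / (27 * √3) + 1 / 2) * d ^ 2
      - (26 * d ^ 2 + 12) / 81 * √(d ^ 2 - 3)
      - (94 * d ^ 2 + 135) / 648 * √(4 * d ^ 2 - 27) - 101 / 216

/-- The sixth piece of the claimed density. -/
noncomputable def pdfSixth (d : ℝ) : ℝ :=
  2 / 9 * d * (2 / √3 * (d ^ 2 / 3 + 12) * Real.arcsin (3 * √3 / (2 * d))
      - 4 / √3 * (d ^ 2 / 3 + 2) * Real.arcsin (√3 / d)
      + (Real.pi / (9 * √3) - 1 / 3) * d ^ 2 - 4 * √(d ^ 2 - 3)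
      + 19 / 6 * √(4 * d ^ 2 - 27) - 8 * Real.pi / (3 * √3) - 9 / 2)

/-- The sixth piece of the claimed distribution function. -/
noncomputable def cdfSixth (d : ℝ) : ℝ :=
  -(2 / (9 * √3)) * (d ^ 4 / 3 + 4 * d ^ 2) * Real.arcsin (√3 / d)
      + 1 / (3 * √3) * (d ^ 4 / 9 + 8 * d ^ 2) * Real.arcsin (3 * √3 / (2 * d))
      + (Real.pi / (162 * √3) - 1 / 54) * d ^ 4
      - (8 * Real.pi / (27 * √3) + 1 / 2) * d ^ 2
      - (26 * d ^ 2 + 12) / 81 * √(d ^ 2 - 3)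
      + (158 * d ^ 2 + 351) / 648 * √(4 * d ^ 2 - 27) - 263 / 216

/-- The seventh piece of the claimed density. -/
noncomputable def pdfSeventh (d : ℝ) : ℝ :=
  2 / 9 * d * (2 / √3 * (d ^ 2 / 3 + 12)
        * (Real.arcsin (3 * √3 / (2 * d)) + Real.arcsin (2 * √3 / d))
      - (2 / 3 + 4 * Real.pi / (9 * √3)) * d ^ 2 + 19 / 6 * √(4 * d ^ 2 - 27)
      + 16 / 3 * √(d ^ 2 - 12) - 16 * Real.pi / √3 - 25 / 2)

/-- The seventh piece of the claimed distribution function. -/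
noncomputable def cdfSeventh (d : ℝ) : ℝ :=
  1 / (3 * √3) * (d ^ 4 / 9 + 8 * d ^ 2)
        * (Real.arcsin (3 * √3 / (2 * d)) + Real.arcsin (2 * √3 / d))
      - (2 * Real.pi / (81 * √3) + 1 / 27) * d ^ 4
      - (16 * Real.pi / (9 * √3) + 25 / 18) * d ^ 2
      + (158 * d ^ 2 + 351) / 648 * √(4 * d ^ 2 - 27)
      + (34 * d ^ 2 + 96) / 81 * √(d ^ 2 - 12) + 25 / 216

lemma breakpoints_lt : (1 : ℝ) < √3 ∧ √3 < 2 ∧ 2 < √7 ∧ √7 < 3 ∧ 3 < 2 * √3 ∧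
    2 * √3 < √13 := by
  have h3 : √3 ^ 2 = 3 := Real.sq_sqrt (by norm_num)
  have h3' : 0 ≤ √3 := Real.sqrt_nonneg _
  refine ⟨?_, ?_, ?_, ?_, ?_, ?_⟩
  · rw [Real.lt_sqrt] <;> norm_num
  · rw [Real.sqrt_lt'] <;> norm_num
  · rw [Real.lt_sqrt] <;> norm_num
  · rw [Real.sqrt_lt'] <;> norm_num
  · nlinarith
  · rw [Real.lt_sqrt, mul_pow, h3] <;> [norm_num; positivity]

section derivatives

variable {c d m : ℝ}

lemma hasDerivAt_sqrt_sq_sub (hm : m < d ^ 2) :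
    HasDerivAt (fun x => √(x ^ 2 - m)) (d / √(d ^ 2 - m)) d := by
  have h := (((hasDerivAt_id d).pow 2).sub_const m).sqrt (by simp; linarith)
  refine h.congr_deriv ?_
  have : √(d ^ 2 - m) ≠ 0 := (Real.sqrt_pos.2 (by linarith)).ne'
  simp only [id, Pi.pow_apply]
  field_simp
  simp

lemma hasDerivAt_sqrt_four_mul_sq_sub (hm : m < 4 * d ^ 2) :
    HasDerivAt (fun x => √(4 * x ^ 2 - m)) (4 * d / √(4 * d ^ 2 - m)) d := by
  have h := ((((hasDerivAt_id d).pow 2).const_mul 4).sub_const m).sqrt (by simp; linarith)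
  refine h.congr_deriv ?_
  have : √(4 * d ^ 2 - m) ≠ 0 := (Real.sqrt_pos.2 (by linarith)).ne'
  simp only [id, Pi.pow_apply]
  field_simp
  norm_num

lemma hasDerivAt_arcsin_div (hd : 0 < d) (hc : c ^ 2 = m) (hm : m < d ^ 2) :
    HasDerivAt (fun x => Real.arcsin (c / x)) (-c / (d * √(d ^ 2 - m))) d := by
  have habs : |c| < d := abs_lt_of_sq_lt_sq (by linarith) hd.le
  rw [abs_lt] at habs
  have h1 : c / d ≠ -1 := by
    intro h
    rw [div_eq_iff hd.ne'] at h
    linarith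
  have h2 : c / d ≠ 1 := by
    intro h
    rw [div_eq_iff hd.ne'] at h
    linarith
  have h := (Real.hasDerivAt_arcsin h1 h2).comp d
    ((hasDerivAt_const d c).div (hasDerivAt_id d) hd.ne')
  refine h.congr_deriv ?_
  have e : √(1 - (c / d) ^ 2) = √(d ^ 2 - m) / d := by
    rw [show 1 - (c / d) ^ 2 = (d ^ 2 - m) / d ^ 2 by rw [← hc]; field_simp,
      Real.sqrt_div' _ (sq_nonneg d), Real.sqrt_sq hd.le]
  have : √(d ^ 2 - m) ≠ 0 := (Real.sqrt_pos.2 (by linarith)).ne'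
  rw [e]
  field_simp
  ring

lemma hasDerivAt_arcsin_div_two_mul (hd : 0 < d) (hc : c ^ 2 = m) (hm : m < 4 * d ^ 2) :
    HasDerivAt (fun x => Real.arcsin (c / (2 * x))) (-c / (d * √(4 * d ^ 2 - m))) d := by
  have h := hasDerivAt_arcsin_div (c := c / 2) (m := m / 4) hd (by rw [div_pow, hc]; norm_num)
    (by linarith)
  have e : √(4 * d ^ 2 - m) = 2 * √(d ^ 2 - m / 4) := by
    rw [← sqrt_four_mul_sub]; ring_nf
  rw [e]
  have e2 : -c / (d * (2 * √(d ^ 2 - m / 4))) = -(c / 2) / (d * √(d ^ 2 - m / 4)) := by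
    rw [show d * (2 * √(d ^ 2 - m / 4)) = 2 * (d * √(d ^ 2 - m / 4)) by ring]
    rw [← div_div]; ring
  rw [e2]
  simpa only [div_div] using h

/-- The common shape of the pieces from the second to the seventh: at most two arcsines `g₁`, `g₂`
and two square roots `h₁`, `h₂` with polynomial coefficients, plus an even quartic. A piece with
only one of each takes zero for the other. -/
lemma hasDerivAt_arcsin_sqrt_combination {g₁ g₂ h₁ h₂ : ℝ → ℝ} {g₁' g₂' h₁' h₂' : ℝ}
    (hg₁ : HasDerivAt g₁ g₁' d) (hg₂ : HasDerivAt g₂ g₂' d)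
    (hh₁ : HasDerivAt h₁ h₁' d) (hh₂ : HasDerivAt h₂ h₂' d)
    (α₁ β₁ γ₁ δ₁ α₂ β₂ γ₂ δ₂ α β ρ : ℝ) :
    HasDerivAt (fun x => (α₁ * x ^ 4 + β₁ * x ^ 2) * g₁ x + (γ₁ * x ^ 2 + δ₁) * h₁ x
        + ((α₂ * x ^ 4 + β₂ * x ^ 2) * g₂ x + (γ₂ * x ^ 2 + δ₂) * h₂ x)
        + (α * x ^ 4 + β * x ^ 2 + ρ))
      ((4 * α₁ * d ^ 3 + 2 * β₁ * d) * g₁ d + (α₁ * d ^ 4 + β₁ * d ^ 2) * g₁'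
        + (2 * γ₁ * d * h₁ d + (γ₁ * d ^ 2 + δ₁) * h₁')
        + ((4 * α₂ * d ^ 3 + 2 * β₂ * d) * g₂ d + (α₂ * d ^ 4 + β₂ * d ^ 2) * g₂'
        + (2 * γ₂ * d * h₂ d + (γ₂ * d ^ 2 + δ₂) * h₂'))
        + (4 * α * d ^ 3 + 2 * β * d)) d := by
  have q : ∀ a b : ℝ, HasDerivAt (fun x : ℝ => a * x ^ 4 + b * x ^ 2)
      (4 * a * d ^ 3 + 2 * b * d) d := fun a b =>
    (((hasDerivAt_pow 4 d).const_mul a).add ((hasDerivAt_pow 2 d).const_mul b)).congr_deriv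
      (by norm_num; ring)
  have r : ∀ a b : ℝ, HasDerivAt (fun x : ℝ => a * x ^ 2 + b) (2 * a * d) d := fun a b =>
    (((hasDerivAt_pow 2 d).const_mul a).add_const b).congr_deriv (by norm_num; ring)
  exact ((((q α₁ β₁).mul hg₁).add ((r γ₁ δ₁).mul hh₁)).add
    (((q α₂ β₂).mul hg₂).add ((r γ₂ δ₂).mul hh₂))).add ((q α β).add_const ρ)

lemma sq_sqrt_three : √3 ^ 2 = (3 : ℝ) := Real.sq_sqrt (by norm_num)

lemma sq_three_mul_sqrt_three : (3 * √3) ^ 2 = (27 : ℝ) := by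
  rw [mul_pow, sq_sqrt_three]; norm_num

lemma sq_two_mul_sqrt_three : (2 * √3) ^ 2 = (12 : ℝ) := by
  rw [mul_pow, sq_sqrt_three]; norm_num

lemma hasDerivAt_cdfFirst : HasDerivAt cdfFirst (pdfFirst d) d := by
  unfold cdfFirst
  have h := ((hasDerivAt_pow 4 d).const_mul (1 / 18 * (Real.pi / (9 * √3) - 1 / 3))).add
    ((hasDerivAt_pow 3 d).const_mul (8 / 81))
  refine h.congr_deriv ?_
  unfold pdfFirst
  norm_num
  ring

lemma hasDerivAt_cdfSecond (hd : 0 < d) (h : 3 < 4 * d ^ 2) :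
    HasDerivAt cdfSecond (pdfSecond d) d := by
  have hs := Real.sqrt_pos.2 (sub_pos.2 h)
  have hs2 := Real.sq_sqrt (sub_pos.2 h).le
  have h3 := sq_sqrt_three
  have hne : √3 ≠ 0 := by positivity
  have := hasDerivAt_arcsin_sqrt_combination
    (hasDerivAt_arcsin_div_two_mul hd sq_sqrt_three h) (hasDerivAt_const d (0 : ℝ))
    (hasDerivAt_sqrt_four_mul_sq_sub h) (hasDerivAt_const d (0 : ℝ))
    (1 / (9 * √3)) (4 / (9 * √3)) (94 / 648) (15 / 648) 0 0 0 0
    (-(5 * Real.pi / (162 * √3) + 1 / 54)) (-(4 * Real.pi / (27 * √3) + 1 / 18)) (-1 / 72)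
  refine (this.congr_of_eventuallyEq (.of_forall fun x => ?_)).congr_deriv ?_
  · unfold cdfSecond
    ring
  · unfold pdfSecond
    clear this
    generalize √(4 * d ^ 2 - 3) = s at *
    generalize Real.arcsin (√3 / (2 * d)) = a at *
    generalize Real.pi = π at *
    generalize √3 = w at *
    field_simp
    grind

lemma hasDerivAt_cdfThird (hd : 0 < d) (h : 3 < d ^ 2) :
    HasDerivAt cdfThird (pdfThird d) d := by
  have h' : 3 < 4 * d ^ 2 := by linarith
  have hs := Real.sqrt_pos.2 (sub_pos.2 h)
  have hs2 := Real.sq_sqrt (sub_pos.2 h).le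
  have ht := Real.sqrt_pos.2 (sub_pos.2 h')
  have ht2 := Real.sq_sqrt (sub_pos.2 h').le
  have h3 := sq_sqrt_three
  have hne : √3 ≠ 0 := by positivity
  have := hasDerivAt_arcsin_sqrt_combination
    (hasDerivAt_arcsin_div_two_mul hd sq_sqrt_three h') (hasDerivAt_arcsin_div hd sq_sqrt_three h)
    (hasDerivAt_sqrt_four_mul_sq_sub h') (hasDerivAt_sqrt_sq_sub h)
    (1 / (27 * √3)) (-4 / (9 * √3)) (-2 / 24) (-1 / 24)
    (-2 / (27 * √3)) (-16 / (9 * √3)) (-14 / 27) (-12 / 27)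
    (Real.pi / (54 * √3) + 1 / 18) (8 * Real.pi / (9 * √3) + 1 / 2) (-7 / 72)
  refine (this.congr_of_eventuallyEq (.of_forall fun x => ?_)).congr_deriv ?_
  · unfold cdfThird
    ring
  · unfold pdfThird
    clear this
    generalize √(4 * d ^ 2 - 3) = s at *
    generalize √(d ^ 2 - 3) = t at *
    generalize Real.arcsin (√3 / (2 * d)) = a at *
    generalize Real.arcsin (√3 / d) = b at *
    generalize Real.pi = π at *
    generalize √3 = w at *
    field_simp
    grind

lemma hasDerivAt_cdfFourth (hd : 0 < d) (h : 3 < 4 * d ^ 2) :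
    HasDerivAt cdfFourth (pdfFourth d) d := by
  have hs := Real.sqrt_pos.2 (sub_pos.2 h)
  have hs2 := Real.sq_sqrt (sub_pos.2 h).le
  have h3 := sq_sqrt_three
  have hne : √3 ≠ 0 := by positivity
  have := hasDerivAt_arcsin_sqrt_combination
    (hasDerivAt_arcsin_div_two_mul hd sq_sqrt_three h) (hasDerivAt_const d (0 : ℝ))
    (hasDerivAt_sqrt_four_mul_sq_sub h) (hasDerivAt_const d (0 : ℝ))
    (1 / (27 * √3)) (-4 / (9 * √3)) (-2 / 24) (-1 / 24) 0 0 0 0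
    (-(Real.pi / (162 * √3) - 1 / 54)) (8 * Real.pi / (27 * √3) + 1 / 18) (-53 / 216)
  refine (this.congr_of_eventuallyEq (.of_forall fun x => ?_)).congr_deriv ?_
  · unfold cdfFourth
    ring
  · unfold pdfFourth
    clear this
    generalize √(4 * d ^ 2 - 3) = s at *
    generalize Real.arcsin (√3 / (2 * d)) = a at *
    generalize Real.pi = π at *
    generalize √3 = w at *
    field_simp
    grind

lemma hasDerivAt_cdfFifth (hd : 0 < d) (h : 27 < 4 * d ^ 2) :
    HasDerivAt cdfFifth (pdfFifth d) d := by
  have h' : 3 < d ^ 2 := by linarith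
  have hs := Real.sqrt_pos.2 (sub_pos.2 h)
  have hs2 := Real.sq_sqrt (sub_pos.2 h).le
  have ht := Real.sqrt_pos.2 (sub_pos.2 h')
  have ht2 := Real.sq_sqrt (sub_pos.2 h').le
  have h3 := sq_sqrt_three
  have hne : √3 ≠ 0 := by positivity
  have := hasDerivAt_arcsin_sqrt_combination
    (hasDerivAt_arcsin_div_two_mul hd sq_three_mul_sqrt_three h)
    (hasDerivAt_arcsin_div hd sq_sqrt_three h')
    (hasDerivAt_sqrt_four_mul_sq_sub h) (hasDerivAt_sqrt_sq_sub h')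
    (-1 / (27 * √3)) (-4 / (3 * √3)) (-94 / 648) (-135 / 648)
    (-2 / (27 * √3)) (-8 / (9 * √3)) (-26 / 81) (-12 / 81)
    (5 * Real.pi / (162 * √3) + 1 / 54) (28 * Real.pi / (27 * √3) + 1 / 2) (-101 / 216)
  refine (this.congr_of_eventuallyEq (.of_forall fun x => ?_)).congr_deriv ?_
  · unfold cdfFifth
    ring
  · unfold pdfFifth
    clear this
    generalize √(4 * d ^ 2 - 27) = s at *
    generalize √(d ^ 2 - 3) = t at *
    generalize Real.arcsin (3 * √3 / (2 * d)) = a at *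
    generalize Real.arcsin (√3 / d) = b at *
    generalize Real.pi = π at *
    generalize √3 = w at *
    field_simp
    grind

lemma hasDerivAt_cdfSixth (hd : 0 < d) (h : 27 < 4 * d ^ 2) :
    HasDerivAt cdfSixth (pdfSixth d) d := by
  have h' : 3 < d ^ 2 := by linarith
  have hs := Real.sqrt_pos.2 (sub_pos.2 h)
  have hs2 := Real.sq_sqrt (sub_pos.2 h).le
  have ht := Real.sqrt_pos.2 (sub_pos.2 h')
  have ht2 := Real.sq_sqrt (sub_pos.2 h').le
  have h3 := sq_sqrt_three
  have hne : √3 ≠ 0 := by positivity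
  have := hasDerivAt_arcsin_sqrt_combination
    (hasDerivAt_arcsin_div_two_mul hd sq_three_mul_sqrt_three h)
    (hasDerivAt_arcsin_div hd sq_sqrt_three h')
    (hasDerivAt_sqrt_four_mul_sq_sub h) (hasDerivAt_sqrt_sq_sub h')
    (1 / (27 * √3)) (8 / (3 * √3)) (158 / 648) (351 / 648)
    (-2 / (27 * √3)) (-8 / (9 * √3)) (-26 / 81) (-12 / 81)
    (Real.pi / (162 * √3) - 1 / 54) (-(8 * Real.pi / (27 * √3) + 1 / 2)) (-263 / 216)
  refine (this.congr_of_eventuallyEq (.of_forall fun x => ?_)).congr_deriv ?_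
  · unfold cdfSixth
    ring
  · unfold pdfSixth
    clear this
    generalize √(4 * d ^ 2 - 27) = s at *
    generalize √(d ^ 2 - 3) = t at *
    generalize Real.arcsin (3 * √3 / (2 * d)) = a at *
    generalize Real.arcsin (√3 / d) = b at *
    generalize Real.pi = π at *
    generalize √3 = w at *
    field_simp
    grind

lemma hasDerivAt_cdfSeventh (hd : 0 < d) (h : 12 < d ^ 2) :
    HasDerivAt cdfSeventh (pdfSeventh d) d := by
  have h' : 27 < 4 * d ^ 2 := by linarith
  have hs := Real.sqrt_pos.2 (sub_pos.2 h)
  have hs2 := Real.sq_sqrt (sub_pos.2 h).le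
  have ht := Real.sqrt_pos.2 (sub_pos.2 h')
  have ht2 := Real.sq_sqrt (sub_pos.2 h').le
  have h3 := sq_sqrt_three
  have hne : √3 ≠ 0 := by positivity
  have := hasDerivAt_arcsin_sqrt_combination
    (hasDerivAt_arcsin_div_two_mul hd sq_three_mul_sqrt_three h')
    (hasDerivAt_arcsin_div hd sq_two_mul_sqrt_three h)
    (hasDerivAt_sqrt_four_mul_sq_sub h') (hasDerivAt_sqrt_sq_sub h)
    (1 / (27 * √3)) (8 / (3 * √3)) (158 / 648) (351 / 648)
    (1 / (27 * √3)) (8 / (3 * √3)) (34 / 81) (96 / 81)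
    (-(2 * Real.pi / (81 * √3) + 1 / 27)) (-(16 * Real.pi / (9 * √3) + 25 / 18)) (25 / 216)
  refine (this.congr_of_eventuallyEq (.of_forall fun x => ?_)).congr_deriv ?_
  · unfold cdfSeventh
    ring
  · unfold pdfSeventh
    clear this
    generalize √(4 * d ^ 2 - 27) = s at *
    generalize √(d ^ 2 - 12) = t at *
    generalize Real.arcsin (3 * √3 / (2 * d)) = a at *
    generalize Real.arcsin (2 * √3 / d) = b at *
    generalize Real.pi = π at *
    generalize √3 = w at *
    field_simp
    grind

end derivatives

/-! ### Continuity and agreement of the pieces at the breakpoints -/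

section continuity

lemma continuousOn_of_continuousAt_pos {f : ℝ → ℝ} {a b : ℝ} (ha : 0 < a)
    (h : ∀ x, 0 < x → ContinuousAt f x) : ContinuousOn f (Set.Icc a b) :=
  fun x hx => (h x (ha.trans_le hx.1)).continuousWithinAt

variable {x : ℝ}

lemma continuousAt_arcsin_div (c : ℝ) (hx : 0 < x) :
    ContinuousAt (fun d => Real.arcsin (c / d)) x :=
  Real.continuous_arcsin.continuousAt.comp (by fun_prop (disch := positivity))

lemma continuousAt_arcsin_div_two_mul (c : ℝ) (hx : 0 < x) :
    ContinuousAt (fun d => Real.arcsin (c / (2 * d))) x :=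
  Real.continuous_arcsin.continuousAt.comp (by fun_prop (disch := positivity))

lemma continuousAt_cdfSecond (hx : 0 < x) : ContinuousAt cdfSecond x := by
  have := continuousAt_arcsin_div_two_mul (√3) hx
  unfold cdfSecond
  fun_prop

lemma continuousAt_cdfThird (hx : 0 < x) : ContinuousAt cdfThird x := by
  have := continuousAt_arcsin_div_two_mul (√3) hx
  have := continuousAt_arcsin_div (√3) hx
  unfold cdfThird
  fun_prop

lemma continuousAt_cdfFourth (hx : 0 < x) : ContinuousAt cdfFourth x := by
  have := continuousAt_arcsin_div_two_mul (√3) hx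
  unfold cdfFourth
  fun_prop

lemma continuousAt_cdfFifth (hx : 0 < x) : ContinuousAt cdfFifth x := by
  have := continuousAt_arcsin_div_two_mul (3 * √3) hx
  have := continuousAt_arcsin_div (√3) hx
  unfold cdfFifth
  fun_prop

lemma continuousAt_cdfSixth (hx : 0 < x) : ContinuousAt cdfSixth x := by
  have := continuousAt_arcsin_div_two_mul (3 * √3) hx
  have := continuousAt_arcsin_div (√3) hx
  unfold cdfSixth
  fun_prop

lemma continuousAt_cdfSeventh (hx : 0 < x) : ContinuousAt cdfSeventh x := by
  have := continuousAt_arcsin_div_two_mul (3 * √3) hx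
  have := continuousAt_arcsin_div (2 * √3) hx
  unfold cdfSeventh
  fun_prop

end continuity

lemma arcsin_sqrt_three_div_two : Real.arcsin (√3 / 2) = Real.pi / 3 := by
  rw [← Real.sin_pi_div_three, Real.arcsin_sin] <;> linarith [Real.pi_pos]

lemma arcsin_one_half : Real.arcsin (1 / 2) = Real.pi / 6 := by
  rw [← Real.sin_pi_div_six, Real.arcsin_sin] <;> linarith [Real.pi_pos]

lemma cdfSecond_one : cdfSecond 1 = cdfFirst 1 := by
  unfold cdfSecond cdfFirst
  have e1 : √(4 * 1 ^ 2 - 3 : ℝ) = 1 := by norm_num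
  rw [mul_one, arcsin_sqrt_three_div_two, e1]
  field_simp
  ring

lemma cdfThird_sqrt_three : cdfThird (√3) = cdfSecond (√3) := by
  unfold cdfThird cdfSecond
  have hne : √3 ≠ 0 := by positivity
  have h3 := sq_sqrt_three
  have e1 : √(4 * √3 ^ 2 - 3) = 3 := by
    rw [h3, show (4 * 3 - 3 : ℝ) = 3 ^ 2 by norm_num, Real.sqrt_sq (by norm_num)]
  have e2 : √(√3 ^ 2 - 3) = 0 := by rw [h3]; simp
  have e3 : √3 / (2 * √3) = 1 / 2 := by field_simp
  rw [e1, e2, e3, arcsin_one_half, div_self hne, Real.arcsin_one]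
  generalize √3 = w at *
  field_simp
  grind

lemma cdfFourth_two : cdfFourth 2 = cdfThird 2 := by
  unfold cdfFourth cdfThird
  have hne : √3 ≠ 0 := by positivity
  have h3 := sq_sqrt_three
  have e2 : √(2 ^ 2 - 3 : ℝ) = 1 := by norm_num
  rw [e2, arcsin_sqrt_three_div_two]
  generalize √3 = w at *
  field_simp
  grind

/-- On the quarter circle `ξ` determines the angle, so crossings that coincide give linear relations
between arcsines. -/
lemma IsArcPoint.eq {d a b ξ y y' : ℝ} (hd : 0 < d) (ha : IsArcPoint d a ξ y)
    (hb : IsArcPoint d b ξ y') : a = b :=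
  le_antisymm (ha.le hd hb le_rfl) (hb.le hd ha le_rfl)

lemma cdfFifth_sqrt_seven : cdfFifth (√7) = cdfFourth (√7) := by
  unfold cdfFifth cdfFourth
  have hne : √3 ≠ 0 := by positivity
  have h3 := sq_sqrt_three
  have hd : 0 < √7 := by positivity
  have h7 : √7 ^ 2 = 7 := Real.sq_sqrt (by norm_num)
  -- At `d = √7` the circle passes through the lattice point `(2, 1)`, where the lines `q = 1`, `p =
  -- 2` and `p + q = 3` meet. The three crossing angles are therefore equal, which expresses two of
  -- the arcsines through the third.
  have p1 := isArcPoint_upper_one hd (by rw [h7]; norm_num)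
  have p2 := isArcPoint_lower_two hd (by rw [h7]; norm_num) (by rw [h7]; norm_num)
  have p3 := isArcPoint_vertical_three hd h7.ge
  have e1 : √(4 * √7 ^ 2 - 3) = 5 := by
    rw [h7, show (4 * 7 - 3 : ℝ) = 5 ^ 2 by norm_num, Real.sqrt_sq (by norm_num)]
  have e2 : √(√7 ^ 2 - 3) = 2 := by
    rw [h7, show (7 - 3 : ℝ) = 2 ^ 2 by norm_num, Real.sqrt_sq (by norm_num)]
  have e3 : √(4 * √7 ^ 2 - 27) = 1 := by rw [h7]; norm_num
  have h4 : √7 ^ 4 = 49 := by rw [show √7 ^ 4 = (√7 ^ 2) ^ 2 by ring, h7]; norm_num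
  rw [e1] at p1
  rw [e2] at p2
  rw [e1, e2, e3, h4, h7]
  norm_num only at p1 p2 p3
  have q1 := p1.eq hd p3
  have q2 := p2.eq hd p3
  generalize Real.arcsin (3 * √3 / (2 * √7)) = a at *
  generalize Real.arcsin (√3 / (2 * √7)) = b at *
  generalize Real.arcsin (√3 / √7) = c at *
  generalize Real.pi = π at *
  generalize √3 = w at *
  have q1' : a = π / 3 + b := by linarith
  have q2' : c = π / 3 - b := by linarith
  subst q1' q2'
  field_simp
  grind

lemma cdfSixth_three : cdfSixth 3 = cdfFifth 3 := by
  unfold cdfSixth cdfFifth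
  have hne : √3 ≠ 0 := by positivity
  have h3 := sq_sqrt_three
  have e1 : √(4 * 3 ^ 2 - 27 : ℝ) = 3 := by
    rw [show (4 * 3 ^ 2 - 27 : ℝ) = 3 ^ 2 by norm_num, Real.sqrt_sq (by norm_num)]
  have e2 : 3 * √3 / (2 * 3) = √3 / 2 := by ring
  rw [e1, e2, arcsin_sqrt_three_div_two]
  generalize √3 = w at *
  field_simp
  grind

lemma cdfSeventh_two_mul_sqrt_three : cdfSeventh (2 * √3) = cdfSixth (2 * √3) := by
  unfold cdfSeventh cdfSixth
  have hne : √3 ≠ 0 := by positivity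
  have h3 := sq_sqrt_three
  have h12 := sq_two_mul_sqrt_three
  have h4 : (2 * √3) ^ 4 = 144 := by rw [show (2 * √3) ^ 4 = ((2 * √3) ^ 2) ^ 2 by ring, h12]; norm_num
  have e1 : √((2 * √3) ^ 2 - 12) = 0 := by rw [h12]; norm_num
  have e2 : √((2 * √3) ^ 2 - 3) = 3 := by
    rw [h12, show (12 - 3 : ℝ) = 3 ^ 2 by norm_num, Real.sqrt_sq (by norm_num)]
  have e3 : √3 / (2 * √3) = 1 / 2 := by field_simp
  rw [e1, e2, e3, arcsin_one_half, div_self (by positivity), Real.arcsin_one, h4, h12]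
  generalize √3 = w at *
  field_simp
  grind

/-! ### The piecewise definitions, range by range -/

section pieces

variable {d : ℝ}

lemma hexPairPDF_first (h0 : 0 < d) (h1 : d ≤ 1) : hexPairPDF d = pdfFirst d := by
  rw [hexPairPDF, if_neg h0.not_gt, if_pos h1, pdfFirst]

lemma hexPairPDF_second (h0 : 1 < d) (h1 : d ≤ √3) : hexPairPDF d = pdfSecond d := by
  rw [hexPairPDF, if_neg (by linarith), if_neg h0.not_ge, if_pos h1, pdfSecond]

lemma hexPairPDF_third (h0 : √3 < d) (h1 : d ≤ 2) : hexPairPDF d = pdfThird d := by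
  obtain ⟨b1, b2, b3, b4, b5, b6⟩ := breakpoints_lt
  rw [hexPairPDF, if_neg (by linarith), if_neg (by linarith), if_neg h0.not_ge, if_pos h1,
    pdfThird]

lemma hexPairPDF_fourth (h0 : 2 < d) (h1 : d ≤ √7) : hexPairPDF d = pdfFourth d := by
  obtain ⟨b1, b2, b3, b4, b5, b6⟩ := breakpoints_lt
  rw [hexPairPDF, if_neg (by linarith), if_neg (by linarith), if_neg (by linarith),
    if_neg h0.not_ge, if_pos h1, pdfFourth]

lemma hexPairPDF_fifth (h0 : √7 < d) (h1 : d ≤ 3) : hexPairPDF d = pdfFifth d := by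
  obtain ⟨b1, b2, b3, b4, b5, b6⟩ := breakpoints_lt
  rw [hexPairPDF, if_neg (by linarith), if_neg (by linarith), if_neg (by linarith),
    if_neg (by linarith), if_neg h0.not_ge, if_pos h1, pdfFifth]

lemma hexPairPDF_sixth (h0 : 3 < d) (h1 : d ≤ 2 * √3) : hexPairPDF d = pdfSixth d := by
  obtain ⟨b1, b2, b3, b4, b5, b6⟩ := breakpoints_lt
  rw [hexPairPDF, if_neg (by linarith), if_neg (by linarith), if_neg (by linarith),
    if_neg (by linarith), if_neg (by linarith), if_neg h0.not_ge, if_pos h1, pdfSixth]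

lemma hexPairPDF_seventh (h0 : 2 * √3 < d) (h1 : d ≤ √13) : hexPairPDF d = pdfSeventh d := by
  obtain ⟨b1, b2, b3, b4, b5, b6⟩ := breakpoints_lt
  rw [hexPairPDF, if_neg (by linarith), if_neg (by linarith), if_neg (by linarith),
    if_neg (by linarith), if_neg (by linarith), if_neg (by linarith), if_neg h0.not_ge,
    if_pos h1, pdfSeventh]

lemma hexPairPDF_far (h0 : √13 < d) : hexPairPDF d = 0 := by
  obtain ⟨b1, b2, b3, b4, b5, b6⟩ := breakpoints_lt
  rw [hexPairPDF, if_neg (by linarith), if_neg (by linarith), if_neg (by linarith),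
    if_neg (by linarith), if_neg (by linarith), if_neg (by linarith), if_neg (by linarith),
    if_neg h0.not_ge]

lemma hexPairCDF_first (h0 : 0 ≤ d) (h1 : d ≤ 1) : hexPairCDF d = cdfFirst d := by
  rw [hexPairCDF, if_neg h0.not_gt, if_pos h1, cdfFirst]

lemma hexPairCDF_second (h0 : 1 ≤ d) (h1 : d ≤ √3) : hexPairCDF d = cdfSecond d := by
  -- At the left endpoint the definition selects the previous piece, so agreement of the two pieces
  -- is what allows a closed interval. The same holds at each later breakpoint.
  rcases h0.eq_or_lt with rfl | h0
  · rw [cdfSecond_one, hexPairCDF_first zero_le_one le_rfl]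
  rw [hexPairCDF, if_neg (by linarith), if_neg h0.not_ge, if_pos h1, cdfSecond]

lemma hexPairCDF_third (h0 : √3 ≤ d) (h1 : d ≤ 2) : hexPairCDF d = cdfThird d := by
  obtain ⟨b1, b2, b3, b4, b5, b6⟩ := breakpoints_lt
  rcases h0.eq_or_lt with rfl | h0
  · rw [cdfThird_sqrt_three, hexPairCDF_second b1.le le_rfl]
  rw [hexPairCDF, if_neg (by linarith), if_neg (by linarith), if_neg h0.not_ge, if_pos h1,
    cdfThird]

lemma hexPairCDF_fourth (h0 : 2 ≤ d) (h1 : d ≤ √7) : hexPairCDF d = cdfFourth d := by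
  obtain ⟨b1, b2, b3, b4, b5, b6⟩ := breakpoints_lt
  rcases h0.eq_or_lt with rfl | h0
  · rw [cdfFourth_two, hexPairCDF_third b2.le le_rfl]
  rw [hexPairCDF, if_neg (by linarith), if_neg (by linarith), if_neg (by linarith),
    if_neg h0.not_ge, if_pos h1, cdfFourth]

lemma hexPairCDF_fifth (h0 : √7 ≤ d) (h1 : d ≤ 3) : hexPairCDF d = cdfFifth d := by
  obtain ⟨b1, b2, b3, b4, b5, b6⟩ := breakpoints_lt
  rcases h0.eq_or_lt with rfl | h0
  · rw [cdfFifth_sqrt_seven, hexPairCDF_fourth b3.le le_rfl]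
  rw [hexPairCDF, if_neg (by linarith), if_neg (by linarith), if_neg (by linarith),
    if_neg (by linarith), if_neg h0.not_ge, if_pos h1, cdfFifth]

lemma hexPairCDF_sixth (h0 : 3 ≤ d) (h1 : d ≤ 2 * √3) : hexPairCDF d = cdfSixth d := by
  obtain ⟨b1, b2, b3, b4, b5, b6⟩ := breakpoints_lt
  rcases h0.eq_or_lt with rfl | h0
  · rw [cdfSixth_three, hexPairCDF_fifth b4.le le_rfl]
  rw [hexPairCDF, if_neg (by linarith), if_neg (by linarith), if_neg (by linarith),
    if_neg (by linarith), if_neg (by linarith), if_neg h0.not_ge, if_pos h1, cdfSixth]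

lemma hexPairCDF_seventh (h0 : 2 * √3 ≤ d) (h1 : d ≤ √13) : hexPairCDF d = cdfSeventh d := by
  obtain ⟨b1, b2, b3, b4, b5, b6⟩ := breakpoints_lt
  rcases h0.eq_or_lt with rfl | h0
  · rw [cdfSeventh_two_mul_sqrt_three, hexPairCDF_sixth b5.le le_rfl]
  rw [hexPairCDF, if_neg (by linarith), if_neg (by linarith), if_neg (by linarith),
    if_neg (by linarith), if_neg (by linarith), if_neg (by linarith), if_neg h0.not_ge,
    if_pos h1, cdfSeventh]

lemma hexPairCDF_far (h0 : √13 < d) : hexPairCDF d = 1 := by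
  obtain ⟨b1, b2, b3, b4, b5, b6⟩ := breakpoints_lt
  rw [hexPairCDF, if_neg (by linarith), if_neg (by linarith), if_neg (by linarith),
    if_neg (by linarith), if_neg (by linarith), if_neg (by linarith), if_neg (by linarith),
    if_neg h0.not_ge]

end pieces

/-- The density is a multiple of the average overlap over the circle of radius `d`. -/
theorem exists_hasArcIntegral {d : ℝ} (hd : 0 < d) :
    ∃ I, HasArcIntegral d 0 (Real.pi / 2) I ∧ hexPairPDF d = 4 * √3 / 27 * d * I := by
  have hsq : ∀ x : ℝ, 0 ≤ x → √x ≤ d → x ≤ d ^ 2 := fun x hx h => by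
    rw [← Real.sq_sqrt hx]; gcongr
  have hsq' : ∀ x : ℝ, 0 ≤ x → d ≤ √x → d ^ 2 ≤ x := fun x hx h => by
    rw [← Real.sq_sqrt hx]; gcongr
  rcases le_or_gt d 1 with h1 | h1
  · rw [hexPairPDF_first hd h1]
    exact exists_hasArcIntegral_first hd h1
  rcases le_or_gt d (√3) with h2 | h2
  · rw [hexPairPDF_second h1 h2]
    exact exists_hasArcIntegral_second h1.le (hsq' 3 (by norm_num) h2)
  rcases le_or_gt d 2 with h3 | h3
  · rw [hexPairPDF_third h2 h3]
    exact exists_hasArcIntegral_third hd (hsq 3 (by norm_num) h2.le) (by nlinarith)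
  rcases le_or_gt d (√7) with h4 | h4
  · rw [hexPairPDF_fourth h3 h4]
    exact exists_hasArcIntegral_fourth h3.le (hsq' 7 (by norm_num) h4)
  rcases le_or_gt d 3 with h5 | h5
  · rw [hexPairPDF_fifth h4 h5]
    exact exists_hasArcIntegral_fifth hd (hsq 7 (by norm_num) h4.le) h5
  rcases le_or_gt d (2 * √3) with h6 | h6
  · rw [hexPairPDF_sixth h5 h6]
    refine exists_hasArcIntegral_sixth h5.le ?_
    rw [← sq_two_mul_sqrt_three]
    gcongr
  rcases le_or_gt d (√13) with h7 | h7
  · rw [hexPairPDF_seventh h6 h7]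
    refine exists_hasArcIntegral_seventh hd ?_ (hsq' 13 (by norm_num) h7)
    rw [← sq_two_mul_sqrt_three]
    gcongr
  · rw [hexPairPDF_far h7]
    exact ⟨0, hasArcIntegral_far hd (hsq 13 (by norm_num) h7.le), by ring⟩

lemma polarOverlap_nonneg (d θ : ℝ) : 0 ≤ polarOverlap d θ := overlapArea_nonneg _ _

lemma hexPairPDF_of_neg {d : ℝ} (hd : d < 0) : hexPairPDF d = 0 := by
  rw [hexPairPDF, if_pos hd]

lemma hexPairPDF_zero : hexPairPDF 0 = 0 := by
  rw [hexPairPDF, if_neg (lt_irrefl _), if_pos zero_le_one]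
  ring

/-- No sign study of the formulas is needed: for `d > 0` the density is a positive multiple of an
integral of areas. -/
theorem hexPairPDF_nonneg (d : ℝ) : 0 ≤ hexPairPDF d := by
  rcases lt_trichotomy d 0 with h | rfl | h
  · exact (hexPairPDF_of_neg h).ge
  · exact hexPairPDF_zero.ge
  · obtain ⟨I, hI, e⟩ := exists_hasArcIntegral h
    rw [e, ← hI.2]
    have : 0 ≤ ∫ θ in 0..Real.pi / 2, polarOverlap d θ :=
      intervalIntegral.integral_nonneg (by positivity) fun θ _ => polarOverlap_nonneg d θ
    positivity

/-- The fundamental theorem of calculus with derivatives on the open interval only, because the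
square roots and arcsines can fail to be differentiable at a breakpoint. -/
lemma integral_hexPairPDF_of_piece {a b : ℝ} {G g : ℝ → ℝ} (hab : a ≤ b)
    (hint : IntervalIntegrable hexPairPDF volume a b)
    (hcdf : ∀ x ∈ Set.Icc a b, hexPairCDF x = G x) (hpdf : ∀ x ∈ Set.Ioo a b, hexPairPDF x = g x)
    (hcont : ContinuousOn G (Set.Icc a b)) (hderiv : ∀ x ∈ Set.Ioo a b, HasDerivAt G (g x) x) :
    ∫ x in a..b, hexPairPDF x = hexPairCDF b - hexPairCDF a := by
  rw [hcdf a (Set.left_mem_Icc.2 hab), hcdf b (Set.right_mem_Icc.2 hab)]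
  exact intervalIntegral.integral_eq_sub_of_hasDerivAt_of_le hab hcont
    (fun x hx => (hpdf x hx) ▸ hderiv x hx) hint

/-- The claimed distribution function is the primitive of the claimed density. -/
theorem integral_hexPairPDF (hint : ∀ a b, IntervalIntegrable hexPairPDF volume a b) {d : ℝ}
    (h0 : 0 ≤ d) (h13 : d ≤ √13) : ∫ x in 0..d, hexPairPDF x = hexPairCDF d := by
  obtain ⟨b1, b2, b3, b4, b5, b6⟩ := breakpoints_lt
  have hsq : ∀ x y : ℝ, 0 ≤ x → √x < y → x < y ^ 2 := fun x y hx h => by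
    rw [← Real.sq_sqrt hx]; gcongr
  have e0 : hexPairCDF 0 = 0 := by
    rw [hexPairCDF_first le_rfl zero_le_one, cdfFirst]; ring
  have glue : ∀ {a b : ℝ}, ∫ x in 0..a, hexPairPDF x = hexPairCDF a →
      ∫ x in a..b, hexPairPDF x = hexPairCDF b - hexPairCDF a →
      ∫ x in 0..b, hexPairPDF x = hexPairCDF b := fun {a b} h1 h2 => by
    rw [← intervalIntegral.integral_add_adjacent_intervals (hint 0 a) (hint a b), h1, h2]
    ring
  have i1 : ∀ d, 0 ≤ d → d ≤ 1 → ∫ x in 0..d, hexPairPDF x = hexPairCDF d := by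
    intro d hd0 hd
    have := integral_hexPairPDF_of_piece hd0 (hint 0 d)
      (fun x hx => hexPairCDF_first hx.1 (hx.2.trans hd))
      (fun x hx => hexPairPDF_first hx.1 (hx.2.le.trans hd))
      (fun x _ => hasDerivAt_cdfFirst.continuousAt.continuousWithinAt)
      (fun x _ => hasDerivAt_cdfFirst)
    rw [this, e0, sub_zero]
  have i2 : ∀ d, 1 ≤ d → d ≤ √3 → ∫ x in 0..d, hexPairPDF x = hexPairCDF d := fun d hd0 hd =>
    glue (i1 1 zero_le_one le_rfl) <| integral_hexPairPDF_of_piece hd0 (hint 1 d)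
      (fun x hx => hexPairCDF_second hx.1 (hx.2.trans hd))
      (fun x hx => hexPairPDF_second hx.1 (hx.2.le.trans hd))
      (continuousOn_of_continuousAt_pos one_pos fun _ => continuousAt_cdfSecond)
      (fun x hx => hasDerivAt_cdfSecond (by linarith [hx.1]) (by nlinarith [hx.1]))
  have i3 : ∀ d, √3 ≤ d → d ≤ 2 → ∫ x in 0..d, hexPairPDF x = hexPairCDF d := fun d hd0 hd =>
    glue (i2 (√3) b1.le le_rfl) <| integral_hexPairPDF_of_piece hd0 (hint _ d)
      (fun x hx => hexPairCDF_third hx.1 (hx.2.trans hd))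
      (fun x hx => hexPairPDF_third hx.1 (hx.2.le.trans hd))
      (continuousOn_of_continuousAt_pos (by linarith) fun _ => continuousAt_cdfThird)
      (fun x hx => hasDerivAt_cdfThird (by linarith [hx.1]) (hsq 3 x (by norm_num) hx.1))
  have i4 : ∀ d, 2 ≤ d → d ≤ √7 → ∫ x in 0..d, hexPairPDF x = hexPairCDF d := fun d hd0 hd =>
    glue (i3 2 b2.le le_rfl) <| integral_hexPairPDF_of_piece hd0 (hint _ d)
      (fun x hx => hexPairCDF_fourth hx.1 (hx.2.trans hd))
      (fun x hx => hexPairPDF_fourth hx.1 (hx.2.le.trans hd))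
      (continuousOn_of_continuousAt_pos (by linarith) fun _ => continuousAt_cdfFourth)
      (fun x hx => hasDerivAt_cdfFourth (by linarith [hx.1]) (by nlinarith [hx.1]))
  have i5 : ∀ d, √7 ≤ d → d ≤ 3 → ∫ x in 0..d, hexPairPDF x = hexPairCDF d := fun d hd0 hd =>
    glue (i4 (√7) b3.le le_rfl) <| integral_hexPairPDF_of_piece hd0 (hint _ d)
      (fun x hx => hexPairCDF_fifth hx.1 (hx.2.trans hd))
      (fun x hx => hexPairPDF_fifth hx.1 (hx.2.le.trans hd))
      (continuousOn_of_continuousAt_pos (by linarith) fun _ => continuousAt_cdfFifth)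
      (fun x hx => hasDerivAt_cdfFifth (by linarith [hx.1])
        (by linarith [hsq 7 x (by norm_num) hx.1]))
  have i6 : ∀ d, 3 ≤ d → d ≤ 2 * √3 → ∫ x in 0..d, hexPairPDF x = hexPairCDF d := fun d hd0 hd =>
    glue (i5 3 b4.le le_rfl) <| integral_hexPairPDF_of_piece hd0 (hint _ d)
      (fun x hx => hexPairCDF_sixth hx.1 (hx.2.trans hd))
      (fun x hx => hexPairPDF_sixth hx.1 (hx.2.le.trans hd))
      (continuousOn_of_continuousAt_pos (by linarith) fun _ => continuousAt_cdfSixth)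
      (fun x hx => hasDerivAt_cdfSixth (by linarith [hx.1]) (by nlinarith [hx.1]))
  have i7 : ∀ d, 2 * √3 ≤ d → d ≤ √13 → ∫ x in 0..d, hexPairPDF x = hexPairCDF d :=
    fun d hd0 hd =>
    glue (i6 (2 * √3) b5.le le_rfl) <| integral_hexPairPDF_of_piece hd0 (hint _ d)
      (fun x hx => hexPairCDF_seventh hx.1 (hx.2.trans hd))
      (fun x hx => hexPairPDF_seventh hx.1 (hx.2.le.trans hd))
      (continuousOn_of_continuousAt_pos (by linarith) fun _ => continuousAt_cdfSeventh)
      (fun x hx => hasDerivAt_cdfSeventh (by linarith [hx.1])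
        (by rw [← sq_two_mul_sqrt_three]; have := hx.1; gcongr))
  rcases le_total d 1 with h1 | h1
  · exact i1 d h0 h1
  rcases le_total d (√3) with h2 | h2
  · exact i2 d h1 h2
  rcases le_total d 2 with h3 | h3
  · exact i3 d h2 h3
  rcases le_total d (√7) with h4 | h4
  · exact i4 d h3 h4
  rcases le_total d 3 with h5 | h5
  · exact i5 d h4 h5
  rcases le_total d (2 * √3) with h6 | h6
  · exact i6 d h5 h6
  · exact i7 d h6 h13

/-! ### From the quarter circle to the full circle -/

section angular

lemma polarOverlap_neg (d θ : ℝ) : polarOverlap d (-θ) = polarOverlap d θ := by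
  unfold polarOverlap
  rw [Real.cos_neg, Real.sin_neg, mul_neg, sub_neg_eq_add, ← sub_eq_add_neg, overlapArea_swap]

lemma polarOverlap_eq_zero {d θ : ℝ} (hd : 0 ≤ d) (h : Real.cos θ ≤ 0) : polarOverlap d θ = 0 := by
  refine overlapArea_eq_zero_of_nonpos ?_
  have : d * Real.cos θ / √3 ≤ 0 :=
    div_nonpos_of_nonpos_of_nonneg (mul_nonpos_of_nonneg_of_nonpos hd h) (by positivity)
  linarith

lemma HasArcIntegral.neg {d a b I : ℝ} (h : HasArcIntegral d a b I) :
    HasArcIntegral d (-b) (-a) I := by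
  have e : (fun θ => polarOverlap d (-θ)) = polarOverlap d := funext (polarOverlap_neg d)
  constructor
  · have := ((IntervalIntegrable.iff_comp_neg (f := polarOverlap d)).1 h.1).symm
    rwa [e] at this
  · have := intervalIntegral.integral_comp_neg (a := -b) (b := -a) (polarOverlap d)
    rw [neg_neg, neg_neg, h.2] at this
    rw [← this, e]

lemma hasArcIntegral_of_eq_zero {d a b : ℝ} (h : ∀ θ ∈ Set.uIcc a b, polarOverlap d θ = 0) :
    HasArcIntegral d a b 0 := by
  constructor
  · refine IntervalIntegrable.congr (f := fun _ => (0 : ℝ)) ?_ (by simp)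
    exact fun θ hθ => (h θ (Set.uIoc_subset_uIcc hθ)).symm
  · rw [intervalIntegral.integral_congr (g := fun _ => 0) h]
    simp

lemma HasArcIntegral.full_circle {d I : ℝ} (hd : 0 ≤ d)
    (h : HasArcIntegral d 0 (Real.pi / 2) I) :
    HasArcIntegral d (-Real.pi) Real.pi (2 * I) := by
  have hpi := Real.pi_pos
  have hz : HasArcIntegral d (Real.pi / 2) Real.pi 0 := by
    refine hasArcIntegral_of_eq_zero fun θ hθ => polarOverlap_eq_zero hd ?_
    rw [Set.uIcc_of_le (by linarith)] at hθ
    exact Real.cos_nonpos_of_pi_div_two_le_of_le hθ.1 (by linarith [hθ.2])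
  have h1 := h.trans hz
  have h2 := h1.neg
  rw [neg_zero] at h2
  have := h2.trans h1
  convert this using 1
  ring

lemma lintegral_polarOverlap {d I : ℝ} (hd : 0 ≤ d) (h : HasArcIntegral d 0 (Real.pi / 2) I) :
    ∫⁻ θ in Set.Ioo (-Real.pi) Real.pi, ENNReal.ofReal (polarOverlap d θ) =
      ENNReal.ofReal (2 * I) := by
  have hle : -Real.pi ≤ Real.pi := by linarith [Real.pi_pos]
  obtain ⟨h1, h2⟩ := h.full_circle hd
  rw [← h2, intervalIntegral.integral_of_le hle, integral_Ioc_eq_integral_Ioo,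
    ofReal_integral_eq_lintegral_ofReal
    (((intervalIntegrable_iff_integrableOn_Ioc_of_le hle).1 h1).mono_set Set.Ioo_subset_Ioc_self)
    (.of_forall fun θ => polarOverlap_nonneg d θ)]

end angular

/-! ### The law of the distance in lattice coordinates -/

section law

/-- Euclidean length of a vector with given lattice coordinates. -/
noncomputable def latticeNorm (u : ℝ × ℝ) : ℝ := √(u.1 ^ 2 + u.1 * u.2 + u.2 ^ 2)

lemma continuous_latticeNorm : Continuous latticeNorm := by
  unfold latticeNorm
  fun_prop

lemma volume_overlap_ne_top (p q : ℝ) :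
    volume {w : ℝ × ℝ | w ∈ latticeHexagon ∧ w + (p, q) ∈ latticeHexagon} ≠ ⊤ :=
  ((isBounded_latticeHexagon.subset fun _ h => h.1).measure_lt_top).ne

lemma volume_latticeHexagon : volume latticeHexagon = 3 := by
  have h := overlapArea_kite (p := 0) (q := 0) le_rfl zero_le_one le_rfl zero_le_one
  have e : {w : ℝ × ℝ | w ∈ latticeHexagon ∧ w + ((0 : ℝ), (0 : ℝ)) ∈ latticeHexagon} =
      latticeHexagon := by
    ext w
    simp [← Prod.zero_eq_mk]
  rw [overlapArea, e, measureReal_def] at h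
  rw [← ENNReal.ofReal_toReal isBounded_latticeHexagon.measure_lt_top.ne, h]
  norm_num

/-- The linear map sending orthonormal coordinates to lattice coordinates. -/
noncomputable def toLatticeCoord : ℝ × ℝ →ₗ[ℝ] ℝ × ℝ :=
  Matrix.toLin (Module.Basis.finTwoProd ℝ) (Module.Basis.finTwoProd ℝ) !![(√3)⁻¹, 1; (√3)⁻¹, -1]

lemma toLatticeCoord_apply (z : ℝ × ℝ) :
    toLatticeCoord z = (z.1 / √3 + z.2, z.1 / √3 - z.2) := by
  rw [toLatticeCoord, Matrix.toLin_finTwoProd_apply]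
  ext <;> simp <;> ring

lemma det_toLatticeCoord : LinearMap.det toLatticeCoord = -(2 / √3) := by
  rw [toLatticeCoord, LinearMap.det_toLin, Matrix.det_fin_two_of]
  ring

lemma lintegral_comp_toLatticeCoord {f : ℝ × ℝ → ENNReal} (hf : Measurable f) :
    ∫⁻ u, f u = ENNReal.ofReal (2 / √3) * ∫⁻ z, f (toLatticeCoord z) := by
  have hdet : LinearMap.det toLatticeCoord ≠ 0 := by
    rw [det_toLatticeCoord]
    have : 0 < 2 / √3 := by positivity
    linarith
  have h := Measure.map_linearMap_addHaar_eq_smul_addHaar (volume : Measure (ℝ × ℝ)) hdet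
  have hm : Measurable toLatticeCoord := by
    have : (toLatticeCoord : ℝ × ℝ → ℝ × ℝ) = fun z => (z.1 / √3 + z.2, z.1 / √3 - z.2) :=
      funext toLatticeCoord_apply
    rw [this]
    fun_prop
  rw [← lintegral_map hf hm, h, lintegral_smul_measure, smul_eq_mul, ← mul_assoc,
    det_toLatticeCoord, ← ENNReal.ofReal_mul (by positivity), abs_inv, abs_neg,
    abs_of_pos (by positivity), mul_inv_cancel₀ (by positivity), ENNReal.ofReal_one, one_mul]

lemma latticeNorm_toLatticeCoord_polar {r : ℝ} (hr : 0 ≤ r) (θ : ℝ) :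
    latticeNorm (toLatticeCoord (r * Real.cos θ, r * Real.sin θ)) = r := by
  rw [toLatticeCoord_apply, latticeNorm]
  have h3 : √3 ^ 2 = (3 : ℝ) := sq_sqrt_three
  have e : (r * Real.cos θ / √3 + r * Real.sin θ) ^ 2
      + (r * Real.cos θ / √3 + r * Real.sin θ) * (r * Real.cos θ / √3 - r * Real.sin θ)
      + (r * Real.cos θ / √3 - r * Real.sin θ) ^ 2 = r ^ 2 := by
    have hsc := Real.sin_sq_add_cos_sq θ
    have hne : √3 ≠ 0 := by positivity
    generalize √3 = t at *
    generalize Real.sin θ = S at *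
    generalize Real.cos θ = c at *
    field_simp
    grind
  rw [e, Real.sqrt_sq hr]

lemma measurable_overlap : Measurable fun u : ℝ × ℝ =>
    volume {w : ℝ × ℝ | w ∈ latticeHexagon ∧ w + u ∈ latticeHexagon} := by
  have hs : MeasurableSet {x : (ℝ × ℝ) × (ℝ × ℝ) | x.2 ∈ latticeHexagon ∧
      x.2 + x.1 ∈ latticeHexagon} :=
    (measurableSet_latticeHexagon.preimage measurable_snd).inter
      (measurableSet_latticeHexagon.preimage (measurable_snd.add measurable_fst))
  exact measurable_measure_prodMk_left hs

lemma measurable_uncurry_overlapArea : Measurable fun u : ℝ × ℝ => overlapArea u.1 u.2 :=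
  measurable_overlap.ennreal_toReal

/-- Integrals of radial functions against the overlap, in terms of the density. -/
lemma lintegral_radial_mul_overlap {g : ℝ → ENNReal} (hg : Measurable g) :
    ∫⁻ u : ℝ × ℝ, g (latticeNorm u) * ENNReal.ofReal (overlapArea (u.1 - 1) (u.2 - 1)) =
      9 * ∫⁻ d, g d * ENNReal.ofReal (hexPairPDF d) := by
  have hov : Measurable fun u : ℝ × ℝ =>
      ENNReal.ofReal (overlapArea (u.1 - 1) (u.2 - 1)) := by
    refine ENNReal.measurable_ofReal.comp ?_
    exact measurable_uncurry_overlapArea.comp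
      (g := fun u : ℝ × ℝ => overlapArea u.1 u.2) (f := fun u : ℝ × ℝ => (u.1 - 1, u.2 - 1))
      (by fun_prop)
  have hgm : Measurable fun u : ℝ × ℝ =>
      g (latticeNorm u) * ENNReal.ofReal (overlapArea (u.1 - 1) (u.2 - 1)) :=
    (hg.comp continuous_latticeNorm.measurable).mul hov
  have hpolar : Measurable fun p : ℝ × ℝ =>
      toLatticeCoord (p.1 * Real.cos p.2, p.1 * Real.sin p.2) := by
    simp_rw [toLatticeCoord_apply]
    fun_prop
  rw [lintegral_comp_toLatticeCoord hgm, ← lintegral_comp_polarCoord_symm, polarCoord_target]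
  have hcongr : ∀ p ∈ Set.Ioi (0 : ℝ) ×ˢ Set.Ioo (-Real.pi) Real.pi,
      ENNReal.ofReal p.1 • (g (latticeNorm (toLatticeCoord (polarCoord.symm p))) *
        ENNReal.ofReal (overlapArea ((toLatticeCoord (polarCoord.symm p)).1 - 1)
          ((toLatticeCoord (polarCoord.symm p)).2 - 1))) =
      ENNReal.ofReal p.1 * g p.1 * ENNReal.ofReal (polarOverlap p.1 p.2) := by
    rintro ⟨r, θ⟩ ⟨hr, -⟩
    have hr : 0 < r := hr
    rw [polarCoord_symm_apply, latticeNorm_toLatticeCoord_polar hr.le, toLatticeCoord_apply,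
      polarOverlap, smul_eq_mul, mul_assoc]
  have hmeas : Measurable fun p : ℝ × ℝ => ENNReal.ofReal (polarOverlap p.1 p.2) := by
    have := hov.comp hpolar
    simpa only [polarOverlap, Function.comp_def, toLatticeCoord_apply] using this
  rw [setLIntegral_congr_fun (measurableSet_Ioi.prod measurableSet_Ioo) hcongr,
    Measure.volume_eq_prod, ← Measure.prod_restrict, lintegral_prod _ (by fun_prop)]
  -- The full circle contributes `2 I`, and `9 · (√3/2) · (4√3/27) = 2`. The factor `√3/2` will
  -- cancel the Jacobian `2/√3` of the change to orthonormal coordinates, leaving 9, the product of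
  -- the two areas.
  have hinner : ∀ r ∈ Set.Ioi (0 : ℝ), ∫⁻ θ in Set.Ioo (-Real.pi) Real.pi,
      ENNReal.ofReal r * g r * ENNReal.ofReal (polarOverlap r θ) =
      ENNReal.ofReal (9 * (√3 / 2)) * (g r * ENNReal.ofReal (hexPairPDF r)) := by
    intro r hr
    have hr : 0 < r := hr
    obtain ⟨I, hI, e⟩ := exists_hasArcIntegral hr
    have hm : Measurable fun θ => ENNReal.ofReal (polarOverlap r θ) :=
      Measurable.of_uncurry_left (f := fun r θ => ENNReal.ofReal (polarOverlap r θ)) hmeas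
    rw [lintegral_const_mul _ hm,
      lintegral_polarOverlap hr.le hI, e, mul_comm (ENNReal.ofReal r), mul_assoc,
      ← ENNReal.ofReal_mul hr.le, mul_left_comm (ENNReal.ofReal (9 * (√3 / 2))), ← ENNReal.ofReal_mul (by positivity)]
    congr 2
    linear_combination -(2 / 3) * r * I * sq_sqrt_three
  rw [setLIntegral_congr_fun measurableSet_Ioi hinner]
  have hzero : ∫⁻ d in Set.Ioi (0 : ℝ), g d * ENNReal.ofReal (hexPairPDF d) =
      ∫⁻ d, g d * ENNReal.ofReal (hexPairPDF d) := by
    rw [← lintegral_indicator measurableSet_Ioi]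
    congr 1
    ext d
    by_cases hd : d ∈ Set.Ioi (0 : ℝ)
    · rw [Set.indicator_of_mem hd]
    · rw [Set.indicator_of_notMem hd]
      have : hexPairPDF d = 0 := by
        rcases (not_lt.1 hd : d ≤ 0).lt_or_eq with h | rfl
        · exact hexPairPDF_of_neg h
        · exact hexPairPDF_zero
      rw [this]; simp
  rw [lintegral_const_mul' _ _ ENNReal.ofReal_ne_top, hzero, ← mul_assoc,
    ← ENNReal.ofReal_mul (by positivity)]
  congr 1
  rw [show 2 / √3 * (9 * (√3 / 2)) = 9 by field_simp]
  norm_num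

/-- The uniform distribution on the hexagon in lattice coordinates. -/
noncomputable def latticeUniform : Measure (ℝ × ℝ) := ProbabilityTheory.cond volume latticeHexagon

/-- The law of the distance of independent uniform points of two adjacent hexagons. -/
lemma map_latticeNorm_latticeUniform :
    (latticeUniform.prod latticeUniform).map (fun x => latticeNorm (x.2 - x.1 + (1, 1))) =
      volume.withDensity fun d => ENNReal.ofReal (hexPairPDF d) := by
  have hcont : Continuous fun x : (ℝ × ℝ) × (ℝ × ℝ) => latticeNorm (x.2 - x.1 + (1, 1)) :=
    continuous_latticeNorm.comp (by fun_prop)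
  ext S hS
  rw [Measure.map_apply hcont.measurable hS, withDensity_apply _ hS]
  unfold latticeUniform ProbabilityTheory.cond
  rw [volume_latticeHexagon, Measure.prod_smul_left, Measure.prod_smul_right,
    Measure.prod_restrict, Measure.smul_apply, Measure.smul_apply,
    Measure.restrict_apply (hcont.measurable hS)]
  have hpre : MeasurableSet ((fun x : (ℝ × ℝ) × (ℝ × ℝ) => latticeNorm (x.2 - x.1 + (1, 1))) ⁻¹' S ∩
      latticeHexagon ×ˢ latticeHexagon) :=
    (hcont.measurable hS).inter (measurableSet_latticeHexagon.prod measurableSet_latticeHexagon)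
  have hshear := measurePreserving_prod_add (volume : Measure (ℝ × ℝ)) (volume : Measure (ℝ × ℝ))
  -- The measure-preserving substitution `(w, w + u)` makes the difference `u` a coordinate; the
  -- slice at fixed `u` is then the overlap of the hexagon with its translate by `u`, or is empty.
  rw [← hshear.measure_preimage hpre.nullMeasurableSet,
    Measure.prod_apply_symm (hshear.measurable hpre)]
  have hslice : ∀ u : ℝ × ℝ, volume ((fun w => (w, u)) ⁻¹'
      ((fun z : (ℝ × ℝ) × (ℝ × ℝ) => (z.1, z.1 + z.2)) ⁻¹'
        ((fun x : (ℝ × ℝ) × (ℝ × ℝ) => latticeNorm (x.2 - x.1 + (1, 1))) ⁻¹' S ∩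
          latticeHexagon ×ˢ latticeHexagon))) =
      S.indicator 1 (latticeNorm (u + (1, 1))) * ENNReal.ofReal (overlapArea u.1 u.2) := by
    intro u
    by_cases hu : latticeNorm (u + (1, 1)) ∈ S
    · rw [Set.indicator_of_mem hu, Pi.one_apply, one_mul, overlapArea, measureReal_def,
        ENNReal.ofReal_toReal (volume_overlap_ne_top _ _)]
      congr 1
      ext w
      simp [hu]
    · rw [Set.indicator_of_notMem hu, zero_mul]
      convert measure_empty (μ := (volume : Measure (ℝ × ℝ)))
      ext w
      simp [hu]
  simp_rw [hslice]
  rw [← lintegral_sub_right_eq_self _ ((1, 1) : ℝ × ℝ)]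
  simp only [sub_add_cancel, Prod.fst_sub, Prod.snd_sub]
  rw [lintegral_radial_mul_overlap (measurable_one.indicator hS), smul_eq_mul, smul_eq_mul,
    ← mul_assoc, ← mul_assoc]
  have h9 : (3 : ENNReal)⁻¹ * 3⁻¹ * 9 = 1 := by
    rw [← ENNReal.mul_inv (by simp) (by simp)]
    norm_num
    exact ENNReal.inv_mul_cancel (by simp) (by simp)
  rw [h9, one_mul, ← lintegral_indicator hS]
  congr 1
  ext d
  by_cases hd : d ∈ S <;> simp [hd]

end law

/-! ### Adjacent hexagons in the Euclidean plane -/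

section geometry

/-- The unit vector with polar angle `t`. -/
noncomputable def unitDir (t : ℝ) : EuclideanSpace ℝ (Fin 2) := !₂[Real.cos t, Real.sin t]

lemma unitDir_ext {s t : ℝ} (hc : Real.cos s = Real.cos t) (hs : Real.sin s = Real.sin t) :
    unitDir s = unitDir t := by
  rw [unitDir, unitDir, hc, hs]

lemma unitDir_add_two_mul_pi_div_three (t : ℝ) :
    unitDir (t + 2 * (Real.pi / 3)) = unitDir (t + Real.pi / 3) - unitDir t := by
  have hc : Real.cos (2 * (Real.pi / 3)) = -1 / 2 := by
    rw [Real.cos_two_mul, Real.cos_pi_div_three]; norm_num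
  have hs : Real.sin (2 * (Real.pi / 3)) = √3 / 2 := by
    rw [Real.sin_two_mul, Real.cos_pi_div_three, Real.sin_pi_div_three]; ring
  ext i
  fin_cases i
  · simp [unitDir, Real.cos_add, hc, hs]; ring
  · simp [unitDir, Real.sin_add, hc, hs]; ring

lemma unitDir_add_pi (t : ℝ) : unitDir (t + Real.pi) = -unitDir t := by
  ext i
  fin_cases i <;> simp [unitDir]

/-- Equality of unit vectors plays the role of congruence of angles modulo `2π`, so no integer
multiple of `2π` has to be carried along. -/
lemma unitDir_add_congr {s t : ℝ} (h : unitDir s = unitDir t) (δ : ℝ) :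
    unitDir (s + δ) = unitDir (t + δ) := by
  have h0 : Real.cos s = Real.cos t := congrArg (fun v => v 0) h
  have h1 : Real.sin s = Real.sin t := congrArg (fun v => v 1) h
  apply unitDir_ext
  · rw [Real.cos_add, Real.cos_add, h0, h1]
  · rw [Real.sin_add, Real.sin_add, h0, h1]

/-- The linear map from lattice coordinates to the plane, for the lattice of orientation `ψ`. -/
noncomputable def latticeMap (ψ : ℝ) : ℝ × ℝ →ₗ[ℝ] EuclideanSpace ℝ (Fin 2) :=
  (LinearMap.fst ℝ ℝ ℝ).smulRight (unitDir (ψ + Real.pi / 3)) +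
    (LinearMap.snd ℝ ℝ ℝ).smulRight (unitDir ψ)

lemma latticeMap_apply (ψ : ℝ) (u : ℝ × ℝ) :
    latticeMap ψ u = u.1 • unitDir (ψ + Real.pi / 3) + u.2 • unitDir ψ := rfl

lemma norm_latticeMap (ψ : ℝ) (u : ℝ × ℝ) : ‖latticeMap ψ u‖ = latticeNorm u := by
  rw [EuclideanSpace.norm_eq, latticeNorm, Fin.sum_univ_two, Real.norm_eq_abs, Real.norm_eq_abs,
    sq_abs, sq_abs]
  congr 1
  simp only [latticeMap_apply, unitDir, PiLp.add_apply, PiLp.smul_apply, smul_eq_mul,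
    Matrix.cons_val_zero, Matrix.cons_val_one, Real.cos_add, Real.sin_add,
    Real.cos_pi_div_three, Real.sin_pi_div_three]
  have hsc := Real.sin_sq_add_cos_sq ψ
  have h3 := sq_sqrt_three
  generalize √3 = w at *
  generalize Real.sin ψ = s at *
  generalize Real.cos ψ = c at *
  grind

lemma latticeNorm_eq_zero {u : ℝ × ℝ} (h : latticeNorm u = 0) : u = 0 := by
  have h0 : 0 ≤ u.1 ^ 2 + u.1 * u.2 + u.2 ^ 2 := by
    nlinarith [sq_nonneg (u.1 + u.2), sq_nonneg u.1, sq_nonneg u.2]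
  rw [latticeNorm, Real.sqrt_eq_zero h0] at h
  ext
  · have : u.1 ^ 2 ≤ 0 := by nlinarith [sq_nonneg (u.1 + 2 * u.2)]
    simpa using pow_eq_zero_iff two_ne_zero |>.1 (le_antisymm this (sq_nonneg _))
  · have : u.2 ^ 2 ≤ 0 := by nlinarith [sq_nonneg (u.2 + 2 * u.1)]
    simpa using pow_eq_zero_iff two_ne_zero |>.1 (le_antisymm this (sq_nonneg _))

lemma latticeMap_injective (ψ : ℝ) : Function.Injective (latticeMap ψ) := by
  rw [injective_iff_map_eq_zero]
  intro u hu
  apply latticeNorm_eq_zero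
  rw [← norm_latticeMap ψ, hu, norm_zero]

/-- The vertices of the unit hexagon in lattice coordinates. -/
def latticeVertex : Fin 6 → ℝ × ℝ := ![(0, 1), (1, 0), (1, -1), (0, -1), (-1, 0), (-1, 1)]

lemma hexVertex_eq (c : EuclideanSpace ℝ (Fin 2)) (θ : ℝ) (k : Fin 6) :
    hexVertex c θ k = c + unitDir (θ + (k : ℕ) * (Real.pi / 3)) := rfl

lemma hexVertex_eq_latticeMap (c : EuclideanSpace ℝ (Fin 2)) (θ : ℝ) (k : Fin 6) :
    hexVertex c θ k = c + latticeMap θ (latticeVertex k) := by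
  rw [hexVertex_eq, latticeMap_apply]
  congr 1
  have h2 := unitDir_add_two_mul_pi_div_three θ
  have h3 := unitDir_add_pi θ
  have h4 := unitDir_add_pi (θ + Real.pi / 3)
  have h5 := unitDir_add_pi (θ + 2 * (Real.pi / 3))
  fin_cases k
  · simp [latticeVertex]
  · simp [latticeVertex]
  · simp only [latticeVertex]
    simpa [sub_eq_add_neg] using h2
  · simp only [latticeVertex]
    simp [← h3]
    ring_nf
  · simp only [latticeVertex]
    simp [← h4]
    ring_nf
  · simp only [latticeVertex]
    rw [h2] at h5
    simp
    rw [neg_add_eq_sub, ← neg_sub, ← h5]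
    ring_nf

lemma convex_latticeHexagon : Convex ℝ latticeHexagon := by
  have h : ∀ f : ℝ × ℝ →ₗ[ℝ] ℝ, Convex ℝ {w | |f w| ≤ 1} := fun f => by
    have : {w | |f w| ≤ 1} = f ⁻¹' Set.Icc (-1) 1 := by
      ext w; simp [abs_le]
    rw [this]
    exact (convex_Icc _ _).linear_preimage f
  exact (h (LinearMap.fst ℝ ℝ ℝ)).inter
    ((h (LinearMap.snd ℝ ℝ ℝ)).inter (h (LinearMap.fst ℝ ℝ ℝ + LinearMap.snd ℝ ℝ ℝ)))

lemma zero_mem_convexHull_latticeVertex :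
    (0 : ℝ × ℝ) ∈ convexHull ℝ (Set.range latticeVertex) := by
  have h := convex_convexHull ℝ (Set.range latticeVertex)
    (subset_convexHull ℝ _ ⟨0, rfl⟩) (subset_convexHull ℝ _ ⟨3, rfl⟩)
    (by norm_num : (0 : ℝ) ≤ 1 / 2) (by norm_num : (0 : ℝ) ≤ 1 / 2) (by norm_num)
  convert h using 1
  ext <;> simp [latticeVertex]

/-- The point is a convex combination of the centre and two vertices. Used for neighbouring
vertices, it covers the six triangles into which the signs of `a`, `b` and `a + b` divide the
hexagon. -/
lemma smul_add_smul_mem_convexHull (i j : Fin 6) {a b : ℝ} (ha : 0 ≤ a) (hb : 0 ≤ b)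
    (hab : a + b ≤ 1) :
    a • latticeVertex i + b • latticeVertex j ∈ convexHull ℝ (Set.range latticeVertex) := by
  have hc := convex_convexHull ℝ (Set.range latticeVertex)
  have hi : latticeVertex i ∈ convexHull ℝ (Set.range latticeVertex) :=
    subset_convexHull ℝ _ ⟨i, rfl⟩
  have hj : latticeVertex j ∈ convexHull ℝ (Set.range latticeVertex) :=
    subset_convexHull ℝ _ ⟨j, rfl⟩
  have h := hc.sum_mem (t := Finset.univ)
    (w := ![1 - a - b, a, b]) (z := ![0, latticeVertex i, latticeVertex j])
    (by intro k _; fin_cases k <;> simp [ha, hb]; linarith)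
    (by simp [Fin.sum_univ_three]; ring)
    (by intro k _; fin_cases k <;> simp [hi, hj, zero_mem_convexHull_latticeVertex])
  simpa [Fin.sum_univ_three] using h

lemma latticeHexagon_eq_convexHull :
    latticeHexagon = convexHull ℝ (Set.range latticeVertex) := by
  apply Set.Subset.antisymm
  · rintro ⟨a, b⟩ ⟨h1, h2, h3⟩
    simp only [abs_le] at h1 h2 h3
    rcases le_total 0 a with ha | ha <;> rcases le_total 0 b with hb | hb
    · convert smul_add_smul_mem_convexHull 1 0 ha hb h3.2 using 1
      ext <;> simp [latticeVertex]
    · rcases le_total 0 (a + b) with hr | hr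
      · convert smul_add_smul_mem_convexHull 1 2 hr (neg_nonneg.2 hb) (by linarith) using 1
        ext <;> simp [latticeVertex]
      · convert smul_add_smul_mem_convexHull 2 3 ha (neg_nonneg.2 hr) (by linarith) using 1
        ext <;> simp [latticeVertex]
    · rcases le_total 0 (a + b) with hr | hr
      · convert smul_add_smul_mem_convexHull 0 5 hr (neg_nonneg.2 ha) (by linarith) using 1
        ext <;> simp [latticeVertex]
      · convert smul_add_smul_mem_convexHull 5 4 hb (neg_nonneg.2 hr) (by linarith) using 1
        ext <;> simp [latticeVertex]
    · convert smul_add_smul_mem_convexHull 4 3 (neg_nonneg.2 ha) (neg_nonneg.2 hb)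
        (by linarith) using 1
      ext <;> simp [latticeVertex]
  · refine convexHull_min ?_ convex_latticeHexagon
    rintro _ ⟨k, rfl⟩
    fin_cases k <;> simp [latticeVertex, latticeHexagon]

lemma unitHexagon_eq_image (c : EuclideanSpace ℝ (Fin 2)) (θ : ℝ) :
    unitHexagon c θ = (fun w => c + latticeMap θ w) '' latticeHexagon := by
  have h := AffineMap.image_convexHull
    (((AffineEquiv.constVAdd ℝ (EuclideanSpace ℝ (Fin 2)) c).toAffineMap).comp
      (latticeMap θ).toAffineMap) (Set.range latticeVertex)
  rw [← latticeHexagon_eq_convexHull, ← Set.range_comp] at h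
  have e : hexVertex c θ = (((AffineEquiv.constVAdd ℝ (EuclideanSpace ℝ (Fin 2)) c).toAffineMap).comp
      (latticeMap θ).toAffineMap) ∘ latticeVertex := funext (hexVertex_eq_latticeMap c θ)
  rw [unitHexagon, e, ← h]
  rfl

lemma unitDir_add_nat_mod (θ : ℝ) (n : ℕ) :
    unitDir (θ + n * (Real.pi / 3)) = unitDir (θ + (n % 6 : ℕ) * (Real.pi / 3)) := by
  have e : θ + n * (Real.pi / 3) =
      θ + (n % 6 : ℕ) * (Real.pi / 3) + (n / 6 : ℕ) * (2 * Real.pi) := by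
    have : (n : ℝ) = (n % 6 : ℕ) + 6 * (n / 6 : ℕ) := by exact_mod_cast (Nat.mod_add_div n 6).symm
    rw [this]
    ring
  rw [e]
  exact unitDir_ext (Real.cos_add_nat_mul_two_pi _ _) (Real.sin_add_nat_mul_two_pi _ _)

lemma hexVertex_rotate (c : EuclideanSpace ℝ (Fin 2)) (θ : ℝ) (i k : Fin 6) :
    hexVertex c (θ + (i : ℕ) * (Real.pi / 3)) k = hexVertex c θ (i + k) := by
  rw [hexVertex_eq, hexVertex_eq, Fin.val_add, ← unitDir_add_nat_mod]
  push_cast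
  ring_nf

/-- Adding a multiple of π/3 to the orientation only relabels the vertices, so the common side may
be taken as the side with index 0 of both hexagons. -/
lemma unitHexagon_rotate (c : EuclideanSpace ℝ (Fin 2)) (θ : ℝ) (i : Fin 6) :
    unitHexagon c (θ + (i : ℕ) * (Real.pi / 3)) = unitHexagon c θ := by
  have e : hexVertex c (θ + (i : ℕ) * (Real.pi / 3)) = hexVertex c θ ∘ Equiv.addLeft i :=
    funext (hexVertex_rotate c θ i)
  rw [unitHexagon, e, (Equiv.addLeft i).surjective.range_comp, unitHexagon]

lemma hexSide_eq (c : EuclideanSpace ℝ (Fin 2)) (θ : ℝ) (i : Fin 6) :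
    hexSide c θ i = segment ℝ (c + unitDir (θ + (i : ℕ) * (Real.pi / 3)))
      (c + unitDir (θ + (i : ℕ) * (Real.pi / 3) + Real.pi / 3)) := by
  rw [hexSide, ← hexVertex_rotate, hexVertex_eq, hexVertex_eq]
  simp

/-- Parametrise the first segment by `[0, 1]`: the ends of the second have parameters `s, t` in `[0,
1]`, and both 0 and 1 are convex combinations of `s` and `t`, which forces `{s, t} = {0, 1}`. -/
lemma segment_eq_segment_iff_endpoints {E : Type*} [AddCommGroup E] [Module ℝ E] {x y x' y' : E}
    (hxy : x ≠ y) (h : segment ℝ x y = segment ℝ x' y') :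
    (x = x' ∧ y = y') ∨ (x = y' ∧ y = x') := by
  have hx' : x' ∈ segment ℝ x y := h ▸ left_mem_segment ℝ x' y'
  have hy' : y' ∈ segment ℝ x y := h ▸ right_mem_segment ℝ x' y'
  have hx : x ∈ segment ℝ x' y' := h ▸ left_mem_segment ℝ x y
  have hy : y ∈ segment ℝ x' y' := h ▸ right_mem_segment ℝ x y
  rw [segment_eq_image'] at hx' hy' hx hy
  obtain ⟨s, ⟨hs0, hs1⟩, rfl⟩ := hx'
  obtain ⟨t, ⟨ht0, ht1⟩, rfl⟩ := hy'
  obtain ⟨a, ⟨ha0, ha1⟩, hx⟩ := hx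
  obtain ⟨b, ⟨hb0, hb1⟩, hy⟩ := hy
  have hv : y - x ≠ 0 := sub_ne_zero.2 hxy.symm
  have e1 : (1 - a) * s + a * t = 0 := by
    have : ((1 - a) * s + a * t) • (y - x) = 0 := by
      simp only at hx
      linear_combination (norm := module) hx
    exact (smul_eq_zero.1 this).resolve_right hv
  have e2 : (1 - b) * s + b * t = 1 := by
    have : ((1 - b) * s + b * t - 1) • (y - x) = 0 := by
      simp only at hy
      linear_combination (norm := module) hy
    linarith [(smul_eq_zero.1 this).resolve_right hv]
  have m1 : (1 - a) * s = 0 := by nlinarith [mul_nonneg (sub_nonneg.2 ha1) hs0, mul_nonneg ha0 ht0]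
  have m2 : a * t = 0 := by linarith
  rcases mul_eq_zero.1 m1 with h1 | h1
  · have ha : a = 1 := by linarith
    have ht : t = 0 := by rw [ha, one_mul] at m2; exact m2
    have hs : s = 1 := by rw [ht] at e2; nlinarith
    right
    rw [ht, hs]
    simp
  · have ht : t = 1 := by rw [h1] at e2; nlinarith
    left
    rw [ht, h1]
    simp

lemma unitDir_ne_unitDir_add (ψ : ℝ) : unitDir ψ ≠ unitDir (ψ + Real.pi / 3) := by
  intro h
  have h0 : latticeMap ψ (1, -1) = latticeMap ψ 0 := by
    rw [latticeMap_apply, ← h, map_zero]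
    simp
  simpa using latticeMap_injective ψ h0

/-- Adjacent hexagons are translates of each other by a lattice vector. -/
lemma ShareSide.exists_latticeMap {c c' : EuclideanSpace ℝ (Fin 2)} {θ θ' : ℝ}
    (h : ShareSide c θ c' θ') :
    ∃ ψ, unitHexagon c θ = (fun w => c + latticeMap ψ w) '' latticeHexagon ∧
      unitHexagon c' θ' = (fun w => c + latticeMap ψ (w + (1, 1))) '' latticeHexagon := by
  obtain ⟨i, j, hi, hj⟩ := h
  rw [hi, hexSide_eq, hexSide_eq] at hj
  rw [hexSide_eq, ← unitHexagon_rotate c θ i, ← unitHexagon_rotate c' θ' j] at hi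
  rw [← unitHexagon_rotate c θ i, ← unitHexagon_rotate c' θ' j]
  generalize θ + (i : ℕ) * (Real.pi / 3) = ψ at *
  generalize θ' + (j : ℕ) * (Real.pi / 3) = φ at *
  have hne : c + unitDir ψ ≠ c + unitDir (ψ + Real.pi / 3) :=
    fun h => unitDir_ne_unitDir_add ψ (add_left_cancel h)
  rcases segment_eq_segment_iff_endpoints hne hj with ⟨h1, h2⟩ | ⟨h1, h2⟩
  -- If the sides match with the same direction, orientations and centres agree and the hexagons
  -- coincide. Their intersection is then the whole hexagon, which contains its centre, while the
  -- side does not.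
  · exfalso
    have h3 : unitDir (ψ + 2 * (Real.pi / 3)) = unitDir (φ + 2 * (Real.pi / 3)) := by
      rw [unitDir_add_two_mul_pi_div_three, unitDir_add_two_mul_pi_div_three]
      linear_combination (norm := module) h2 - h1
    have h4 := unitDir_add_congr h3 (-(2 * (Real.pi / 3)))
    rw [add_neg_cancel_right, add_neg_cancel_right] at h4
    have hc : c = c' := by rw [h4] at h1; exact add_right_cancel h1
    have hmap : latticeMap φ = latticeMap ψ := by
      ext <;> simp [latticeMap_apply, h4, unitDir_add_congr h4]
    rw [unitHexagon_eq_image, unitHexagon_eq_image, hmap, ← hc, Set.inter_self] at hi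
    have hmem : c ∈ (fun w => c + latticeMap ψ w) '' latticeHexagon :=
      ⟨0, by simp [latticeHexagon], by simp⟩
    rw [hi] at hmem
    obtain ⟨a, b, -, -, hab, e⟩ := hmem
    have h0 : latticeMap ψ (b, a) = latticeMap ψ 0 := by
      rw [latticeMap_apply, map_zero]
      have : a • c + b • c = c := by rw [← add_smul, hab, one_smul]
      simp only [smul_add] at e
      linear_combination (norm := module) e - this
    have := latticeMap_injective ψ h0
    simp only [Prod.mk_eq_zero] at this
    linarith
  -- If the directions are opposite, the orientations differ by π and the second centre is the first
  -- plus the two vectors to the ends of the side. The half turn disappears because the hexagon is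
  -- symmetric about its centre.
  · have h3 : unitDir (φ + 2 * (Real.pi / 3)) = unitDir (ψ + Real.pi + 2 * (Real.pi / 3)) := by
      rw [unitDir_add_two_mul_pi_div_three, unitDir_add_two_mul_pi_div_three, unitDir_add_pi,
        add_right_comm, unitDir_add_pi]
      linear_combination (norm := module) h2 - h1
    have h4 := unitDir_add_congr h3 (-(2 * (Real.pi / 3)))
    rw [add_neg_cancel_right, add_neg_cancel_right] at h4
    have h5 := unitDir_add_congr h4 (Real.pi / 3)
    rw [unitDir_add_pi] at h4
    rw [add_right_comm, unitDir_add_pi] at h5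
    have hc : c' = c + latticeMap ψ (1, 1) := by
      rw [latticeMap_apply, one_smul, one_smul]
      rw [h4] at h2
      linear_combination (norm := module) -h2
    refine ⟨ψ, unitHexagon_eq_image c ψ, ?_⟩
    rw [unitHexagon_eq_image, hc]
    have hneg : ∀ w, latticeMap φ w = latticeMap ψ (-w) := fun w => by
      rw [latticeMap_apply, latticeMap_apply, h4, h5]
      simp
    ext z
    constructor
    · rintro ⟨w, hw, rfl⟩
      refine ⟨-w, ?_, ?_⟩
      · simpa [latticeHexagon, ← neg_add_rev, abs_neg, add_comm] using hw
      · simp only [hneg, map_add]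
        abel
    · rintro ⟨w, hw, rfl⟩
      refine ⟨-w, ?_, ?_⟩
      · simpa [latticeHexagon, ← neg_add_rev, abs_neg, add_comm] using hw
      · simp only [hneg, map_add, neg_neg]
        abel

end geometry

/-! ### Transfer to random points in the plane -/

lemma cond_image_latticeMap (c : EuclideanSpace ℝ (Fin 2)) (ψ : ℝ) :
    ProbabilityTheory.cond volume ((fun w => c + latticeMap ψ w) '' latticeHexagon) =
      latticeUniform.map fun w => c + latticeMap ψ w := by
  let L : (ℝ × ℝ) ≃L[ℝ] EuclideanSpace ℝ (Fin 2) :=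
    ((latticeMap ψ).linearEquivOfInjective (latticeMap_injective ψ)
      (by simp)).toContinuousLinearEquiv
  let f : ℝ × ℝ → EuclideanSpace ℝ (Fin 2) := fun w => c + latticeMap ψ w
  have hf : f = (fun z => c + z) ∘ L := rfl
  have hemb : MeasurableEmbedding f := by
    rw [hf]
    exact (measurableEmbedding_addLeft c).comp L.toHomeomorph.measurableEmbedding
  -- Uniqueness of Haar measure provides the factor `k`. Its value is irrelevant, since it cancels
  -- on normalising.
  have hvol : ∃ k : ENNReal, k ≠ 0 ∧ k ≠ ⊤ ∧ (volume : Measure (ℝ × ℝ)).map f = k • volume := by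
    have hH : ((volume : Measure (ℝ × ℝ)).map L).IsAddHaarMeasure := L.isAddHaarMeasure_map _
    refine ⟨Measure.addHaarScalarFactor (Measure.map L volume) volume, ?_,
      ENNReal.coe_ne_top, ?_⟩
    · exact_mod_cast (Measure.addHaarScalarFactor_pos_of_isAddHaarMeasure _ _).ne'
    · rw [hf, ← Measure.map_map (measurable_const_add c) L.continuous.measurable]
      refine (map_add_left_eq_self (Measure.map L volume) c).trans ?_
      exact Measure.isAddLeftInvariant_eq_smul (Measure.map L volume) volume
  obtain ⟨k, hk0, hkt, hk⟩ := hvol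
  have hA : volume latticeHexagon = k * volume (f '' latticeHexagon) := by
    rw [← smul_eq_mul, ← Measure.smul_apply, ← hk, hemb.map_apply,
      Set.preimage_image_eq _ hemb.injective]
  have hres : (volume.restrict latticeHexagon).map f =
      k • volume.restrict (f '' latticeHexagon) := by
    rw [← Measure.restrict_smul, ← hk, hemb.restrict_map, Set.preimage_image_eq _ hemb.injective]
  change ProbabilityTheory.cond volume (f '' latticeHexagon) = latticeUniform.map f
  unfold latticeUniform ProbabilityTheory.cond
  rw [Measure.map_smul, hres, smul_smul, hA, ENNReal.mul_inv (.inl hk0) (.inl hkt),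
    mul_right_comm, ENNReal.inv_mul_cancel hk0 hkt, one_mul]

instance : IsProbabilityMeasure latticeUniform :=
  cond_isProbabilityMeasure_of_finite (by rw [volume_latticeHexagon]; simp)
    (by rw [volume_latticeHexagon]; simp)

lemma continuous_add_latticeMap (c : EuclideanSpace ℝ (Fin 2)) (ψ : ℝ) :
    Continuous fun w => c + latticeMap ψ w :=
  continuous_const.add (latticeMap ψ).continuous_of_finiteDimensional

/-- The push-forward along a map that is not almost everywhere measurable is zero by convention.
Measurability of `X` and `Y` can thus be read off from their being uniform. -/
lemma aemeasurable_of_isProbabilityMeasure_map {Ω E : Type*} [MeasurableSpace Ω]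
    [MeasurableSpace E] {P : Measure Ω} {Z : Ω → E} (h : IsProbabilityMeasure (P.map Z)) :
    AEMeasurable Z P := by
  by_contra hZ
  exact IsProbabilityMeasure.ne_zero (P.map Z) (Measure.map_of_not_aemeasurable hZ)

lemma map_dist_of_indepFun {Ω E V : Type*} [MeasurableSpace Ω] [PseudoMetricSpace E]
    [SecondCountableTopology E] [MeasurableSpace E] [BorelSpace E] [MeasurableSpace V]
    {P : Measure Ω} [IsProbabilityMeasure P] {U : Measure V} [IsProbabilityMeasure U]
    {X Y : Ω → E} {f g : V → E} (hf : Measurable f) (hg : Measurable g)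
    (hX : P.map X = U.map f) (hY : P.map Y = U.map g) (hXY : IndepFun X Y P) :
    AEMeasurable (fun ω => dist (X ω) (Y ω)) P ∧
      P.map (fun ω => dist (X ω) (Y ω)) =
        (U.prod U).map fun x => dist (f x.1) (g x.2) := by
  have haX : AEMeasurable X P := aemeasurable_of_isProbabilityMeasure_map
    (hX ▸ Measure.isProbabilityMeasure_map hf.aemeasurable)
  have haY : AEMeasurable Y P := aemeasurable_of_isProbabilityMeasure_map
    (hY ▸ Measure.isProbabilityMeasure_map hg.aemeasurable)
  have hjoint := (indepFun_iff_map_prod_eq_prod_map_map haX haY).1 hXY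
  have hdist : Measurable fun z : E × E => dist z.1 z.2 := continuous_dist.measurable
  refine ⟨hdist.comp_aemeasurable (haX.prodMk haY), ?_⟩
  have hcomp : (fun ω => dist (X ω) (Y ω)) =
      (fun z : E × E => dist z.1 z.2) ∘ fun ω => (X ω, Y ω) := rfl
  rw [hcomp, ← AEMeasurable.map_map_of_aemeasurable hdist.aemeasurable (haX.prodMk haY), hjoint,
    hX, hY, Measure.map_prod_map _ _ hf hg, Measure.map_map hdist (hf.prodMap hg)]
  rfl

lemma dist_add_latticeMap (c : EuclideanSpace ℝ (Fin 2)) (ψ : ℝ) (v w : ℝ × ℝ) :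
    dist (c + latticeMap ψ v) (c + latticeMap ψ (w + (1, 1))) =
      latticeNorm (w - v + (1, 1)) := by
  rw [dist_comm, dist_add_left, dist_eq_norm, ← map_sub, norm_latticeMap, add_sub_right_comm]

/-- The law of the distance between independent uniform points of two adjacent hexagons. -/
theorem map_dist_eq_withDensity {Ω : Type*} [MeasurableSpace Ω] {P : Measure Ω}
    [IsProbabilityMeasure P] {c c' : EuclideanSpace ℝ (Fin 2)} {θ θ' : ℝ}
    (hside : ShareSide c θ c' θ') {X Y : Ω → EuclideanSpace ℝ (Fin 2)}
    (hX : pdf.IsUniform X (unitHexagon c θ) P volume)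
    (hY : pdf.IsUniform Y (unitHexagon c' θ') P volume) (hXY : IndepFun X Y P) :
    AEMeasurable (fun ω => dist (X ω) (Y ω)) P ∧
    P.map (fun ω => dist (X ω) (Y ω)) =
      volume.withDensity fun d => ENNReal.ofReal (hexPairPDF d) := by
  obtain ⟨ψ, h1, h2⟩ := hside.exists_latticeMap
  have e : (fun w => c + latticeMap ψ (w + (1, 1))) =
      fun w => c + latticeMap ψ (1, 1) + latticeMap ψ w := by
    funext w
    rw [map_add, add_assoc, add_comm (latticeMap ψ w)]
  have hX' : P.map X = latticeUniform.map fun w => c + latticeMap ψ w := by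
    rw [← cond_image_latticeMap, ← h1]
    exact hX
  have hY' : P.map Y = latticeUniform.map fun w => c + latticeMap ψ (w + (1, 1)) := by
    rw [e, ← cond_image_latticeMap, ← e, ← h2]
    exact hY
  have h := map_dist_of_indepFun (continuous_add_latticeMap c ψ).measurable
    (e ▸ (continuous_add_latticeMap (c + latticeMap ψ (1, 1)) ψ).measurable) hX' hY' hXY
  simp only [dist_add_latticeMap] at h
  rwa [map_latticeNorm_latticeUniform] at h

theorem mainTheorem2 {Ω : Type*} [MeasurableSpace Ω] (P : Measure Ω) [IsProbabilityMeasure P]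
    (c c' : EuclideanSpace ℝ (Fin 2)) (θ θ' : ℝ) (hside : ShareSide c θ c' θ')
    (X Y : Ω → EuclideanSpace ℝ (Fin 2))
    (hX : pdf.IsUniform X (unitHexagon c θ) P volume)
    (hY : pdf.IsUniform Y (unitHexagon c' θ') P volume)
    (hXY : IndepFun X Y P) :
    (∀ d : ℝ, 0 ≤ hexPairPDF d) ∧
    P.map (fun ω => dist (X ω) (Y ω)) =
      volume.withDensity (fun d => ENNReal.ofReal (hexPairPDF d)) ∧
    ∀ d : ℝ, P.real {ω | dist (X ω) (Y ω) ≤ d} = hexPairCDF d := by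
  obtain ⟨hae, hlaw⟩ := map_dist_eq_withDensity hside hX hY hXY
  refine ⟨hexPairPDF_nonneg, hlaw, fun d => ?_⟩
  have hmeas : Measurable hexPairPDF := by
    unfold hexPairPDF
    refine Measurable.ite measurableSet_Iio measurable_const ?_
    repeat' refine Measurable.ite measurableSet_Iic (by fun_prop) ?_
    exact measurable_const
  have hprob : IsProbabilityMeasure (P.map fun ω => dist (X ω) (Y ω)) :=
    Measure.isProbabilityMeasure_map hae
  -- Integrability comes from the law having total mass 1, not from bounding the pieces.
  have hint : Integrable hexPairPDF := by
    refine ⟨hmeas.aestronglyMeasurable, ?_⟩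
    rw [hasFiniteIntegral_iff_ofReal (.of_forall hexPairPDF_nonneg)]
    have h := hprob.measure_univ
    rw [hlaw, withDensity_apply _ MeasurableSet.univ, Measure.restrict_univ] at h
    rw [h]
    exact ENNReal.one_lt_top
  have hreal : ∀ s : Set ℝ, MeasurableSet s →
      (P.map fun ω => dist (X ω) (Y ω)).real s = ∫ x in s, hexPairPDF x := fun s hs => by
    rw [hlaw, measureReal_def, withDensity_apply _ hs,
      ← ofReal_integral_eq_lintegral_ofReal hint.integrableOn (.of_forall hexPairPDF_nonneg),
      ENNReal.toReal_ofReal (integral_nonneg hexPairPDF_nonneg)]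
  have hIic : P.real {ω | dist (X ω) (Y ω) ≤ d} =
      (P.map fun ω => dist (X ω) (Y ω)).real (Set.Iic d) := by
    rw [measureReal_def, measureReal_def, Measure.map_apply_of_aemeasurable hae measurableSet_Iic]
    rfl
  have hIi : ∀ x ∈ Set.Iio (0 : ℝ), hexPairPDF x = 0 := fun x hx => hexPairPDF_of_neg hx
  rw [hIic]
  rcases lt_or_ge d 0 with h0 | h0
  · rw [hreal _ measurableSet_Iic, hexPairCDF, if_pos h0]
    exact setIntegral_eq_zero_of_forall_eq_zero fun x hx => hIi x (lt_of_le_of_lt hx h0)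
  rcases le_or_gt d (√13) with h13 | h13
  · rw [hreal _ measurableSet_Iic, ← integral_hexPairPDF (fun a b => hint.intervalIntegrable) h0 h13,
      intervalIntegral.integral_of_le h0, ← Set.Iic_union_Ioc_eq_Iic h0,
      setIntegral_union (Set.Iic_disjoint_Ioc le_rfl) measurableSet_Ioc hint.integrableOn
        hint.integrableOn, integral_Iic_eq_integral_Iio,
      setIntegral_eq_zero_of_forall_eq_zero hIi, zero_add]
  -- Beyond √13 the density vanishes, so the complement has no mass; `cdfSeventh` need not be
  -- evaluated at √13.
  · have hcompl : (P.map fun ω => dist (X ω) (Y ω)).real (Set.Iic d)ᶜ = 0 := by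
      rw [hreal _ measurableSet_Iic.compl, Set.compl_Iic]
      exact setIntegral_eq_zero_of_forall_eq_zero fun x hx => hexPairPDF_far (h13.trans hx)
    rw [hexPairCDF_far h13]
    have := probReal_add_probReal_compl (μ := P.map fun ω => dist (X ω) (Y ω))
      (measurableSet_Iic (a := d))
    rw [hcompl, add_zero] at this
    exact this
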